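/- Let $k$ be a field, $\mathcal V$ a rigid braided monoidal category that is $k$-linear with bilinear tensor product and has finite direct sums, and $G$ a finite group. **$\mathcal V$-monoidal side.** A $\mathcal V$-monoidal category $\mathscr C$ is a $\mathcal V$-enriched category with a unit object $1$, tensor products of objects, and tensor product morphisms $\mathscr C(a\to c)\otimes\mathscr C(b\to d)\to\mathscr C(ab\to cd)$ which preserve identities, satisfy the braided interchange law with composition, and are associative and unital up to coherent $\mathcal V$-natural isomorphisms of the underlying category; it is strict if these isomorphisms are identities. Its underlying category $\mathscr C^{\mathcal V}$ has the same objects and morphisms $\mathscr C^{\mathcal V}(a\to b)=\mathcal V(1_{\mathcal V}\to\mathscr C(a\to b))$; it is a $k$-linear monoidal category. $\mathscr C$ is *rigid* if $\mathscr C^{\mathcal V}$ is; *weakly tensored* if every functor $\mathscr C(a\to-):\mathscr C^{\mathcal V}\to\mathcal V$ has a left adjoint; *tensored* if every $\mathcal V$-functor $\mathscr C(a\to -)$ to the self-enrichment of $\mathcal V$ has a left $\mathcal V$-adjoint. A *$G$-grading* $\mathscr C=\bigoplus_g\mathscr C_g$ is a family of full replete subcategories such that $\mathscr C^{\mathcal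 V}$ is additive, each object is a direct sum $\bigoplus_g c_g$ with $c_g\in\mathscr C_g$, $\mathscr C(a\to b)=0$ for $a\in\mathscr C_g$, $b\in\mathscr C_h$, $g\ne h$, and $\mathscr C_g\otimes\mathscr C_h\subseteq\mathscr C_{gh}$. It is *faithful* if every $\mathscr C_g$ has a non-zero hom object. An *equivalence* is a strong $\mathcal V$-monoidal functor that is an isomorphism on hom objects and essentially surjective, whose underlying functor is additive, and which maps each $\mathscr C_g$ to $\mathscr D_g$. **Module side.** A $\mathcal V$-module tensor category is a $k$-linear monoidal category $C$ with a $k$-linear, strongly unital, oplax monoidal, braided functor $\mathcal F_C^Z:\mathcal V\to Z(C)$ to the Drinfeld center (half-braidings $e_{a,X}:aX\to Xa$, braiding $e_{X,Y}$). Let $\mathcal F_C:\mathcal V\to C$ be its composite with the forgetful functor. It is *rigid* if $C$ is; *weakly tensored* if $\mathcal F_C$ has a right adjoint; *tensored* if moreover $\mathcal F_C$ is strong monoidal. A *$G$-grading* $C=\bigoplus_gC_g$ is a family of full replete subcategories such that $C$ is additive, each object is a direct sum $\bigoplus_g c_g$ with $c_g\in C_g$, $C(a\to b)=0$ for $a\in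 C_g$, $b\in C_h$, $g\neq h$, $C_g\otimes C_h\subseteq C_{gh}$ and $\mathcal F_C(\mathcal V)\subseteq C_e$. It is *faithful* if every $C_g$ contains a non-zero morphism. An *equivalence* is a triple $(R,\rho,r)$ of an additive strong monoidal equivalence $(R,\rho):C\to D$ with $R(C_g)\subseteq D_g$ and a natural isomorphism $r:\mathcal F_D\Rightarrow R\mathcal F_C$ compatible with the units, the oplax structures and the half-braidings. **Theorem.** On both sides, equivalence is an equivalence relation, and there is a bijection of equivalence classes $$\left\{\text{faithfully } G\text{-graded weakly tensored rigid } \mathcal V\text{-monoidal categories } \mathscr C=\textstyle\bigoplus_g\mathscr C_g\right\}\;\cong\;\left\{\text{faithfully } G\text{-graded weakly tensored rigid } \mathcal V\text{-module tensor categories } (C=\textstyle\bigoplus_g C_g,\mathcal F_C^Z)\right\},$$ and likewise with "tensored" in place of "weakly tensored", and in both cases also when only strict categories are considered on both sides. The bijection sends the class of $\mathscr C$ to the class of $(\mathscr C^{\mathcal V},\mathcal F^Z)$ with the same grading, where $\mathcal F^Z$ exists and is characterized as follows: $\mathcal F$ is left adjoint to $x\mapsto\mathscr C(1\to x)$, with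 unit $\eta$; the counit $\mathcal F(1_{\mathcal V})\to 1$ and the oplax structure $\mathcal F(uv)\to\mathcal F(u)\mathcal F(v)$ are the mates of $j_1:1_{\mathcal V}\to\mathscr C(1\to1)$ and of $\eta_u\otimes\eta_v:uv\to\mathscr C(1\to\mathcal F(u)\mathcal F(v))$; and the half-braiding $e_{a,\mathcal F(v)}:a\mathcal F(v)\to\mathcal F(v)a$ is the morphism with $(j_a\otimes\eta_v)\circ e_{a,\mathcal F(v)}=\eta_v\otimes j_a$ as morphisms $v\to\mathscr C(a\to\mathcal F(v)a)$ (composition written from left to right). -/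

import Mathlib

open CategoryTheory MonoidalCategory Limits

universe w v u u₁ u₂

noncomputable section

namespace VEnriched

section Basic

variable (V : Type v) [Category.{w} V] [MonoidalCategory V]
variable {A : Type u} [EnrichedCategory V A]

/-- The underlying category of a `V`-category: morphisms `a ⟶ b` are the morphisms
`𝟙_ V ⟶ (a ⟶[V] b)` of `V`. -/
abbrev Und (A : Type u) [EnrichedCategory V A] : Type u := ForgetEnrichment V A

/-- Composition with a `𝟙_ V`-graded morphism `g : b ⟶ c` on the target side. -/
def postcomp (a : A) {b c : A} (g : 𝟙_ V ⟶ (b ⟶[V] c)) : (a ⟶[V] b) ⟶ (a ⟶[V] c) :=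
  (ρ_ _).inv ≫ ((a ⟶[V] b) ◁ g) ≫ eComp V a b c

/-- Composition with a `𝟙_ V`-graded morphism `f : a ⟶ b` on the source side. -/
def precomp {a b : A} (f : 𝟙_ V ⟶ (a ⟶[V] b)) (c : A) : (b ⟶[V] c) ⟶ (a ⟶[V] c) :=
  (λ_ _).inv ≫ (f ▷ (b ⟶[V] c)) ≫ eComp V a b c

variable {V}

theorem und_hom_ext {a b : Und V A} {f g : a ⟶ b}
    (h : ForgetEnrichment.homTo V f = ForgetEnrichment.homTo V g) : f = g := h

theorem homTo_comp_eq_postcomp {a b c : Und V A} (f : a ⟶ b) (g : b ⟶ c) :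
    ForgetEnrichment.homTo V (f ≫ g) =
      ForgetEnrichment.homTo V f ≫ postcomp V a.to (ForgetEnrichment.homTo V g) := by
  rw [ForgetEnrichment.homTo_comp, postcomp, MonoidalCategory.tensorHom_def]
  simp only [Category.assoc]
  rw [unitors_inv_equal, ← rightUnitor_inv_naturality_assoc]

theorem homTo_comp_eq_precomp {a b c : Und V A} (f : a ⟶ b) (g : b ⟶ c) :
    ForgetEnrichment.homTo V (f ≫ g) =
      ForgetEnrichment.homTo V g ≫ precomp V (ForgetEnrichment.homTo V f) c.to := by
  rw [ForgetEnrichment.homTo_comp, precomp, tensorHom_def']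
  simp only [Category.assoc]
  rw [← leftUnitor_inv_naturality_assoc]

end Basic

section Monoidal

variable (V : Type v) [Category.{w} V] [MonoidalCategory V]

/-- The data of a tensor product on a `V`-category: a unit object, tensor products of objects,
and tensor product morphisms `A(a → c) ⊗ A(b → d) ⟶ A(a b → c d)`. -/
class VMonoidalStruct (A : Type u) [EnrichedCategory V A] where
  one : A
  tensorObj : A → A → A
  tensorHom : ∀ a b c d : A,
    ((a ⟶[V] c) ⊗ (b ⟶[V] d)) ⟶ (tensorObj a b ⟶[V] tensorObj c d)


variable {A : Type u} [EnrichedCategory V A]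

/-- The unit object. -/
abbrev vOne (A : Type u) [EnrichedCategory V A] [VMonoidalStruct V A] : A :=
  VMonoidalStruct.one V

/-- The tensor product of objects. -/
abbrev vObj [VMonoidalStruct V A] (a b : A) : A := VMonoidalStruct.tensorObj V a b

/-- The tensor product morphism. -/
abbrev vHom [VMonoidalStruct V A] (a b c d : A) :
    ((a ⟶[V] c) ⊗ (b ⟶[V] d)) ⟶ (vObj V a b ⟶[V] vObj V c d) :=
  VMonoidalStruct.tensorHom a b c d

/-- The tensor product of two `𝟙_ V`-graded morphisms. -/
def undTensor [VMonoidalStruct V A] {a b c d : Und V A} (f : a ⟶ c) (g : b ⟶ d) :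
    ForgetEnrichment.of V (vObj V a.to b.to) ⟶ ForgetEnrichment.of V (vObj V c.to d.to) :=
  ForgetEnrichment.homOf V ((λ_ (𝟙_ V)).inv ≫
    (ForgetEnrichment.homTo V f ⊗ₘ ForgetEnrichment.homTo V g) ≫ vHom V a.to b.to c.to d.to)

open ForgetEnrichment in
/-- A `V`-monoidal category, for `V` braided. The associator and the unitors are
`𝟙_ V`-graded isomorphisms, that is isomorphisms of the underlying category; they are `V`-natural
and satisfy the pentagon and triangle identities. -/
class VMonoidalCategory [BraidedCategory V] (A : Type u) [EnrichedCategory V A] extends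
    VMonoidalStruct V A where
  associator : ∀ a b c : A, of V (vObj V (vObj V a b) c) ≅ of V (vObj V a (vObj V b c))
  leftUnitor : ∀ a : A, of V (vObj V (vOne V A) a) ≅ of V a
  rightUnitor : ∀ a : A, of V (vObj V a (vOne V A)) ≅ of V a
  tensor_id : ∀ a b : A, (λ_ (𝟙_ V)).inv ≫ (eId V a ⊗ₘ eId V b) ≫ vHom V a b a b =
    eId V (vObj V a b)
  /-- The braided interchange law; `tensorμ` braids the second and the third factor. -/
  interchange : ∀ a b c d e f : A,
    (vHom V a d b e ⊗ₘ vHom V b e c f) ≫ eComp V (vObj V a d) (vObj V b e) (vObj V c f) =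
      tensorμ (a ⟶[V] b) (d ⟶[V] e) (b ⟶[V] c) (e ⟶[V] f) ≫
        (eComp V a b c ⊗ₘ eComp V d e f) ≫ vHom V a d c f
  associator_naturality : ∀ a b c d e f : A,
    (vHom V a b d e ▷ (c ⟶[V] f)) ≫ vHom V (vObj V a b) c (vObj V d e) f ≫
        postcomp V _ (homTo V (associator d e f).hom) =
      (α_ _ _ _).hom ≫ ((a ⟶[V] d) ◁ vHom V b c e f) ≫ vHom V a (vObj V b c) d (vObj V e f) ≫
        precomp V (homTo V (associator a b c).hom) _
  leftUnitor_naturality : ∀ a b : A,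
    (λ_ _).inv ≫ (eId V (vOne V A) ▷ (a ⟶[V] b)) ≫ vHom V (vOne V A) a (vOne V A) b ≫
        postcomp V _ (homTo V (leftUnitor b).hom) =
      precomp V (homTo V (leftUnitor a).hom) b
  rightUnitor_naturality : ∀ a b : A,
    (ρ_ _).inv ≫ ((a ⟶[V] b) ◁ eId V (vOne V A)) ≫ vHom V a (vOne V A) b (vOne V A) ≫
        postcomp V _ (homTo V (rightUnitor b).hom) =
      precomp V (homTo V (rightUnitor a).hom) b
  pentagon : ∀ a b c d : A,
    undTensor V (associator a b c).hom (𝟙 (of V d)) ≫ (associator a (vObj V b c) d).hom ≫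
        undTensor V (𝟙 (of V a)) (associator b c d).hom =
      (associator (vObj V a b) c d).hom ≫ (associator a b (vObj V c d)).hom
  triangle : ∀ a b : A,
    (associator a (vOne V A) b).hom ≫ undTensor V (𝟙 (of V a)) (leftUnitor b).hom =
      undTensor V (rightUnitor a).hom (𝟙 (of V b))

end Monoidal

section Underlying

variable (V : Type v) [Category.{w} V] [MonoidalCategory V] [BraidedCategory V]
variable (A : Type u) [EnrichedCategory V A] [VMonoidalCategory V A]

open ForgetEnrichment

instance undMonoidalStruct : MonoidalCategoryStruct (Und V A) where
  tensorObj a b := of V (vObj V a.to b.to)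
  tensorUnit := of V (vOne V A)
  tensorHom f g := undTensor V f g
  whiskerLeft a _ _ f := undTensor V (𝟙 a) f
  whiskerRight f b := undTensor V f (𝟙 b)
  associator a b c := VMonoidalCategory.associator a.to b.to c.to
  leftUnitor a := VMonoidalCategory.leftUnitor a.to
  rightUnitor a := VMonoidalCategory.rightUnitor a.to

variable {V A}

theorem homTo_undTensor {a b c d : Und V A} (f : a ⟶ c) (g : b ⟶ d) :
    homTo V (undTensor V f g) = (λ_ (𝟙_ V)).inv ≫ (homTo V f ⊗ₘ homTo V g) ≫
      vHom V a.to b.to c.to d.to := rfl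

theorem undTensor_id (a b : Und V A) :
    undTensor V (𝟙 a) (𝟙 b) = 𝟙 (of V (vObj V a.to b.to)) := by
  apply und_hom_ext
  rw [homTo_undTensor, homTo_id, homTo_id, homTo_id]
  exact VMonoidalCategory.tensor_id _ _

theorem undTensor_comp {a b c d e f : Und V A} (x : a ⟶ b) (y : d ⟶ e) (x' : b ⟶ c)
    (y' : e ⟶ f) :
    undTensor V x y ≫ undTensor V x' y' = undTensor V (x ≫ x') (y ≫ y') := by
  apply und_hom_ext
  rw [homTo_comp]
  simp only [homTo_undTensor, homTo_comp]
  simp only [← tensorHom_comp_tensorHom, Category.assoc]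
  have h := VMonoidalCategory.interchange (V := V) a.to b.to c.to d.to e.to f.to
  erw [h]
  rw [tensorμ_natural_assoc]
  rw [show tensorμ (𝟙_ V) (𝟙_ V) (𝟙_ V) (𝟙_ V) = 𝟙 _ by
    rw [tensorμ, braiding_tensorUnit_left]; monoidal, Category.id_comp]

/-- The tensor product of `𝟙_ V`-graded morphisms, seen in `V`. -/
def ptTensor {a b c d : A} (f : 𝟙_ V ⟶ (a ⟶[V] c)) (g : 𝟙_ V ⟶ (b ⟶[V] d)) :
    𝟙_ V ⟶ (vObj V a b ⟶[V] vObj V c d) :=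
  (λ_ (𝟙_ V)).inv ≫ (f ⊗ₘ g) ≫ vHom V a b c d

theorem ptTensor_assoc {a b c d e f : A} (x : 𝟙_ V ⟶ (a ⟶[V] d)) (y : 𝟙_ V ⟶ (b ⟶[V] e))
    (z : 𝟙_ V ⟶ (c ⟶[V] f)) :
    ptTensor (ptTensor x y) z ≫
        postcomp V _ (homTo V (VMonoidalCategory.associator d e f).hom) =
      ptTensor x (ptTensor y z) ≫
        precomp V (homTo V (VMonoidalCategory.associator a b c).hom) _ := by
  have h := VMonoidalCategory.associator_naturality (V := V) a b c d e f
  calc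
    _ = (λ_ (𝟙_ V)).inv ≫ ((λ_ (𝟙_ V)).inv ▷ 𝟙_ V) ≫ ((x ⊗ₘ y) ⊗ₘ z) ≫
          (vHom V a b d e ▷ _) ≫ vHom V _ c _ f ≫
          postcomp V _ (homTo V (VMonoidalCategory.associator d e f).hom) := by
      simp only [ptTensor, ← tensorHom_id, tensorHom_comp_tensorHom_assoc, Category.assoc,
        Category.id_comp, Category.comp_id]
    _ = (λ_ (𝟙_ V)).inv ≫ (𝟙_ V ◁ (λ_ (𝟙_ V)).inv) ≫ (x ⊗ₘ (y ⊗ₘ z)) ≫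
          (_ ◁ vHom V b c e f) ≫ vHom V a _ d _ ≫
          precomp V (homTo V (VMonoidalCategory.associator a b c).hom) _ := by
      rw [h, associator_naturality_assoc]
      simp only [← Category.assoc]
      congr 4
      monoidal
    _ = _ := by
      simp only [ptTensor, ← id_tensorHom, tensorHom_comp_tensorHom_assoc, Category.assoc,
        Category.id_comp, Category.comp_id]

theorem ptTensor_leftUnit {a b : A} (f : 𝟙_ V ⟶ (a ⟶[V] b)) :
    ptTensor (eId V (vOne V A)) f ≫
        postcomp V _ (homTo V (VMonoidalCategory.leftUnitor b).hom) =
      f ≫ precomp V (homTo V (VMonoidalCategory.leftUnitor a).hom) b := by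
  rw [← VMonoidalCategory.leftUnitor_naturality a b, leftUnitor_inv_naturality_assoc,
    ptTensor, tensorHom_def']
  simp only [Category.assoc]

theorem ptTensor_rightUnit {a b : A} (f : 𝟙_ V ⟶ (a ⟶[V] b)) :
    ptTensor f (eId V (vOne V A)) ≫
        postcomp V _ (homTo V (VMonoidalCategory.rightUnitor b).hom) =
      f ≫ precomp V (homTo V (VMonoidalCategory.rightUnitor a).hom) b := by
  rw [← VMonoidalCategory.rightUnitor_naturality a b, rightUnitor_inv_naturality_assoc,
    ptTensor, MonoidalCategory.tensorHom_def, unitors_inv_equal]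
  simp only [Category.assoc]

theorem undAssoc_naturality {a b c d e f : Und V A} (x : a ⟶ d) (y : b ⟶ e) (z : c ⟶ f) :
    undTensor V (undTensor V x y) z ≫ (VMonoidalCategory.associator d.to e.to f.to).hom =
      (VMonoidalCategory.associator a.to b.to c.to).hom ≫ undTensor V x (undTensor V y z) := by
  apply und_hom_ext
  rw [homTo_comp_eq_postcomp, homTo_comp_eq_precomp]
  exact ptTensor_assoc (homTo V x) (homTo V y) (homTo V z)

theorem undLeftUnitor_naturality {a b : Und V A} (f : a ⟶ b) :
    undTensor V (𝟙 (of V (vOne V A))) f ≫ (VMonoidalCategory.leftUnitor b.to).hom =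
      (VMonoidalCategory.leftUnitor a.to).hom ≫ f := by
  apply und_hom_ext
  rw [homTo_comp_eq_postcomp, homTo_comp_eq_precomp, homTo_undTensor, homTo_id]
  exact ptTensor_leftUnit (homTo V f)

theorem undRightUnitor_naturality {a b : Und V A} (f : a ⟶ b) :
    undTensor V f (𝟙 (of V (vOne V A))) ≫ (VMonoidalCategory.rightUnitor b.to).hom =
      (VMonoidalCategory.rightUnitor a.to).hom ≫ f := by
  apply und_hom_ext
  rw [homTo_comp_eq_postcomp, homTo_comp_eq_precomp, homTo_undTensor, homTo_id]
  exact ptTensor_rightUnit (homTo V f)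

variable (V A) in
/-- The underlying monoidal category of a `V`-monoidal category. -/
instance undMonoidal : MonoidalCategory (Und V A) :=
  MonoidalCategory.ofTensorHom
    (id_tensorHom_id := fun a b => undTensor_id a b)
    (id_tensorHom := fun _ _ _ _ => rfl)
    (tensorHom_id := fun _ _ => rfl)
    (tensorHom_comp_tensorHom := fun f g f' g' => undTensor_comp f g f' g')
    (associator_naturality := fun f g h => undAssoc_naturality f g h)
    (leftUnitor_naturality := fun f => undLeftUnitor_naturality f)
    (rightUnitor_naturality := fun f => undRightUnitor_naturality f)
    (pentagon := fun a b c d => VMonoidalCategory.pentagon a.to b.to c.to d.to)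
    (triangle := fun a b => VMonoidalCategory.triangle a.to b.to)

theorem homTo_whiskerLeft (a : Und V A) {b c : Und V A} (f : b ⟶ c) :
    homTo V (a ◁ f) = (λ_ (𝟙_ V)).inv ≫ (homTo V (𝟙 a) ⊗ₘ homTo V f) ≫
      vHom V a.to b.to a.to c.to := rfl

theorem homTo_whiskerRight (a : Und V A) {b c : Und V A} (f : b ⟶ c) :
    homTo V (f ▷ a) = (λ_ (𝟙_ V)).inv ≫ (homTo V f ⊗ₘ homTo V (𝟙 a)) ≫
      vHom V b.to a.to c.to a.to := rfl

end Underlying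

section Linear

variable (V : Type v) [Category.{w} V] [MonoidalCategory V] [Preadditive V]
variable (A : Type u) [EnrichedCategory V A]

open ForgetEnrichment

/-- The underlying category of a `V`-category is preadditive when `V` is. -/
instance undPreadditive : Preadditive (Und V A) where
  homGroup a b := inferInstanceAs (AddCommGroup (𝟙_ V ⟶ (a.to ⟶[V] b.to)))
  add_comp a b c f f' g := by
    apply und_hom_ext
    rw [homTo_comp_eq_postcomp]
    exact (Preadditive.add_comp _ _ _ (homTo V f) (homTo V f') _).trans
      (by rw [← homTo_comp_eq_postcomp, ← homTo_comp_eq_postcomp]; rfl)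
  comp_add a b c f g g' := by
    apply und_hom_ext
    rw [homTo_comp_eq_precomp]
    exact (Preadditive.add_comp _ _ _ (homTo V g) (homTo V g') _).trans
      (by rw [← homTo_comp_eq_precomp, ← homTo_comp_eq_precomp]; rfl)

variable {V A} in
theorem homTo_add {a b : Und V A} (f g : a ⟶ b) :
    homTo V (f + g) = homTo V f + homTo V g := rfl

variable {V A} in
theorem homTo_zero {a b : Und V A} : homTo V (0 : a ⟶ b) = 0 := rfl

variable (k : Type u₁) [Field k] [CategoryTheory.Linear k V]

/-- The underlying category of a `V`-category is linear when `V` is. -/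
instance undLinear : CategoryTheory.Linear k (Und V A) where
  homModule a b := inferInstanceAs (Module k (𝟙_ V ⟶ (a.to ⟶[V] b.to)))
  smul_comp a b c r f g := by
    apply und_hom_ext
    rw [homTo_comp_eq_postcomp]
    exact (Linear.smul_comp _ _ _ r (homTo V f) _).trans
      (by rw [← homTo_comp_eq_postcomp]; rfl)
  comp_smul a b c f r g := by
    apply und_hom_ext
    rw [homTo_comp_eq_precomp]
    exact (Linear.smul_comp _ _ _ r (homTo V g) _).trans
      (by rw [← homTo_comp_eq_precomp]; rfl)

variable {V A k} in
theorem homTo_smul {a b : Und V A} (r : k) (f : a ⟶ b) :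
    homTo V (r • f) = r • homTo V f := rfl

variable [BraidedCategory V] [MonoidalPreadditive V] [VMonoidalCategory V A]

instance undMonoidalPreadditive : MonoidalPreadditive (Und V A) where
  whiskerLeft_zero := by
    intros; apply und_hom_ext; simp only [homTo_whiskerLeft, homTo_zero]; simp
  zero_whiskerRight := by
    intros; apply und_hom_ext; simp only [homTo_whiskerRight, homTo_zero]; simp
  whiskerLeft_add := by
    intros; apply und_hom_ext
    simp only [homTo_whiskerLeft, homTo_add, MonoidalPreadditive.tensor_add,
      Preadditive.add_comp, Preadditive.comp_add]
  add_whiskerRight := by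
    intros; apply und_hom_ext
    simp only [homTo_whiskerRight, homTo_add, MonoidalPreadditive.add_tensor,
      Preadditive.add_comp, Preadditive.comp_add]

instance undMonoidalLinear [MonoidalLinear k V] : MonoidalLinear k (Und V A) where
  whiskerLeft_smul := by
    intros; apply und_hom_ext
    simp only [homTo_whiskerLeft, homTo_smul, MonoidalCategory.tensorHom_def, MonoidalLinear.whiskerLeft_smul,
      Linear.smul_comp, Linear.comp_smul]
  smul_whiskerRight := by
    intros; apply und_hom_ext
    simp only [homTo_whiskerRight, homTo_smul, MonoidalCategory.tensorHom_def, MonoidalLinear.smul_whiskerRight,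
      Linear.smul_comp, Linear.comp_smul]

end Linear

section Tensored

variable (V : Type v) [Category.{w} V] [MonoidalCategory V]
variable {A : Type u} [EnrichedCategory V A]

open ForgetEnrichment

theorem postcomp_id (a b : A) : postcomp V a (eId V b) = 𝟙 _ := e_comp_id V a b

theorem postcomp_comp (a : A) {b c d : Und V A} (f : b ⟶ c) (g : c ⟶ d) :
    postcomp V a (homTo V (f ≫ g)) = postcomp V a (homTo V f) ≫ postcomp V a (homTo V g) := by
  rw [homTo_comp_eq_postcomp]
  simp only [postcomp, Category.assoc, MonoidalCategory.whiskerLeft_comp]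
  rw [rightUnitor_inv_naturality_assoc, ← whisker_exchange_assoc, ← e_assoc]
  simp

/-- The representable functor `A(a → -)` from the underlying category of `A` to `V`. -/
def reprFunctor (a : A) : Und V A ⥤ V where
  obj b := a ⟶[V] b.to
  map f := postcomp V a (homTo V f)
  map_id b := by rw [homTo_id, postcomp_id]
  map_comp f g := postcomp_comp V a f g

open scoped MonoidalClosed

variable {V} in
/-- A `V`-adjunction `L ⊣ R` between `V`-functors: a `V`-natural isomorphism of hom objects
`B(L x → y) ≅ A(x → R y)`. -/
structure VAdjunction {A : Type u} {B : Type u₁} [EnrichedCategory V A] [EnrichedCategory V B]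
    (L : EnrichedFunctor V A B) (R : EnrichedFunctor V B A) where
  homIso : ∀ (x : A) (y : B), (L.obj x ⟶[V] y) ≅ (x ⟶[V] R.obj y)
  naturality_right : ∀ (x : A) (y y' : B),
    eComp V (L.obj x) y y' ≫ (homIso x y').hom =
      ((homIso x y).hom ⊗ₘ R.map y y') ≫ eComp V x (R.obj y) (R.obj y')
  naturality_left : ∀ (x x' : A) (y : B),
    (L.map x x' ▷ (L.obj x' ⟶[V] y)) ≫ eComp V (L.obj x) (L.obj x') y ≫ (homIso x y).hom =
      ((x ⟶[V] x') ◁ (homIso x' y).hom) ≫ eComp V x x' (R.obj y)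

/-- The representable `V`-functor `A(a → -)` from `A` to the self-enrichment of `V`. -/
def reprVFunctor [MonoidalClosed V] (a : A) : EnrichedFunctor V A V where
  obj b := a ⟶[V] b
  map b c := MonoidalClosed.curry (eComp V a b c)
  map_id b := by
    rw [← MonoidalClosed.curry_natural_left]
    have h : ((a ⟶[V] b) ◁ eId V b) ≫ eComp V a b b = (ρ_ _).hom := by
      rw [← Iso.inv_comp_eq_id]; exact e_comp_id V a b
    rw [h]
    rfl
  map_comp b c d := by
    change eComp V b c d ≫ MonoidalClosed.curry (eComp V a b d) =
      (MonoidalClosed.curry (eComp V a b c) ⊗ₘ MonoidalClosed.curry (eComp V a c d)) ≫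
        MonoidalClosed.comp _ _ _
    rw [MonoidalClosed.comp_eq, ← MonoidalClosed.curry_natural_left,
      ← MonoidalClosed.curry_natural_left, ← e_assoc, MonoidalClosed.compTranspose_eq, MonoidalCategory.tensorHom_def]
    congr 1
    simp only [MonoidalCategory.whiskerLeft_comp, Category.assoc,
      associator_inv_naturality_right_assoc, associator_inv_naturality_middle_assoc]
    rw [whisker_exchange_assoc, ← comp_whiskerRight_assoc,
      MonoidalClosed.whiskerLeft_curry_ihom_ev_app]
    exact congrArg (fun t => (α_ _ _ _).inv ≫ (eComp V a b c ▷ (c ⟶[V] d)) ≫ t)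
      (MonoidalClosed.whiskerLeft_curry_ihom_ev_app _ _ _).symm

end Tensored

section Functors

open ForgetEnrichment

/-- A (strong) `V`-monoidal functor between `V`-monoidal categories. -/
structure VMonoidalFunctor (V : Type v) [Category.{w} V] [MonoidalCategory V] [BraidedCategory V]
    (A B : Type u) [EnrichedCategory V A] [EnrichedCategory V B]
    [VMonoidalCategory V A] [VMonoidalCategory V B] extends EnrichedFunctor V A B where
  unitIso : 𝟙_ (Und V B) ≅ of V (obj (vOne V A))
  tensorIso : ∀ a b : A,
    (of V (obj a) : Und V B) ⊗ (of V (obj b) : Und V B) ≅ of V (obj (vObj V a b))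
  naturality : ∀ a b c d : A,
    (map a c ⊗ₘ map b d) ≫ vHom V (obj a) (obj b) (obj c) (obj d) ≫
        postcomp V _ (homTo V (tensorIso c d).hom) =
      vHom V a b c d ≫ map (vObj V a b) (vObj V c d) ≫
        precomp V (homTo V (tensorIso a b).hom) _
  associativity : ∀ a b c : Und V A,
    ((tensorIso a.to b.to).hom ▷ toEnrichedFunctor.forget.obj c) ≫
        (tensorIso (vObj V a.to b.to) c.to).hom ≫ toEnrichedFunctor.forget.map (α_ a b c).hom =
      (α_ _ _ _).hom ≫ (toEnrichedFunctor.forget.obj a ◁ (tensorIso b.to c.to).hom) ≫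
        (tensorIso a.to (vObj V b.to c.to)).hom
  left_unitality : ∀ a : Und V A,
    (unitIso.hom ▷ toEnrichedFunctor.forget.obj a) ≫ (tensorIso (vOne V A) a.to).hom ≫
        toEnrichedFunctor.forget.map (λ_ a).hom = (λ_ (toEnrichedFunctor.forget.obj a)).hom
  right_unitality : ∀ a : Und V A,
    (toEnrichedFunctor.forget.obj a ◁ unitIso.hom) ≫ (tensorIso a.to (vOne V A)).hom ≫
        toEnrichedFunctor.forget.map (ρ_ a).hom = (ρ_ (toEnrichedFunctor.forget.obj a)).hom

/-- A `V`-monoidal functor is an equivalence when it is an isomorphism on hom objects and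
essentially surjective. -/
def VMonoidalFunctor.IsEquivalence {V : Type v} [Category.{w} V] [MonoidalCategory V]
    [BraidedCategory V] {A B : Type u} [EnrichedCategory V A] [EnrichedCategory V B]
    [VMonoidalCategory V A] [VMonoidalCategory V B] (R : VMonoidalFunctor V A B) : Prop :=
  (∀ a b : A, IsIso (R.map a b)) ∧ R.toEnrichedFunctor.forget.EssSurj

end Functors

section Gradings

/-- A monoidal category is strict when the tensor product is strictly associative and unital
and the coherence isomorphisms are identities. -/
structure IsStrictMonoidal (C : Type u) [Category.{w} C] [MonoidalCategory C] : Prop where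
  assoc_obj : ∀ a b c : C, (a ⊗ b) ⊗ c = a ⊗ (b ⊗ c)
  one_obj : ∀ a : C, 𝟙_ C ⊗ a = a
  obj_one : ∀ a : C, a ⊗ 𝟙_ C = a
  associator : ∀ a b c : C, (α_ a b c).hom = eqToHom (assoc_obj a b c)
  leftUnitor : ∀ a : C, (λ_ a).hom = eqToHom (one_obj a)
  rightUnitor : ∀ a : C, (ρ_ a).hom = eqToHom (obj_one a)

/-- The conditions on objects in a decomposition `C = ⨁ g, C_g` of an additive monoidal category
into full replete subcategories `C_g`, given by predicates `deg g` on the objects: every object is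
a direct sum of homogeneous objects, and `C_g ⊗ C_h ⊆ C_{gh}`. The vanishing of the morphisms
between different components is stated separately, in `GradedVMonCat.IsGraded` for hom objects
and in `GradedVModTensCat.IsGraded` for hom spaces. -/
structure IsObjectGrading {G : Type u₂} [Group G] [Finite G] {C : Type u} [Category.{w} C]
    [Preadditive C] [MonoidalCategory C] (deg : G → ObjectProperty C) : Prop where
  [additive : HasFiniteBiproducts C]
  replete : ∀ g, (deg g).IsClosedUnderIsomorphisms
  exists_decomposition : ∀ c : C, ∃ x : G → C, (∀ g, deg g (x g)) ∧ Nonempty (c ≅ ⨁ x)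
  tensor_mem : ∀ (g h : G) (a b : C), deg g a → deg h b → deg (g * h) (a ⊗ b)

end Gradings

section VMonCat

/-- A `V`-monoidal category together with a family of full subcategories indexed by `G`. -/
structure GradedVMonCat (V : Type v) [Category.{w} V] [MonoidalCategory V] [BraidedCategory V]
    (G : Type u₂) where
  carrier : Type u
  [enriched : EnrichedCategory V carrier]
  [monoidal : VMonoidalCategory V carrier]
  deg : G → ObjectProperty (Und V carrier)

attribute [instance] GradedVMonCat.enriched GradedVMonCat.monoidal

variable {V : Type v} [Category.{w} V] [MonoidalCategory V] [BraidedCategory V] {G : Type u₂}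

namespace GradedVMonCat

/-- The underlying monoidal category. -/
abbrev U (𝒞 : GradedVMonCat.{w, v, u, u₂} V G) : Type u := Und V 𝒞.carrier

/-- Rigidity of the underlying monoidal category. -/
def IsRigid (𝒞 : GradedVMonCat.{w, v, u, u₂} V G) : Prop := Nonempty (RigidCategory 𝒞.U)

/-- The `V`-monoidal category is strict. -/
def IsStrict (𝒞 : GradedVMonCat.{w, v, u, u₂} V G) : Prop := IsStrictMonoidal 𝒞.U

/-- Each representable functor `𝒞(a → -)` from the underlying category to `V` has a left
adjoint. -/
def IsWeaklyTensored (𝒞 : GradedVMonCat.{w, v, u, u₂} V G) : Prop :=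
  ∀ a : 𝒞.carrier, (reprFunctor V a).IsRightAdjoint

open scoped MonoidalClosed in
/-- Each representable `V`-functor `𝒞(a → -)` from `𝒞` to the self-enrichment of `V` has a left
`V`-adjoint. The internal hom of `V` comes from the duals. -/
def IsTensored [RigidCategory V] (𝒞 : GradedVMonCat.{w, v, u, u₂} V G) : Prop :=
  letI := monoidalClosedOfLeftRigidCategory V
  ∀ a : 𝒞.carrier, ∃ L : EnrichedFunctor V V 𝒞.carrier, Nonempty (VAdjunction L (reprVFunctor V a))

/-- `𝒞` is the direct sum of the components `𝒞_g`, and this is a `G`-grading. -/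
structure IsGraded [Preadditive V] [Group G] [Finite G]
    (𝒞 : GradedVMonCat.{w, v, u, u₂} V G) : Prop extends IsObjectGrading 𝒞.deg where
  isZero_hom : ∀ (g h : G) (a b : 𝒞.U), g ≠ h → 𝒞.deg g a → 𝒞.deg h b →
    IsZero (a.to ⟶[V] b.to)

/-- The grading is faithful: each component has a non-zero hom object. -/
def IsFaithful (𝒞 : GradedVMonCat.{w, v, u, u₂} V G) : Prop :=
  ∀ g : G, ∃ a b : 𝒞.U, 𝒞.deg g a ∧ 𝒞.deg g b ∧ ¬ IsZero (a.to ⟶[V] b.to)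

/-- Existence of a `G`-graded `V`-monoidal equivalence. -/
def Equivalent [Preadditive V] (𝒞 𝒟 : GradedVMonCat.{w, v, u, u₂} V G) : Prop :=
  ∃ R : VMonoidalFunctor V 𝒞.carrier 𝒟.carrier, R.IsEquivalence ∧
    R.toEnrichedFunctor.forget.Additive ∧
    ∀ (g : G) (c : 𝒞.U), 𝒞.deg g c → 𝒟.deg g (R.toEnrichedFunctor.forget.obj c)

end GradedVMonCat

end VMonCat

section VModTens

open Functor.OplaxMonoidal Functor.LaxMonoidal

variable (k : Type u₁) [Field k]
variable (V : Type v) [Category.{w} V] [MonoidalCategory V] [BraidedCategory V]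
  [Preadditive V] [CategoryTheory.Linear k V]

/-- A linear, braided, strongly unital, oplax monoidal functor from `V` to the Drinfeld center
of `C`. The half-braiding of an object `X` of the center is taken in the form
`e_{a, X} : a ⊗ X ⟶ X ⊗ a`, and the braiding of the center is `e_{X, Y} : X ⊗ Y ⟶ Y ⊗ X`. This is
inverse to the convention in `CategoryTheory.Center`, where the half-braiding of `X` is
`X ⊗ a ⟶ a ⊗ X`; hence the inverses below. -/
structure CentralFunctor (C : Type u) [Category.{w} C] [MonoidalCategory C] [Preadditive C]
    [CategoryTheory.Linear k C] where
  toFunctor : V ⥤ Center C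
  [oplax : toFunctor.OplaxMonoidal]
  isIso_η : IsIso (η toFunctor)
  braided : ∀ u v : V,
    δ toFunctor u v ≫ (β_ (toFunctor.obj v) (toFunctor.obj u)).inv =
      toFunctor.map (β_ u v).hom ≫ δ toFunctor v u
  additive : (toFunctor ⋙ Center.forget C).Additive
  linear : (toFunctor ⋙ Center.forget C).Linear k

attribute [instance] CentralFunctor.oplax

namespace CentralFunctor

variable {k V} {C : Type u} [Category.{w} C] [MonoidalCategory C] [Preadditive C]
  [CategoryTheory.Linear k C] (F : CentralFunctor k V C)

/-- The composite of the functor to the center with the forgetful functor. -/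
abbrev functor : V ⥤ C := F.toFunctor ⋙ Center.forget C

/-- The half-braiding `e_{a, F v} : a ⊗ F v ⟶ F v ⊗ a`. -/
def halfBraiding (a : C) (v : V) : a ⊗ F.functor.obj v ⟶ F.functor.obj v ⊗ a :=
  ((F.toFunctor.obj v).2.β a).inv

/-- The oplax structure `F (u v) ⟶ F u ⊗ F v` in `C`. -/
def cotensor (u v : V) : F.functor.obj (u ⊗ v) ⟶ F.functor.obj u ⊗ F.functor.obj v :=
  (δ F.toFunctor u v).f

/-- The counit `F 1 ⟶ 1` in `C`. -/
def counit : F.functor.obj (𝟙_ V) ⟶ 𝟙_ C := (η F.toFunctor).f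

end CentralFunctor

/-- A linear `V`-module tensor category together with a family of full subcategories indexed by
`G`. -/
structure GradedVModTensCat (G : Type u₂) where
  carrier : Type u
  [category : Category.{w} carrier]
  [preadditive : Preadditive carrier]
  [linear : CategoryTheory.Linear k carrier]
  [monoidal : MonoidalCategory carrier]
  [monoidalPreadditive : MonoidalPreadditive carrier]
  [monoidalLinear : MonoidalLinear k carrier]
  F : CentralFunctor k V carrier
  deg : G → ObjectProperty carrier

attribute [instance] GradedVModTensCat.category GradedVModTensCat.preadditive
  GradedVModTensCat.linear GradedVModTensCat.monoidal GradedVModTensCat.monoidalPreadditive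
  GradedVModTensCat.monoidalLinear

variable {k V} {G : Type u₂}

namespace GradedVModTensCat

/-- Rigidity of the monoidal category. -/
def IsRigid (X : GradedVModTensCat.{w, v, u, u₁, u₂} k V G) : Prop :=
  Nonempty (RigidCategory X.carrier)

/-- Strictness of the monoidal category. -/
def IsStrict (X : GradedVModTensCat.{w, v, u, u₁, u₂} k V G) : Prop := IsStrictMonoidal X.carrier

/-- The functor `F : V ⥤ C` has a right adjoint. -/
def IsWeaklyTensored (X : GradedVModTensCat.{w, v, u, u₁, u₂} k V G) : Prop :=
  X.F.functor.IsLeftAdjoint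

/-- The functor `F : V ⥤ C` has a right adjoint and is strong monoidal. -/
def IsTensored (X : GradedVModTensCat.{w, v, u, u₁, u₂} k V G) : Prop :=
  X.IsWeaklyTensored ∧ ∀ u v : V, IsIso (X.F.cotensor u v)

/-- `C` is the direct sum of the components `C_g`, this is a `G`-grading, and `F` takes its values
in the trivial component. -/
structure IsGraded [Group G] [Finite G] (X : GradedVModTensCat.{w, v, u, u₁, u₂} k V G) :
    Prop extends IsObjectGrading X.deg where
  hom_eq_zero : ∀ (g h : G) (a b : X.carrier), g ≠ h → X.deg g a → X.deg h b →
    ∀ f : a ⟶ b, f = 0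
  functor_mem : ∀ v : V, X.deg 1 (X.F.functor.obj v)

/-- The grading is faithful: each component has a non-zero hom space. -/
def IsFaithful (X : GradedVModTensCat.{w, v, u, u₁, u₂} k V G) : Prop :=
  ∀ g : G, ∃ a b : X.carrier, X.deg g a ∧ X.deg g b ∧ ∃ f : a ⟶ b, f ≠ 0

/-- The coherence conditions for an action coherence `r : F_Y ⟶ R F_X` on a monoidal functor `R`:
compatibility with the units, with the oplax structures, and with the half-braidings. -/
structure IsActionCoherence {X Y : GradedVModTensCat.{w, v, u, u₁, u₂} k V G}
    (R : X.carrier ⥤ Y.carrier) [R.Monoidal] (r : Y.F.functor ⟶ X.F.functor ⋙ R) : Prop where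
  unit : r.app (𝟙_ V) ≫ R.map X.F.counit = Y.F.counit ≫ ε R
  tensor : ∀ u v : V, r.app (u ⊗ v) ≫ R.map (X.F.cotensor u v) =
    Y.F.cotensor u v ≫ (r.app u ⊗ₘ r.app v) ≫ μ R (X.F.functor.obj u) (X.F.functor.obj v)
  halfBraiding : ∀ (a : X.carrier) (v : V),
    Y.F.halfBraiding (R.obj a) v ≫ (r.app v ▷ R.obj a) ≫ μ R (X.F.functor.obj v) a =
      (R.obj a ◁ r.app v) ≫ μ R a (X.F.functor.obj v) ≫ R.map (X.F.halfBraiding a v)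

/-- Existence of a `G`-graded equivalence `(R, ρ, r)` of `V`-module tensor categories. -/
def Equivalent (X Y : GradedVModTensCat.{w, v, u, u₁, u₂} k V G) : Prop :=
  ∃ (R : X.carrier ⥤ Y.carrier) (_ : R.Monoidal) (r : Y.F.functor ≅ X.F.functor ⋙ R),
    R.IsEquivalence ∧ R.Additive ∧ IsActionCoherence R r.hom ∧
    ∀ (g : G) (c : X.carrier), X.deg g c → Y.deg g (R.obj c)

end GradedVModTensCat

end VModTens

section Correspondence

open ForgetEnrichment

variable {k : Type u₁} [Field k]
variable {V : Type v} [Category.{w} V] [MonoidalCategory V] [BraidedCategory V]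
  [Preadditive V] [CategoryTheory.Linear k V] [MonoidalPreadditive V] [MonoidalLinear k V]

/-- The map `A(b → c) ⟶ A(a b → a c)` that tensors with `a` on the left. -/
def tensorLeftMap {A : Type u} [EnrichedCategory V A] [VMonoidalStruct V A] (a b c : A) :
    (b ⟶[V] c) ⟶ (vObj V a b ⟶[V] vObj V a c) :=
  (λ_ _).inv ≫ (eId V a ▷ (b ⟶[V] c)) ≫ vHom V a b a c

/-- The map `A(b → c) ⟶ A(b a → c a)` that tensors with `a` on the right. -/
def tensorRightMap {A : Type u} [EnrichedCategory V A] [VMonoidalStruct V A] (b c a : A) :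
    (b ⟶[V] c) ⟶ (vObj V b a ⟶[V] vObj V c a) :=
  (ρ_ _).inv ≫ ((b ⟶[V] c) ◁ eId V a) ≫ vHom V b a c a

/-- The functor `F` from `V` to the center of the underlying category of `A` is the one induced
by `A`: it is left adjoint to the functor `x ↦ A(1 → x)`, and its counit, its oplax structure and
its half-braidings are the mates, under this adjunction, of `j_1`, of
`A(1 → F u) ⊗ A(1 → F v) ⟶ A(1 → F u ⊗ F v)`, and of
`η_v ⊗ j_a : v ⟶ A(1 → F v) ⟶ A(a → F v ⊗ a)`. -/
def IsInducedBy (A : Type u) [EnrichedCategory V A] [VMonoidalCategory V A]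
    (F : CentralFunctor k V (Und V A)) : Prop :=
  ∃ adj : F.functor ⊣ reprFunctor V (vOne V A),
    let unit (v : V) : v ⟶ (vOne V A ⟶[V] (F.functor.obj v).to) := adj.unit.app v
    unit (𝟙_ V) ≫ postcomp V (vOne V A) (homTo V F.counit) = eId V (vOne V A) ∧
    (∀ u v : V,
      unit (u ⊗ v) ≫ postcomp V (vOne V A) (homTo V (F.cotensor u v)) =
        (unit u ⊗ₘ unit v) ≫
          vHom V (vOne V A) (vOne V A) (F.functor.obj u).to (F.functor.obj v).to ≫
          precomp V (homTo V (λ_ (𝟙_ (Und V A))).inv) _) ∧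
    (∀ (a : Und V A) (v : V),
      unit v ≫ tensorLeftMap a.to (vOne V A) (F.functor.obj v).to ≫
          precomp V (homTo V (ρ_ a).inv) _ ≫ postcomp V a.to (homTo V (F.halfBraiding a v)) =
        unit v ≫ tensorRightMap (vOne V A) (F.functor.obj v).to a.to ≫
          precomp V (homTo V (λ_ a).inv) _)

/-- The underlying monoidal category of a graded `V`-monoidal category, with the same grading and
with a functor from `V` to its center. -/
def GradedVMonCat.toModTens {G : Type u₂} (𝒞 : GradedVMonCat.{w, v, u, u₂} V G)
    (F : CentralFunctor k V 𝒞.U) : GradedVModTensCat.{w, v, u, u₁, u₂} k V G where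
  carrier := 𝒞.U
  F := F
  deg := 𝒞.deg

/-- The two kinds of categories in the correspondence. -/
inductive TensorKind
  | weaklyTensored
  | tensored

/-- Faithfully `G`-graded (weakly) tensored rigid `V`-monoidal categories, among all of them or
among the strict ones only. -/
def GradedVMonCat.IsCell [RigidCategory V] {G : Type u₂} [Group G] [Finite G] (t : TensorKind)
    (strict : Bool) (𝒞 : GradedVMonCat.{w, v, u, u₂} V G) : Prop :=
  𝒞.IsGraded ∧ 𝒞.IsFaithful ∧ 𝒞.IsRigid ∧ (strict = true → 𝒞.IsStrict) ∧
    match t with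
    | .weaklyTensored => 𝒞.IsWeaklyTensored
    | .tensored => 𝒞.IsTensored

/-- Faithfully `G`-graded (weakly) tensored rigid `V`-module tensor categories, among all of them
or among the strict ones only. -/
def GradedVModTensCat.IsCell {G : Type u₂} [Group G] [Finite G] (t : TensorKind)
    (strict : Bool) (X : GradedVModTensCat.{w, v, u, u₁, u₂} k V G) : Prop :=
  X.IsGraded ∧ X.IsFaithful ∧ X.IsRigid ∧ (strict = true → X.IsStrict) ∧
    match t with
    | .weaklyTensored => X.IsWeaklyTensored
    | .tensored => X.IsTensored

/-- Faithfully `G`-graded (weakly) tensored rigid `V`-monoidal categories. -/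
abbrev VMonCell (V : Type v) [Category.{w} V] [MonoidalCategory V] [BraidedCategory V]
    [Preadditive V] [RigidCategory V] (G : Type u₂) [Group G] [Finite G] (t : TensorKind)
    (strict : Bool) :=
  {𝒞 : GradedVMonCat.{w, v, u, u₂} V G // 𝒞.IsCell t strict}

/-- Faithfully `G`-graded (weakly) tensored rigid `V`-module tensor categories. -/
abbrev VModTensCell (k : Type u₁) [Field k] (V : Type v) [Category.{w} V] [MonoidalCategory V]
    [BraidedCategory V] [Preadditive V] [CategoryTheory.Linear k V]
    (G : Type u₂) [Group G] [Finite G] (t : TensorKind) (strict : Bool) :=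
  {X : GradedVModTensCat.{w, v, u, u₁, u₂} k V G // X.IsCell t strict}

/-- Equivalence of graded `V`-monoidal categories. -/
def monEquiv (V : Type v) [Category.{w} V] [MonoidalCategory V] [BraidedCategory V]
    [Preadditive V] [RigidCategory V] (G : Type u₂) [Group G] [Finite G] (t : TensorKind)
    (strict : Bool) (𝒞 𝒟 : VMonCell.{w, v, u, u₂} V G t strict) : Prop :=
  𝒞.1.Equivalent 𝒟.1

/-- Equivalence of graded `V`-module tensor categories. -/
def modTensEquiv (k : Type u₁) [Field k] (V : Type v) [Category.{w} V] [MonoidalCategory V]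
    [BraidedCategory V] [Preadditive V] [CategoryTheory.Linear k V]
    (G : Type u₂) [Group G] [Finite G] (t : TensorKind) (strict : Bool)
    (X Y : VModTensCell.{w, v, u, u₁, u₂} k V G t strict) : Prop :=
  X.1.Equivalent Y.1

end Correspondence

end VEnriched

end

/-! Both sides describe the same structure on a rigid monoidal category `C`. One records hom objects
`H a b` in `V`, the other a functor `F` from `V` to the center, and the bridge is a natural
bijection between generalized elements `v ⟶ H a b` and morphisms `a ⊗ F v ⟶ b`.

From hom objects to `F`: being weakly tensored gives, for each `v`, an object `F v` with a universal
element `η v : v ⟶ H 1 (F v)`. Duals carry universality from `1` to every object `a`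
(`IsUniversal.atL`, `IsUniversal.atR`), so that `a ⊗ F v` and `F v ⊗ a` represent the same functor;
the resulting isomorphism between them is the half-braiding. Every axiom of a braided oplax functor
into the center is an equality of morphisms out of a representing object, so it is checked on the
universal element. Braidedness of `F` is the interchange law for `η u` and `η v`.

From `F` to hom objects: if `G` is right adjoint to `F`, then `H a b = G (a' ⊗ b)`, with `a'` a left
dual of `a`, classifies the morphisms `a ⊗ F v ⟶ b`. Composition uses the oplax structure, right
whiskering uses the half-braiding, and the interchange law follows from braidedness
(`gmul_exchange`). The functor induced by this enrichment is the original `F`.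

The same dictionary applies to functors. An enriched monoidal equivalence compares universal
elements and yields the isomorphism `r`; conversely `r` transports `a ⊗ F v ⟶ b` to `R a ⊗ F' v ⟶ R
b` and thereby acts on hom objects. Hence two enriched categories are equivalent exactly when their
module tensor categories are (`GradedVMonCat.equivalent_iff`). This makes the map on classes well
defined and injective, and it transfers the equivalence relation from the module side, where
symmetry comes from taking the mate of the inverse of `r`.

Being tensored means that composition with `η` is bijective on elements of every shape `w ⟶ H x c`,
not only on points. In terms of `F`, this says that the oplax structure is invertible.

In a grading, an object lies in `C_g` as soon as all its morphisms to the other components vanish.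
This puts the values of `F` in the trivial component and makes inverse equivalences preserve the
grading.

The intermediate notion `Enrichment` replaces the tensor product of hom objects by left and right
whiskering, so that the braiding enters through the single axiom `exchange`. -/

noncomputable section

/-! ### Enrichments in terms of whiskerings, and the calculus of generalized elements. -/

namespace VEnriched

/-- Hom objects in `V` for the objects of a monoidal category `C`, with composition and
whiskering; the morphisms of `C` are the `𝟙_ V`-points of the hom objects. -/
structure EnrichmentData (V : Type v) [Category.{w} V] [MonoidalCategory V]
    (C : Type u) [Category.{w} C] [MonoidalCategory C] where
  H : C → C → V
  hom {a b : C} : (a ⟶ b) ≃ (𝟙_ V ⟶ H a b)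
  comp (a b c : C) : H a b ⊗ H b c ⟶ H a c
  left (a b c : C) : H b c ⟶ H (a ⊗ b) (a ⊗ c)
  right (b c a : C) : H b c ⟶ H (b ⊗ a) (c ⊗ a)

namespace EnrichmentData

variable {V : Type v} [Category.{w} V] [MonoidalCategory V]
  {C : Type u} [Category.{w} C] [MonoidalCategory C] (E : EnrichmentData V C)

/-- Composition of generalized elements of hom objects. -/
def mul {u v : V} {a b c : C} (f : u ⟶ E.H a b) (g : v ⟶ E.H b c) : u ⊗ v ⟶ E.H a c :=
  (f ⊗ₘ g) ≫ E.comp a b c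

/-- Left whiskering of a generalized element. -/
def wl (a : C) {v : V} {b c : C} (f : v ⟶ E.H b c) : v ⟶ E.H (a ⊗ b) (a ⊗ c) :=
  f ≫ E.left a b c

/-- Right whiskering of a generalized element. -/
def wr {v : V} {b c : C} (f : v ⟶ E.H b c) (a : C) : v ⟶ E.H (b ⊗ a) (c ⊗ a) :=
  f ≫ E.right b c a

/-- Composition of a generalized element with a morphism of `C`. -/
def post {v : V} {a b c : C} (f : v ⟶ E.H a b) (g : b ⟶ c) : v ⟶ E.H a c :=
  (ρ_ v).inv ≫ E.mul f (E.hom g)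

/-- Composition of a morphism of `C` with a generalized element. -/
def pre {v : V} {a b c : C} (f : a ⟶ b) (g : v ⟶ E.H b c) : v ⟶ E.H a c :=
  (λ_ v).inv ≫ E.mul (E.hom f) g

end EnrichmentData

/-- An enrichment of a monoidal category `C` over a braided category `V`, in terms of
whiskerings. -/
structure Enrichment (V : Type v) [Category.{w} V] [MonoidalCategory V] [BraidedCategory V]
    (C : Type u) [Category.{w} C] [MonoidalCategory C] extends EnrichmentData V C where
  hom_comp {a b c : C} (f : a ⟶ b) (g : b ⟶ c) :
    (λ_ (𝟙_ V)).inv ≫ toEnrichmentData.mul (hom f) (hom g) = hom (f ≫ g)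
  id_mul {v : V} {a b : C} (f : v ⟶ H a b) :
    toEnrichmentData.mul (hom (𝟙 a)) f = (λ_ v).hom ≫ f
  mul_id {v : V} {a b : C} (f : v ⟶ H a b) :
    toEnrichmentData.mul f (hom (𝟙 b)) = (ρ_ v).hom ≫ f
  mul_assoc {u v w : V} {a b c d : C} (f : u ⟶ H a b) (g : v ⟶ H b c) (h : w ⟶ H c d) :
    toEnrichmentData.mul (toEnrichmentData.mul f g) h =
      (α_ u v w).hom ≫ toEnrichmentData.mul f (toEnrichmentData.mul g h)
  wl_hom (a : C) {b c : C} (f : b ⟶ c) : toEnrichmentData.wl a (hom f) = hom (a ◁ f)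
  wr_hom {b c : C} (f : b ⟶ c) (a : C) : toEnrichmentData.wr (hom f) a = hom (f ▷ a)
  wl_mul (a : C) {u v : V} {b c d : C} (f : u ⟶ H b c) (g : v ⟶ H c d) :
    toEnrichmentData.wl a (toEnrichmentData.mul f g) =
      toEnrichmentData.mul (toEnrichmentData.wl a f) (toEnrichmentData.wl a g)
  wr_mul {u v : V} {b c d : C} (f : u ⟶ H b c) (g : v ⟶ H c d) (a : C) :
    toEnrichmentData.wr (toEnrichmentData.mul f g) a =
      toEnrichmentData.mul (toEnrichmentData.wr f a) (toEnrichmentData.wr g a)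
  exchange {u v : V} {a b c d : C} (f : u ⟶ H a c) (g : v ⟶ H b d) :
    toEnrichmentData.mul (toEnrichmentData.wl a g) (toEnrichmentData.wr f d) =
      (β_ v u).hom ≫ toEnrichmentData.mul (toEnrichmentData.wr f b) (toEnrichmentData.wl c g)
  wl_wl {v : V} (a b : C) {c d : C} (f : v ⟶ H c d) :
    toEnrichmentData.post (toEnrichmentData.wl (a ⊗ b) f) (α_ a b d).hom =
      toEnrichmentData.pre (α_ a b c).hom (toEnrichmentData.wl a (toEnrichmentData.wl b f))
  wl_wr {v : V} (a b : C) {c d : C} (f : v ⟶ H c d) :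
    toEnrichmentData.post (toEnrichmentData.wr (toEnrichmentData.wl a f) b) (α_ a d b).hom =
      toEnrichmentData.pre (α_ a c b).hom (toEnrichmentData.wl a (toEnrichmentData.wr f b))
  wr_wr {v : V} (a b : C) {c d : C} (f : v ⟶ H c d) :
    toEnrichmentData.post (toEnrichmentData.wr (toEnrichmentData.wr f a) b) (α_ d a b).hom =
      toEnrichmentData.pre (α_ c a b).hom (toEnrichmentData.wr f (a ⊗ b))
  one_wl {v : V} {a b : C} (f : v ⟶ H a b) :
    toEnrichmentData.post (toEnrichmentData.wl (𝟙_ C) f) (λ_ b).hom =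
      toEnrichmentData.pre (λ_ a).hom f
  wr_one {v : V} {a b : C} (f : v ⟶ H a b) :
    toEnrichmentData.post (toEnrichmentData.wr f (𝟙_ C)) (ρ_ b).hom =
      toEnrichmentData.pre (ρ_ a).hom f

namespace EnrichmentData

variable {V : Type v} [Category.{w} V] [MonoidalCategory V]
  {C : Type u} [Category.{w} C] [MonoidalCategory C] (E : EnrichmentData V C)

theorem comp_mul {u u' v : V} {a b c : C} (x : u' ⟶ u) (f : u ⟶ E.H a b) (g : v ⟶ E.H b c) :
    E.mul (x ≫ f) g = x ▷ v ≫ E.mul f g := by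
  simp [mul, MonoidalCategory.tensorHom_def]

theorem mul_comp {u v v' : V} {a b c : C} (f : u ⟶ E.H a b) (x : v' ⟶ v) (g : v ⟶ E.H b c) :
    E.mul f (x ≫ g) = u ◁ x ≫ E.mul f g := by
  simp [mul, tensorHom_def']

theorem wl_comp {u v : V} (a : C) {b c : C} (x : u ⟶ v) (f : v ⟶ E.H b c) :
    E.wl a (x ≫ f) = x ≫ E.wl a f := by simp [wl]

theorem wr_comp {u v : V} {b c : C} (x : u ⟶ v) (f : v ⟶ E.H b c) (a : C) :
    E.wr (x ≫ f) a = x ≫ E.wr f a := by simp [wr]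

theorem comp_post {u v : V} {a b c : C} (x : u ⟶ v) (f : v ⟶ E.H a b) (g : b ⟶ c) :
    E.post (x ≫ f) g = x ≫ E.post f g := by
  simp [post, comp_mul]

theorem pre_comp {u v : V} {a b c : C} (f : a ⟶ b) (x : u ⟶ v) (g : v ⟶ E.H b c) :
    E.pre f (x ≫ g) = x ≫ E.pre f g := by
  simp [pre, mul_comp]

end EnrichmentData

namespace Enrichment

variable {V : Type v} [Category.{w} V] [MonoidalCategory V] [BraidedCategory V]
  {C : Type u} [Category.{w} C] [MonoidalCategory C] (E : Enrichment V C)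

open EnrichmentData

theorem post_id {v : V} {a b : C} (f : v ⟶ E.H a b) : E.post f (𝟙 b) = f := by
  simp [post, E.mul_id]

theorem pre_id {v : V} {a b : C} (f : v ⟶ E.H a b) : E.pre (𝟙 a) f = f := by
  simp [pre, E.id_mul]

theorem hom_mul_hom {a b c : C} (f : a ⟶ b) (g : b ⟶ c) :
    E.mul (E.hom f) (E.hom g) = (λ_ (𝟙_ V)).hom ≫ E.hom (f ≫ g) := by
  rw [← E.hom_comp, Iso.hom_inv_id_assoc]

theorem post_hom {a b c : C} (f : a ⟶ b) (g : b ⟶ c) :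
    E.post (E.hom f) g = E.hom (f ≫ g) := by
  rw [post, hom_mul_hom, unitors_inv_equal.symm, Iso.inv_hom_id_assoc]

theorem pre_hom {a b c : C} (f : a ⟶ b) (g : b ⟶ c) :
    E.pre f (E.hom g) = E.hom (f ≫ g) := by
  rw [pre, hom_mul_hom, Iso.inv_hom_id_assoc]

theorem mul_post {u v : V} {a b c d : C} (f : u ⟶ E.H a b) (g : v ⟶ E.H b c) (h : c ⟶ d) :
    E.mul f (E.post g h) = E.post (E.mul f g) h := by
  simp only [post, mul_comp, E.mul_assoc]
  rw [← Category.assoc]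
  congr 1
  monoidal

theorem pre_mul {u v : V} {a b c d : C} (h : a ⟶ b) (f : u ⟶ E.H b c) (g : v ⟶ E.H c d) :
    E.mul (E.pre h f) g = E.pre h (E.mul f g) := by
  simp only [pre, comp_mul, E.mul_assoc]
  rw [← Category.assoc]
  congr 1
  monoidal

theorem post_mul {u v : V} {a b c d : C} (f : u ⟶ E.H a b) (h : b ⟶ c) (g : v ⟶ E.H c d) :
    E.mul (E.post f h) g = E.mul f (E.pre h g) := by
  simp only [pre, post, comp_mul, mul_comp, E.mul_assoc]
  rw [← Category.assoc]
  congr 1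
  monoidal

theorem post_post {v : V} {a b c d : C} (f : v ⟶ E.H a b) (g : b ⟶ c) (h : c ⟶ d) :
    E.post (E.post f g) h = E.post f (g ≫ h) := by
  conv_lhs => rw [post, post_mul, pre_hom, ← post]

theorem pre_pre {v : V} {a b c d : C} (h : a ⟶ b) (g : b ⟶ c) (f : v ⟶ E.H c d) :
    E.pre h (E.pre g f) = E.pre (h ≫ g) f := by
  conv_lhs => rw [pre, ← post_mul, post_hom, ← pre]

theorem pre_post {v : V} {a b c d : C} (h : a ⟶ b) (f : v ⟶ E.H b c) (g : c ⟶ d) :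
    E.pre h (E.post f g) = E.post (E.pre h f) g := by
  conv_lhs => rw [pre, mul_post, ← comp_post, ← pre]

theorem wl_post {v : V} (a : C) {b c d : C} (f : v ⟶ E.H b c) (g : c ⟶ d) :
    E.wl a (E.post f g) = E.post (E.wl a f) (a ◁ g) := by
  rw [post, wl_comp, E.wl_mul, E.wl_hom, post]

theorem wl_pre {v : V} (a : C) {b c d : C} (g : b ⟶ c) (f : v ⟶ E.H c d) :
    E.wl a (E.pre g f) = E.pre (a ◁ g) (E.wl a f) := by
  rw [pre, wl_comp, E.wl_mul, E.wl_hom, pre]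

theorem wr_post {v : V} (a : C) {b c d : C} (f : v ⟶ E.H b c) (g : c ⟶ d) :
    E.wr (E.post f g) a = E.post (E.wr f a) (g ▷ a) := by
  rw [post, wr_comp, E.wr_mul, E.wr_hom, post]

theorem wr_pre {v : V} (a : C) {b c d : C} (g : b ⟶ c) (f : v ⟶ E.H c d) :
    E.wr (E.pre g f) a = E.pre (g ▷ a) (E.wr f a) := by
  rw [pre, wr_comp, E.wr_mul, E.wr_hom, pre]

/-- This is the exchange law with a point as one factor. Braiding with the unit object is a
composite of unitors, so no braiding remains. -/
theorem post_wl_whiskerRight {v : V} {a a' b c : C} (f : v ⟶ E.H b c) (h : a ⟶ a') :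
    E.post (E.wl a f) (h ▷ c) = E.pre (h ▷ b) (E.wl a' f) := by
  rw [post, pre, ← E.wr_hom, ← E.wr_hom, E.exchange, braiding_tensorUnit_right]
  simp

theorem post_wr_whiskerLeft {v : V} {a a' b c : C} (f : v ⟶ E.H b c) (h : a ⟶ a') :
    E.post (E.wr f a) (c ◁ h) = E.pre (b ◁ h) (E.wr f a') := by
  rw [post, pre, ← E.wl_hom, ← E.wl_hom, E.exchange, braiding_tensorUnit_left]
  simp

/-- A generalized element `v ⟶ E.H a x` that represents the functor `E.H a -`. -/
def IsUniversal {v : V} {a x : C} (η : v ⟶ E.H a x) : Prop :=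
  ∀ c : C, Function.Bijective fun g : x ⟶ c => E.post η g

end Enrichment

end VEnriched

/-! ### Universal elements, and their behaviour under tensoring and duality. -/

namespace VEnriched

namespace Enrichment

open EnrichmentData

variable {V : Type v} [Category.{w} V] [MonoidalCategory V] [BraidedCategory V]
  {C : Type u} [Category.{w} C] [MonoidalCategory C] (E : Enrichment V C)

/-- The tensor product of `𝟙 a` with a generalized element of `H 1 x`. -/
def atL {v : V} {x : C} (η : v ⟶ E.H (𝟙_ C) x) (a : C) : v ⟶ E.H a (a ⊗ x) :=
  E.pre (ρ_ a).inv (E.wl a η)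

/-- The tensor product of a generalized element of `H 1 x` with `𝟙 a`. -/
def atR {v : V} {x : C} (η : v ⟶ E.H (𝟙_ C) x) (a : C) : v ⟶ E.H a (x ⊗ a) :=
  E.pre (λ_ a).inv (E.wr η a)

section

variable {u v : V} {x y : C} (η : v ⟶ E.H (𝟙_ C) x)

theorem post_inv_eq {a b c : C} {f : v ⟶ E.H a b} {g : v ⟶ E.H a c} (e : b ≅ c) :
    E.post g e.inv = f ↔ g = E.post f e.hom := by
  constructor
  · rintro rfl; rw [post_post, Iso.inv_hom_id, post_id]
  · rintro rfl; rw [post_post, Iso.hom_inv_id, post_id]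

theorem atL_comp (z : u ⟶ v) (a : C) : E.atL (z ≫ η) a = z ≫ E.atL η a := by
  rw [atL, wl_comp, pre_comp, atL]

theorem atR_comp (z : u ⟶ v) (a : C) : E.atR (z ≫ η) a = z ≫ E.atR η a := by
  rw [atR, wr_comp, pre_comp, atR]

theorem atL_post (g : x ⟶ y) (a : C) : E.atL (E.post η g) a = E.post (E.atL η a) (a ◁ g) := by
  rw [atL, wl_post, pre_post, atL]

theorem atR_post (g : x ⟶ y) (a : C) : E.atR (E.post η g) a = E.post (E.atR η a) (g ▷ a) := by
  rw [atR, wr_post, pre_post, atR]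

theorem pre_atL {a a' : C} (h : a ⟶ a') :
    E.pre h (E.atL η a') = E.post (E.atL η a) (h ▷ x) := by
  rw [atL, atL, ← pre_post, post_wl_whiskerRight, pre_pre, pre_pre, rightUnitor_inv_naturality]

theorem pre_atR {a a' : C} (h : a ⟶ a') :
    E.pre h (E.atR η a') = E.post (E.atR η a) (x ◁ h) := by
  rw [atR, atR, ← pre_post, post_wr_whiskerLeft, pre_pre, pre_pre, leftUnitor_inv_naturality]

/-- The two unitors agree at the unit object, so whiskering by `𝟙_ C` only inserts a unitor. -/
theorem atL_one : E.atL η (𝟙_ C) = E.post η (λ_ x).inv := by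
  rw [eq_comm, post_inv_eq, atL, ← pre_post, E.one_wl, pre_pre, unitors_equal,
    Iso.inv_hom_id, pre_id]

theorem atR_one : E.atR η (𝟙_ C) = E.post η (ρ_ x).inv := by
  rw [eq_comm, post_inv_eq, atR, ← pre_post, E.wr_one, pre_pre, ← unitors_equal,
    Iso.inv_hom_id, pre_id]

theorem atL_tensor (a b : C) :
    E.post (E.atL η (a ⊗ b)) (α_ a b x).hom = E.wl a (E.atL η b) := by
  rw [atL, atL, ← pre_post, E.wl_wl, pre_pre, wl_pre]
  congr 1
  monoidal

theorem atR_tensor (a b : C) :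
    E.wr (E.atR η a) b = E.post (E.atR η (a ⊗ b)) (α_ x a b).inv := by
  rw [eq_comm, post_inv_eq, atR, atR, wr_pre, ← pre_post, E.wr_wr, pre_pre]
  congr 1
  monoidal

theorem wr_atL (a b : C) :
    E.post (E.wr (E.atL η a) b) (α_ a x b).hom = E.wl a (E.atR η b) := by
  rw [atL, atR, wr_pre, ← pre_post, E.wl_wr, pre_pre, wl_pre]
  congr 1
  monoidal

theorem atL_mul {c : C} (k : u ⟶ E.H x c) (a : C) :
    E.atL (E.mul η k) a = E.mul (E.atL η a) (E.wl a k) := by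
  rw [atL, E.wl_mul, ← pre_mul, atL]

theorem atR_mul {c : C} (k : u ⟶ E.H x c) (a : C) :
    E.atR (E.mul η k) a = E.mul (E.atR η a) (E.wr k a) := by
  rw [atR, E.wr_mul, ← pre_mul, atR]

/-- Relates the two forms of the product of two elements out of `𝟙_ C`: the composite of `η` with `x
⊗ θ`, and the tensor product of `η` with `θ`. The first suits calculations, the second appears in
`IsInducedBy`. -/
theorem mul_atL (θ : u ⟶ E.H (𝟙_ C) y) :
    E.mul η (E.atL θ x) = E.pre (λ_ _).inv (E.mul (E.wr η (𝟙_ C)) (E.wl x θ)) := by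
  rw [← pre_mul, ← atR, atR_one, post_mul, ← atL]

theorem atL_hom (g : 𝟙_ C ⟶ x) (a : C) : E.atL (E.hom g) a = E.hom ((ρ_ a).inv ≫ a ◁ g) := by
  rw [atL, E.wl_hom, pre_hom]

theorem atR_hom (g : 𝟙_ C ⟶ x) (a : C) : E.atR (E.hom g) a = E.hom ((λ_ a).inv ≫ g ▷ a) := by
  rw [atR, E.wr_hom, pre_hom]

end

variable {E}

namespace IsUniversal

variable {v : V} {a x y : C} {η : v ⟶ E.H a x}

/-- The morphism that corresponds to an element of `H a c`. -/
def desc (h : E.IsUniversal η) {c : C} (k : v ⟶ E.H a c) : x ⟶ c := ((h c).2 k).choose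

@[simp]
theorem fac (h : E.IsUniversal η) {c : C} (k : v ⟶ E.H a c) : E.post η (h.desc k) = k :=
  ((h c).2 k).choose_spec

theorem ext (h : E.IsUniversal η) {c : C} {g g' : x ⟶ c} (w : E.post η g = E.post η g') :
    g = g' := (h c).1 w

/-- Representing objects are unique. -/
@[simps hom]
def iso (h : E.IsUniversal η) {η' : v ⟶ E.H a y} (h' : E.IsUniversal η') : x ≅ y where
  hom := h.desc η'
  inv := h'.desc η
  hom_inv_id := h.ext (by rw [← post_post, h.fac, h'.fac, post_id])
  inv_hom_id := h'.ext (by rw [← post_post, h'.fac, h.fac, post_id])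

/-- A morphism that carries a universal element to a universal element compares two representing
objects, hence is invertible. -/
theorem isIso_of_post (h : E.IsUniversal η) {e : x ⟶ y} (h' : E.IsUniversal (E.post η e)) :
    IsIso e :=
  ⟨h'.desc η, h.ext (by rw [← post_post, h'.fac, post_id]),
    h'.ext (by rw [← post_post, h'.fac, post_id])⟩

end IsUniversal

section Duals

variable {v : V} {x : C} {η : v ⟶ E.H (𝟙_ C) x}

/-- The duality bijection for morphisms corresponds, under composition with universal elements, to
the map that whiskers an element by `a'` and precomposes with the coevaluation. -/
theorem post_tensorLeftHomEquiv (a a' : C) [ExactPairing a' a] {c : C} (g : a ⊗ x ⟶ c) :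
    E.post η (tensorLeftHomEquiv x a' a c g) =
      E.pre (η_ a' a) (E.wl a' (E.post (E.atL η a) g)) := by
  simp only [tensorLeftHomEquiv, Equiv.coe_fn_mk]
  rw [← post_post, ← atL_one, ← post_post, ← pre_atL, ← post_post, ← pre_post, ← pre_post,
    atL_tensor, wl_post]

theorem post_tensorRightHomEquiv (a a' : C) [ExactPairing a a'] {c : C} (g : x ⊗ a ⟶ c) :
    E.post η (tensorRightHomEquiv x a a' c g) =
      E.pre (η_ a a') (E.wr (E.post (E.atR η a) g) a') := by
  simp only [tensorRightHomEquiv, Equiv.coe_fn_mk]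
  rw [← post_post, ← atR_one, ← post_post, ← pre_atR, ← post_post, ← pre_post, ← pre_post,
    ← atR_tensor, wr_post]

/-- Tensoring the transposed element with `a` and composing with the evaluation recovers the
original one, by a zigzag identity. -/
theorem pre_coevaluation_wl_injective (a a' : C) [ExactPairing a' a] {c : C}
    {k k' : v ⟶ E.H a c} (w : E.pre (η_ a' a) (E.wl a' k) = E.pre (η_ a' a) (E.wl a' k')) :
    k = k' := by
  have key : ∀ k : v ⟶ E.H a c, E.post (E.atL (E.pre (η_ a' a) (E.wl a' k)) a)
      ((α_ _ _ _).inv ≫ ε_ a' a ▷ c ≫ (λ_ c).hom) = k := by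
    intro k
    have h : E.post (E.wl a (E.wl a' k)) (α_ _ _ _).inv =
        E.pre (α_ _ _ _).inv (E.wl (a ⊗ a') k) := by
      rw [post_inv_eq, ← pre_post, E.wl_wl, pre_pre, Iso.inv_hom_id, pre_id]
    rw [atL, wl_pre, pre_pre, ← pre_post, ← post_post, h, ← pre_post, ← post_post,
      post_wl_whiskerRight, ← pre_post, E.one_wl]
    simp only [pre_pre, Category.assoc, ExactPairing.coevaluation_evaluation_assoc]
    simp [pre_id]
  rw [← key k, w, key]

theorem pre_coevaluation_wr_injective (a a' : C) [ExactPairing a a'] {c : C}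
    {k k' : v ⟶ E.H a c} (w : E.pre (η_ a a') (E.wr k a') = E.pre (η_ a a') (E.wr k' a')) :
    k = k' := by
  have key : ∀ k : v ⟶ E.H a c, E.post (E.atR (E.pre (η_ a a') (E.wr k a')) a)
      ((α_ _ _ _).hom ≫ c ◁ ε_ a a' ≫ (ρ_ c).hom) = k := by
    intro k
    rw [atR, wr_pre, pre_pre, ← pre_post, ← post_post, E.wr_wr, ← pre_post, ← post_post,
      post_wr_whiskerLeft, ← pre_post, E.wr_one]
    simp only [pre_pre, Category.assoc, ExactPairing.evaluation_coevaluation_assoc]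
    simp [pre_id]
  rw [← key k, w, key]

/-- Morphisms `a ⊗ x ⟶ c` are morphisms `x ⟶ a' ⊗ c`, hence elements of `H 1 (a' ⊗ c)`. Elements of
`H a c` embed there by the same transposition, and this is how universality at `𝟙_ C` yields
universality at `a`. -/
theorem IsUniversal.atL (h : E.IsUniversal η) (a a' : C) [ExactPairing a' a] :
    E.IsUniversal (E.atL η a) := fun c => by
  constructor
  · intro g g' w
    apply (tensorLeftHomEquiv x a' a c).injective
    apply h.ext
    rw [post_tensorLeftHomEquiv, post_tensorLeftHomEquiv]
    exact congrArg (fun k => E.pre (η_ a' a) (E.wl a' k)) w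
  · intro k
    -- The witness is forced: transpose `k` to an element at `𝟙_ C`, represent it by a morphism out
    -- of `x`, and transpose that morphism back.
    refine ⟨(tensorLeftHomEquiv x a' a c).symm (h.desc (E.pre (η_ a' a) (E.wl a' k))), ?_⟩
    apply pre_coevaluation_wl_injective a a'
    rw [← post_tensorLeftHomEquiv, Equiv.apply_symm_apply, h.fac]

theorem IsUniversal.atR (h : E.IsUniversal η) (a a' : C) [ExactPairing a a'] :
    E.IsUniversal (E.atR η a) := fun c => by
  constructor
  · intro g g' w
    apply (tensorRightHomEquiv x a a' c).injective
    apply h.ext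
    rw [post_tensorRightHomEquiv, post_tensorRightHomEquiv]
    exact congrArg (fun k => E.pre (η_ a a') (E.wr k a')) w
  · intro k
    refine ⟨(tensorRightHomEquiv x a a' c).symm (h.desc (E.pre (η_ a a') (E.wr k a'))), ?_⟩
    apply pre_coevaluation_wr_injective a a'
    rw [← post_tensorRightHomEquiv, Equiv.apply_symm_apply, h.fac]

end Duals

end Enrichment

end VEnriched

/-! ### The central functor given by representing objects. -/

namespace VEnriched

open EnrichmentData

theorem center_braiding_inv_f {C : Type u} [Category.{w} C] [MonoidalCategory C] (X Y : Center C) :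
    (β_ X Y).inv.f = (X.2.β Y.1).inv :=
  IsIso.Iso.inv_hom (X.2.β Y.1)

namespace Enrichment

variable {V : Type v} [Category.{w} V] [MonoidalCategory V] [BraidedCategory V]
  {C : Type u} [Category.{w} C] [MonoidalCategory C] (E : Enrichment V C)

/-- The identification of morphisms of `C` with points of the hom objects is linear. -/
structure IsLinear (k : Type u₁) [Field k] [Preadditive V] [CategoryTheory.Linear k V]
    [Preadditive C] [CategoryTheory.Linear k C] (E : Enrichment V C) : Prop where
  hom_add {a b : C} (f g : a ⟶ b) : E.hom (f + g) = E.hom f + E.hom g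
  hom_smul {a b : C} (r : k) (f : a ⟶ b) : E.hom (r • f) = r • E.hom f

section Linear

variable {k : Type u₁} [Field k] [Preadditive V] [CategoryTheory.Linear k V]
  [MonoidalPreadditive V] [Preadditive C] [CategoryTheory.Linear k C] {E}

theorem IsLinear.post_add (hE : E.IsLinear k) {v : V} {a b c : C} (f : v ⟶ E.H a b) (g g' : b ⟶ c) :
    E.post f (g + g') = E.post f g + E.post f g' := by
  simp only [post, mul, hE.hom_add, MonoidalPreadditive.tensor_add, Preadditive.add_comp,
    Preadditive.comp_add]

theorem IsLinear.post_smul [MonoidalLinear k V] (hE : E.IsLinear k) {v : V} {a b c : C}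
    (f : v ⟶ E.H a b) (r : k) (g : b ⟶ c) :
    E.post f (r • g) = r • E.post f g := by
  simp only [post, mul, hE.hom_smul, MonoidalCategory.tensorHom_def,
    MonoidalLinear.whiskerLeft_smul,
    Linear.smul_comp, Linear.comp_smul]

end Linear

/-- Representing objects for the functors `v ↦ (v ⟶ H 1 x)`. -/
structure UnitRepresentation where
  obj : V → C
  η (v : V) : v ⟶ E.H (𝟙_ C) (obj v)
  universal (v : V) : E.IsUniversal (η v)

namespace UnitRepresentation

variable {E} (P : E.UnitRepresentation)

/-- The morphisms between the representing objects. -/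
def map {u v : V} (f : u ⟶ v) : P.obj u ⟶ P.obj v := (P.universal u).desc (f ≫ P.η v)

theorem post_map {u v : V} (f : u ⟶ v) : E.post (P.η u) (P.map f) = f ≫ P.η v :=
  (P.universal u).fac _

theorem map_id (v : V) : P.map (𝟙 v) = 𝟙 (P.obj v) :=
  (P.universal v).ext (by rw [post_map, post_id, Category.id_comp])

theorem map_comp {u v w : V} (f : u ⟶ v) (g : v ⟶ w) : P.map (f ≫ g) = P.map f ≫ P.map g :=
  (P.universal u).ext (by
    rw [post_map, ← post_post, post_map, comp_post, post_map, Category.assoc])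

/-- The map `F 1 ⟶ 1`. -/
def counit : P.obj (𝟙_ V) ⟶ 𝟙_ C := (P.universal (𝟙_ V)).desc (E.hom (𝟙 _))

theorem post_counit : E.post (P.η (𝟙_ V)) P.counit = E.hom (𝟙 _) :=
  (P.universal _).fac _

/-- The map `F (u v) ⟶ F u ⊗ F v`. -/
def cotensor (u v : V) : P.obj (u ⊗ v) ⟶ P.obj u ⊗ P.obj v :=
  (P.universal (u ⊗ v)).desc (E.mul (P.η u) (E.atL (P.η v) (P.obj u)))

theorem post_cotensor (u v : V) : E.post (P.η (u ⊗ v)) (P.cotensor u v) =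
    E.mul (P.η u) (E.atL (P.η v) (P.obj u)) := (P.universal _).fac _

/-- Points of `H 1 c` are morphisms `𝟙_ C ⟶ c`, so `𝟙_ C` itself represents the case `v = 𝟙_ V`.
This is why the functor is strongly unital. -/
theorem isUniversal_hom_id : E.IsUniversal (E.hom (𝟙 (𝟙_ C))) := fun c => by
  convert E.hom.bijective using 2 with g
  rw [post_hom, Category.id_comp]

instance : IsIso P.counit :=
  (P.universal _).isIso_of_post (by rw [post_counit]; exact isUniversal_hom_id)

theorem cotensor_natural_left {u u' : V} (f : u ⟶ u') (v : V) :
    P.cotensor u v ≫ P.map f ▷ P.obj v =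
      P.map (f ▷ v) ≫ P.cotensor u' v := by
  apply (P.universal _).ext
  rw [← post_post, ← post_post, post_cotensor, ← mul_post, ← pre_atL, ← post_mul, post_map,
    post_map, comp_post, post_cotensor, comp_mul]

theorem cotensor_natural_right (u : V) {v v' : V} (f : v ⟶ v') :
    P.cotensor u v ≫ P.obj u ◁ P.map f =
      P.map (u ◁ f) ≫ P.cotensor u v' := by
  apply (P.universal _).ext
  rw [← post_post, ← post_post, post_cotensor, ← mul_post, ← atL_post, post_map, atL_comp,
    post_map, comp_post, post_cotensor, mul_comp]

/-- On the universal element both sides become the triple product of `η u`, `η v` and `η w`, up to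
the associator of `V`. -/
theorem cotensor_assoc (u v w : V) :
    P.cotensor (u ⊗ v) w ≫ P.cotensor u v ▷ P.obj w ≫ (α_ _ _ _).hom =
      P.map (α_ u v w).hom ≫ P.cotensor u (v ⊗ w) ≫ P.obj u ◁ P.cotensor v w := by
  apply (P.universal _).ext
  rw [← post_post, ← post_post, post_cotensor, ← mul_post, ← pre_atL, ← post_mul, post_cotensor,
    ← mul_post, atL_tensor, ← post_post, post_map, comp_post, ← post_post, post_cotensor,
    ← mul_post, ← atL_post, post_cotensor, atL_mul, E.mul_assoc]

theorem cotensor_left_unit (v : V) :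
    (λ_ (P.obj v)).inv =
      P.map (λ_ v).inv ≫ P.cotensor (𝟙_ V) v ≫ P.counit ▷ P.obj v := by
  apply (P.universal _).ext
  rw [← post_post, post_map, ← post_post, comp_post, post_cotensor, comp_post, ← mul_post,
    ← pre_atL, ← post_mul, post_counit, E.id_mul, Iso.inv_hom_id_assoc, atL_one]

theorem cotensor_right_unit (v : V) :
    (ρ_ (P.obj v)).inv =
      P.map (ρ_ v).inv ≫ P.cotensor v (𝟙_ V) ≫ P.obj v ◁ P.counit := by
  apply (P.universal _).ext
  rw [← post_post, post_map, ← post_post, comp_post, post_cotensor, comp_post, ← mul_post,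
    ← atL_post, post_counit, atL_hom, MonoidalCategory.whiskerLeft_id, Category.comp_id, post]

section Rigid

variable [RigidCategory C]

theorem universal_atL (a : C) (v : V) : E.IsUniversal (E.atL (P.η v) a) :=
  (P.universal v).atL a (ᘁa)

theorem universal_atR (a : C) (v : V) : E.IsUniversal (E.atR (P.η v) a) :=
  (P.universal v).atR a (aᘁ)

/-- The isomorphism `F v ⊗ a ≅ a ⊗ F v`. -/
def swap (v : V) (a : C) : P.obj v ⊗ a ≅ a ⊗ P.obj v :=
  (P.universal_atR a v).iso (P.universal_atL a v)

theorem post_swap_hom (v : V) (a : C) :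
    E.post (E.atR (P.η v) a) (P.swap v a).hom = E.atL (P.η v) a := (P.universal_atR a v).fac _

theorem post_swap_inv (v : V) (a : C) :
    E.post (E.atL (P.η v) a) (P.swap v a).inv = E.atR (P.η v) a := (P.universal_atL a v).fac _

/-- Both sides carry `atR` of `η v` at `a ⊗ b` to `atL`: the right side moves the element first past
`a` and then past `b`. -/
theorem swap_tensor (v : V) (a b : C) : (P.swap v (a ⊗ b)).hom =
    (α_ _ _ _).inv ≫ (P.swap v a).hom ▷ b ≫ (α_ _ _ _).hom ≫ a ◁ (P.swap v b).hom ≫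
      (α_ _ _ _).inv := by
  apply (P.universal_atR _ v).ext
  rw [post_swap_hom, ← post_post, ← atR_tensor, ← post_post, ← wr_post, post_swap_hom,
    ← post_post, wr_atL, ← post_post, ← wl_post, post_swap_hom, eq_comm, post_inv_eq, atL_tensor]

theorem swap_naturality_right (v : V) {a b : C} (f : a ⟶ b) :
    P.obj v ◁ f ≫ (P.swap v b).hom = (P.swap v a).hom ≫ f ▷ P.obj v := by
  apply (P.universal_atR _ v).ext
  rw [← post_post, ← post_post, post_swap_hom, ← pre_atL, ← pre_atR, ← pre_post, post_swap_hom]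

theorem swap_naturality_left {u v : V} (f : u ⟶ v) (a : C) :
    P.map f ▷ a ≫ (P.swap v a).hom = (P.swap u a).hom ≫ a ◁ P.map f := by
  apply (P.universal_atR _ u).ext
  rw [← post_post, ← post_post, ← atR_post, post_map, atR_comp, comp_post, post_swap_hom,
    post_swap_hom, ← atL_post, post_map, atL_comp]

theorem swap_counit (a : C) : P.counit ▷ a ≫ (λ_ a).hom ≫ (ρ_ a).inv =
    (P.swap (𝟙_ V) a).hom ≫ a ◁ P.counit := by
  apply (P.universal_atR _ _).ext
  rw [← post_post, ← post_post, ← post_post, ← atR_post, post_swap_hom, ← atL_post, post_counit,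
    atL_hom, atR_hom, post_hom, post_hom]
  simp

/-- The cotensor turns the universal element of `u ⊗ v` into a product of two elements, and the
product is moved past `a` one factor at a time. -/
theorem swap_cotensor (u v : V) (a : C) :
    P.cotensor u v ▷ a ≫ (α_ _ _ _).hom ≫ P.obj u ◁ (P.swap v a).hom ≫ (α_ _ _ _).inv ≫
      (P.swap u a).hom ▷ P.obj v ≫ (α_ _ _ _).hom =
    (P.swap (u ⊗ v) a).hom ≫ a ◁ P.cotensor u v := by
  apply (P.universal_atR _ _).ext
  have h : E.post (E.wl (P.obj u) (E.atL (P.η v) a)) (α_ _ _ _).inv =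
      E.atL (P.η v) (P.obj u ⊗ a) := by
    rw [post_inv_eq, atL_tensor]
  rw [← post_post, ← atR_post, post_cotensor, atR_mul, ← post_post, ← mul_post, wr_atL,
    ← post_post, ← mul_post, ← wl_post, post_swap_hom, ← post_post, ← mul_post, h, ← post_post,
    ← mul_post, ← pre_atL, ← post_mul, post_swap_hom, ← mul_post, atL_tensor,
    ← post_post, post_swap_hom, ← atL_post, post_cotensor, atL_mul]

/-- Of the axioms for the central functor, this is the one that uses `exchange` with a nontrivial
braiding: the left side multiplies the whiskered elements `η u` and `η v` in one order, the right
side in the other. -/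
theorem cotensor_braiding (u v : V) :
    P.cotensor u v ≫ (P.swap v (P.obj u)).inv =
      P.map (β_ u v).hom ≫ P.cotensor v u := by
  apply (P.universal _).ext
  rw [← post_post, post_cotensor, ← mul_post, post_swap_inv, ← post_post, post_map, comp_post,
    post_cotensor]
  -- Both universal elements are brought to whiskerings at the unit object with the same prefix `(λ_
  -- _).inv`, so that `exchange` applies to what follows.
  have h1 : E.post (P.η u) (λ_ _).inv = E.pre (λ_ _).inv (E.wl (𝟙_ C) (P.η u)) := by
    rw [← atL_one, atL, unitors_inv_equal]
  have h2 : E.post (P.η v) (ρ_ _).inv = E.pre (λ_ _).inv (E.wr (P.η v) (𝟙_ C)) := by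
    rw [← atR_one, atR]
  rw [atR, atL, ← post_mul, ← post_mul, h1, h2, pre_mul, pre_mul, E.exchange, pre_comp]

/-- The functor to the Drinfeld center. -/
def toCenter : V ⥤ Center C where
  obj v := ⟨P.obj v, P.swap v, P.swap_tensor v, P.swap_naturality_right v⟩
  map f := ⟨P.map f, fun a => P.swap_naturality_left f a⟩
  map_id v := Center.ext _ _ (P.map_id v)
  map_comp f g := Center.ext _ _ (P.map_comp f g)

instance : P.toCenter.OplaxMonoidal where
  η := ⟨P.counit, fun a => P.swap_counit a⟩
  δ u v := ⟨P.cotensor u v, fun a => P.swap_cotensor u v a⟩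
  δ_natural_left f v := Center.ext _ _ (P.cotensor_natural_left f v)
  δ_natural_right {_ _} u f := Center.ext _ _ (P.cotensor_natural_right u f)
  oplax_associativity u v w := Center.ext _ _ (P.cotensor_assoc u v w)
  oplax_left_unitality v := Center.ext _ _
    ((Center.leftUnitor_inv_f _).trans (P.cotensor_left_unit v))
  oplax_right_unitality v := Center.ext _ _
    ((Center.rightUnitor_inv_f _).trans (P.cotensor_right_unit v))

end Rigid

end UnitRepresentation

variable {k : Type u₁} [Field k] [Preadditive V] [CategoryTheory.Linear k V]
  [Preadditive C] [CategoryTheory.Linear k C]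

/-- The central functor `F` is induced by the enrichment `E`. -/
structure Induced (E : Enrichment V C) (F : CentralFunctor k V C) where
  η (v : V) : v ⟶ E.H (𝟙_ C) (F.functor.obj v)
  universal (v : V) : E.IsUniversal (η v)
  post_map {u v : V} (f : u ⟶ v) : E.post (η u) (F.functor.map f) = f ≫ η v
  post_counit : E.post (η (𝟙_ V)) F.counit = E.hom (𝟙 _)
  post_cotensor (u v : V) : E.post (η (u ⊗ v)) (F.cotensor u v) =
    E.mul (η u) (E.atL (η v) (F.functor.obj u))
  post_halfBraiding (a : C) (v : V) :
    E.post (E.atL (η v) a) (F.halfBraiding a v) = E.atR (η v) a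

namespace UnitRepresentation

variable {E} [MonoidalPreadditive V] (P : E.UnitRepresentation)

theorem map_add (hE : E.IsLinear k) {u v : V} (f g : u ⟶ v) :
    P.map (f + g) = P.map f + P.map g :=
  (P.universal u).ext (by rw [hE.post_add, post_map, post_map, post_map, Preadditive.add_comp])

theorem map_smul [MonoidalLinear k V] (hE : E.IsLinear k) (r : k) {u v : V} (f : u ⟶ v) :
    P.map (r • f) = r • P.map f :=
  (P.universal u).ext (by rw [hE.post_smul, post_map, post_map, Linear.smul_comp])

variable [MonoidalLinear k V] [RigidCategory C]

/-- The central functor given by a representation. -/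
def centralFunctor (hE : E.IsLinear k) : CentralFunctor k V C where
  toFunctor := P.toCenter
  isIso_η := by
    have : IsIso (Functor.OplaxMonoidal.η P.toCenter).f := inferInstanceAs (IsIso P.counit)
    infer_instance
  braided u v := by
    apply Center.ext
    exact (congrArg (P.cotensor u v ≫ ·) (center_braiding_inv_f _ _)).trans
      (P.cotensor_braiding u v)
  additive := ⟨P.map_add hE _ _⟩
  linear := ⟨fun f r => P.map_smul hE r f⟩

/-- The central functor given by a representation is induced by the enrichment. -/
def induced (hE : E.IsLinear k) : E.Induced (P.centralFunctor hE) where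
  η := P.η
  universal := P.universal
  post_map := P.post_map
  post_counit := P.post_counit
  post_cotensor := P.post_cotensor
  post_halfBraiding a v := P.post_swap_inv v a

end UnitRepresentation

end Enrichment

end VEnriched

/-! ### The underlying category of a `V`-monoidal category as an enrichment. -/

namespace VEnriched

section Elements

variable {V : Type v} [Category.{w} V] [MonoidalCategory V] {A : Type u} [EnrichedCategory V A]

/-- Composition of generalized elements of the hom objects of a `V`-category. -/
def elComp {u v : V} {a b c : A} (f : u ⟶ (a ⟶[V] b)) (g : v ⟶ (b ⟶[V] c)) :
    u ⊗ v ⟶ (a ⟶[V] c) := (f ⊗ₘ g) ≫ eComp V a b c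

theorem comp_elComp {u' u v : V} {a b c : A} (x : u' ⟶ u) (f : u ⟶ (a ⟶[V] b))
    (g : v ⟶ (b ⟶[V] c)) : elComp (x ≫ f) g = x ▷ v ≫ elComp f g := by
  simp [elComp, MonoidalCategory.tensorHom_def]

theorem elComp_comp {u v' v : V} {a b c : A} (f : u ⟶ (a ⟶[V] b)) (x : v' ⟶ v)
    (g : v ⟶ (b ⟶[V] c)) : elComp f (x ≫ g) = u ◁ x ≫ elComp f g := by
  simp [elComp, tensorHom_def']

theorem eId_elComp {v : V} {a b : A} (f : v ⟶ (a ⟶[V] b)) :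
    elComp (eId V a) f = (λ_ v).hom ≫ f := by
  rw [← Iso.inv_comp_eq, elComp, tensorHom_def', Category.assoc, ← leftUnitor_inv_naturality_assoc,
    e_id_comp, Category.comp_id]

theorem elComp_eId {v : V} {a b : A} (f : v ⟶ (a ⟶[V] b)) :
    elComp f (eId V b) = (ρ_ v).hom ≫ f := by
  rw [← Iso.inv_comp_eq, elComp, MonoidalCategory.tensorHom_def, Category.assoc,
    ← rightUnitor_inv_naturality_assoc, e_comp_id, Category.comp_id]

theorem elComp_assoc {u v w : V} {a b c d : A} (f : u ⟶ (a ⟶[V] b)) (g : v ⟶ (b ⟶[V] c))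
    (h : w ⟶ (c ⟶[V] d)) :
    elComp (elComp f g) h = (α_ u v w).hom ≫ elComp f (elComp g h) := by
  have e : (α_ _ _ _).inv ≫ _ ≫ _ = _ := e_assoc V a b c d
  rw [Iso.inv_comp_eq] at e
  have h1 : elComp (elComp f g) h = ((f ⊗ₘ g) ⊗ₘ h) ≫ eComp V a b c ▷ _ ≫ eComp V a c d := by
    simp only [elComp, ← tensorHom_id, tensorHom_comp_tensorHom_assoc, Category.comp_id]
  have h2 : elComp f (elComp g h) = (f ⊗ₘ (g ⊗ₘ h)) ≫ _ ◁ eComp V b c d ≫ eComp V a b d := by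
    simp only [elComp, ← id_tensorHom, tensorHom_comp_tensorHom_assoc, Category.comp_id]
  rw [h1, h2, e, associator_naturality_assoc]

theorem comp_postcomp {v : V} {a b c : A} (f : v ⟶ (a ⟶[V] b)) (g : 𝟙_ V ⟶ (b ⟶[V] c)) :
    f ≫ postcomp V a g = (ρ_ v).inv ≫ elComp f g := by
  rw [postcomp, elComp, MonoidalCategory.tensorHom_def, Category.assoc,
    rightUnitor_inv_naturality_assoc]

theorem comp_precomp {v : V} {a b c : A} (g : 𝟙_ V ⟶ (a ⟶[V] b)) (f : v ⟶ (b ⟶[V] c)) :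
    f ≫ precomp V g c = (λ_ v).inv ≫ elComp g f := by
  rw [precomp, elComp, tensorHom_def', Category.assoc, leftUnitor_inv_naturality_assoc]

variable [BraidedCategory V] [VMonoidalCategory V A]

/-- Tensor product of generalized elements of the hom objects of a `V`-monoidal category. -/
def elTensor {u v : V} {a b c d : A} (f : u ⟶ (a ⟶[V] c)) (g : v ⟶ (b ⟶[V] d)) :
    u ⊗ v ⟶ (vObj V a b ⟶[V] vObj V c d) := (f ⊗ₘ g) ≫ vHom V a b c d

theorem comp_elTensor {u' u v : V} {a b c d : A} (x : u' ⟶ u) (f : u ⟶ (a ⟶[V] c))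
    (g : v ⟶ (b ⟶[V] d)) : elTensor (x ≫ f) g = x ▷ v ≫ elTensor f g := by
  simp [elTensor, MonoidalCategory.tensorHom_def]

theorem elTensor_comp {u v' v : V} {a b c d : A} (f : u ⟶ (a ⟶[V] c)) (x : v' ⟶ v)
    (g : v ⟶ (b ⟶[V] d)) : elTensor f (x ≫ g) = u ◁ x ≫ elTensor f g := by
  simp [elTensor, tensorHom_def']

theorem elTensor_eId (a b : A) :
    elTensor (eId V a) (eId V b) = (λ_ (𝟙_ V)).hom ≫ eId V (vObj V a b) := by
  rw [← VMonoidalCategory.tensor_id, Iso.hom_inv_id_assoc, elTensor]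

theorem elTensor_interchange {u v u' v' : V} {a b c d e f : A} (x : u ⟶ (a ⟶[V] b))
    (y : v ⟶ (d ⟶[V] e)) (x' : u' ⟶ (b ⟶[V] c)) (y' : v' ⟶ (e ⟶[V] f)) :
    elComp (elTensor x y) (elTensor x' y') =
      tensorμ u v u' v' ≫ elTensor (elComp x x') (elComp y y') := by
  have h := VMonoidalCategory.interchange (V := V) a b c d e f
  simp only [elComp, elTensor, ← tensorHom_comp_tensorHom, Category.assoc]
  rw [h, tensorμ_natural_assoc]

theorem elTensor_assoc {u v w : V} {a b c d e f : A} (x : u ⟶ (a ⟶[V] d))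
    (y : v ⟶ (b ⟶[V] e)) (z : w ⟶ (c ⟶[V] f)) :
    elTensor (elTensor x y) z ≫
        postcomp V _ (ForgetEnrichment.homTo V (VMonoidalCategory.associator d e f).hom) =
      (α_ u v w).hom ≫ elTensor x (elTensor y z) ≫
        precomp V (ForgetEnrichment.homTo V (VMonoidalCategory.associator a b c).hom) _ := by
  have h := VMonoidalCategory.associator_naturality (V := V) a b c d e f
  have h1 : elTensor (elTensor x y) z =
      ((x ⊗ₘ y) ⊗ₘ z) ≫ vHom V a b d e ▷ _ ≫ vHom V _ c _ f := by
    simp only [elTensor, ← tensorHom_id, tensorHom_comp_tensorHom_assoc, Category.comp_id]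
  have h2 : elTensor x (elTensor y z) =
      (x ⊗ₘ (y ⊗ₘ z)) ≫ _ ◁ vHom V b c e f ≫ vHom V a _ d _ := by
    simp only [elTensor, ← id_tensorHom, tensorHom_comp_tensorHom_assoc, Category.comp_id]
  rw [h1, h2]
  simp only [Category.assoc]
  rw [h, associator_naturality_assoc]

theorem comp_tensorLeftMap {v : V} (a : A) {b c : A} (f : v ⟶ (b ⟶[V] c)) :
    f ≫ tensorLeftMap a b c = (λ_ v).inv ≫ elTensor (eId V a) f := by
  rw [tensorLeftMap, elTensor, tensorHom_def', Category.assoc, leftUnitor_inv_naturality_assoc]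

theorem comp_tensorRightMap {v : V} {b c : A} (f : v ⟶ (b ⟶[V] c)) (a : A) :
    f ≫ tensorRightMap b c a = (ρ_ v).inv ≫ elTensor f (eId V a) := by
  rw [tensorRightMap, elTensor, MonoidalCategory.tensorHom_def, Category.assoc,
    rightUnitor_inv_naturality_assoc]

/-- The interchange law with an identity in the left factor: the braiding in `tensorμ` then involves
the unit object and is structural. -/
theorem elComp_tensorLeftMap (a : A) {u v : V} {b c d : A} (f : u ⟶ (b ⟶[V] c))
    (g : v ⟶ (c ⟶[V] d)) : elComp f g ≫ tensorLeftMap a b d =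
      elComp (f ≫ tensorLeftMap a b c) (g ≫ tensorLeftMap a c d) := by
  simp only [comp_tensorLeftMap, comp_elComp, elComp_comp, elTensor_interchange, eId_elComp,
    comp_elTensor, tensorμ, braiding_tensorUnit_right]
  simp only [← Category.assoc]
  congr 1
  monoidal

theorem elComp_tensorRightMap {u v : V} {b c d : A} (f : u ⟶ (b ⟶[V] c))
    (g : v ⟶ (c ⟶[V] d)) (a : A) : elComp f g ≫ tensorRightMap b d a =
      elComp (f ≫ tensorRightMap b c a) (g ≫ tensorRightMap c d a) := by
  simp only [comp_tensorRightMap, comp_elComp, elComp_comp, elTensor_interchange, eId_elComp,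
    elTensor_comp, tensorμ, braiding_tensorUnit_left]
  simp only [← Category.assoc]
  congr 1
  monoidal

/-- The tensor product of elements is `f ⊗ id` followed by `id ⊗ g`; in this order `tensorμ` braids
only unit objects. -/
theorem elTensor_eq {u v : V} {a b c d : A} (f : u ⟶ (a ⟶[V] c)) (g : v ⟶ (b ⟶[V] d)) :
    elTensor f g = elComp (f ≫ tensorRightMap a c b) (g ≫ tensorLeftMap c b d) := by
  simp only [comp_tensorRightMap, comp_tensorLeftMap, comp_elComp, elComp_comp,
    elTensor_interchange, eId_elComp, elComp_eId, elTensor_comp, comp_elTensor, tensorμ,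
    braiding_tensorUnit_left]
  simp only [← Category.assoc]
  rw [eq_comm]
  -- All that remains in front of the tensor product is a structural endomorphism of `u ⊗ v`, which
  -- coherence identifies with the identity.
  convert Category.id_comp _
  monoidal

/-- Composing `id ⊗ g` before `f ⊗ id` is the order in which `tensorμ` braids `v` past `u`; the
opposite order is `elTensor_eq`. -/
theorem elComp_exchange {u v : V} {a b c d : A} (f : u ⟶ (a ⟶[V] c)) (g : v ⟶ (b ⟶[V] d)) :
    elComp (g ≫ tensorLeftMap a b d) (f ≫ tensorRightMap a c d) =
      (β_ v u).hom ≫ elComp (f ≫ tensorRightMap a c b) (g ≫ tensorLeftMap c b d) := by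
  rw [← elTensor_eq]
  simp only [comp_tensorRightMap, comp_tensorLeftMap, comp_elComp, elComp_comp,
    elTensor_interchange, eId_elComp, elComp_eId, elTensor_comp, comp_elTensor, tensorμ]
  simp only [← Category.assoc]
  congr 1
  monoidal

theorem eId_vObj (a b : A) :
    eId V (vObj V a b) = (λ_ (𝟙_ V)).inv ≫ elTensor (eId V a) (eId V b) := by
  rw [elTensor_eId, Iso.inv_hom_id_assoc]

open ForgetEnrichment

theorem tensorLeftMap_tensorLeftMap {v : V} (a b : A) {c d : A} (f : v ⟶ (c ⟶[V] d)) :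
    (f ≫ tensorLeftMap (vObj V a b) c d) ≫
        postcomp V _ (homTo V (VMonoidalCategory.associator a b d).hom) =
      ((f ≫ tensorLeftMap b c d) ≫ tensorLeftMap a _ _) ≫
        precomp V (homTo V (VMonoidalCategory.associator a b c).hom) _ := by
  simp only [comp_tensorLeftMap, eId_vObj, comp_elTensor, elTensor_comp, Category.assoc,
    elTensor_assoc]
  simp only [← Category.assoc]
  congr 2
  monoidal

theorem tensorRightMap_tensorLeftMap {v : V} (a b : A) {c d : A} (f : v ⟶ (c ⟶[V] d)) :
    ((f ≫ tensorLeftMap a c d) ≫ tensorRightMap _ _ b) ≫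
        postcomp V _ (homTo V (VMonoidalCategory.associator a d b).hom) =
      ((f ≫ tensorRightMap c d b) ≫ tensorLeftMap a _ _) ≫
        precomp V (homTo V (VMonoidalCategory.associator a c b).hom) _ := by
  simp only [comp_tensorLeftMap, comp_tensorRightMap, comp_elTensor, elTensor_comp,
    Category.assoc, elTensor_assoc]
  simp only [← Category.assoc]
  congr 2
  monoidal

theorem tensorRightMap_tensorRightMap {v : V} (a b : A) {c d : A} (f : v ⟶ (c ⟶[V] d)) :
    ((f ≫ tensorRightMap c d a) ≫ tensorRightMap _ _ b) ≫
        postcomp V _ (homTo V (VMonoidalCategory.associator d a b).hom) =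
      (f ≫ tensorRightMap c d (vObj V a b)) ≫
        precomp V (homTo V (VMonoidalCategory.associator c a b).hom) _ := by
  simp only [comp_tensorRightMap, eId_vObj, comp_elTensor, elTensor_comp, Category.assoc,
    elTensor_assoc]
  simp only [← Category.assoc]
  congr 2
  monoidal

theorem tensorLeftMap_one {v : V} {a b : A} (f : v ⟶ (a ⟶[V] b)) :
    (f ≫ tensorLeftMap (vOne V A) a b) ≫
        postcomp V _ (homTo V (VMonoidalCategory.leftUnitor b).hom) =
      f ≫ precomp V (homTo V (VMonoidalCategory.leftUnitor a).hom) b := by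
  rw [← VMonoidalCategory.leftUnitor_naturality, tensorLeftMap]
  simp only [Category.assoc]

theorem tensorRightMap_one {v : V} {a b : A} (f : v ⟶ (a ⟶[V] b)) :
    (f ≫ tensorRightMap a b (vOne V A)) ≫
        postcomp V _ (homTo V (VMonoidalCategory.rightUnitor b).hom) =
      f ≫ precomp V (homTo V (VMonoidalCategory.rightUnitor a).hom) b := by
  rw [← VMonoidalCategory.rightUnitor_naturality, tensorRightMap]
  simp only [Category.assoc]

variable (V A) in
/-- The enrichment of the underlying category of a `V`-monoidal category. -/
def undEnrichmentData : EnrichmentData V (Und V A) where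
  H a b := a.to ⟶[V] b.to
  hom := ⟨homTo V, homOf V, fun _ => rfl, fun _ => rfl⟩
  comp a b c := eComp V a.to b.to c.to
  left a b c := tensorLeftMap a.to b.to c.to
  right b c a := tensorRightMap b.to c.to a.to

theorem undEnrichmentData_post {v : V} {a b c : Und V A}
    (f : v ⟶ (undEnrichmentData V A).H a b) (g : b ⟶ c) :
    (undEnrichmentData V A).post f g = f ≫ postcomp V a.to (homTo V g) :=
  (comp_postcomp (a := a.to) (b := b.to) (c := c.to) f (homTo V g)).symm

theorem undEnrichmentData_pre {v : V} {a b c : Und V A} (g : a ⟶ b)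
    (f : v ⟶ (undEnrichmentData V A).H b c) :
    (undEnrichmentData V A).pre g f = f ≫ precomp V (homTo V g) c.to :=
  (comp_precomp (a := a.to) (b := b.to) (c := c.to) (homTo V g) f).symm

variable (V A) in
/-- The enrichment of the underlying category of a `V`-monoidal category. -/
def undEnrichment : Enrichment V (Und V A) where
  toEnrichmentData := undEnrichmentData V A
  hom_comp f g := by
    have h := homTo_comp V f g
    rw [Category.assoc] at h
    exact h.symm
  id_mul {v a b} f := by
    refine Eq.trans ?_ (eId_elComp (a := a.to) (b := b.to) f)
    exact congrArg (fun t => elComp t f) (homTo_id V a)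
  mul_id {v a b} f := by
    refine Eq.trans ?_ (elComp_eId (a := a.to) (b := b.to) f)
    exact congrArg (fun t => elComp f t) (homTo_id V b)
  mul_assoc {u v w a b c d} f g h :=
    elComp_assoc (a := a.to) (b := b.to) (c := c.to) (d := d.to) f g h
  wl_hom a {b c} f := by
    refine (comp_tensorLeftMap (b := b.to) (c := c.to) a.to (homTo V f)).trans ?_
    refine Eq.trans ?_ (homTo_whiskerLeft a f).symm
    rw [homTo_id]
    rfl
  wr_hom {b c} f a := by
    refine (comp_tensorRightMap (b := b.to) (c := c.to) (homTo V f) a.to).trans ?_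
    refine Eq.trans ?_ (homTo_whiskerRight a f).symm
    rw [homTo_id, unitors_inv_equal]
    rfl
  wl_mul a {u v b c d} f g := elComp_tensorLeftMap a.to (b := b.to) (c := c.to) (d := d.to) f g
  wr_mul {u v b c d} f g a := elComp_tensorRightMap (b := b.to) (c := c.to) (d := d.to) f g a.to
  exchange {u v a b c d} f g :=
    elComp_exchange (a := a.to) (b := b.to) (c := c.to) (d := d.to) f g
  wl_wl {v} a b {c d} f := by
    rw [undEnrichmentData_post, undEnrichmentData_pre]
    exact tensorLeftMap_tensorLeftMap a.to b.to (c := c.to) (d := d.to) f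
  wl_wr {v} a b {c d} f := by
    rw [undEnrichmentData_post, undEnrichmentData_pre]
    exact tensorRightMap_tensorLeftMap a.to b.to (c := c.to) (d := d.to) f
  wr_wr {v} a b {c d} f := by
    rw [undEnrichmentData_post, undEnrichmentData_pre]
    exact tensorRightMap_tensorRightMap a.to b.to (c := c.to) (d := d.to) f
  one_wl {v a b} f := by
    rw [undEnrichmentData_post, undEnrichmentData_pre]
    exact tensorLeftMap_one (a := a.to) (b := b.to) f
  wr_one {v a b} f := by
    rw [undEnrichmentData_post, undEnrichmentData_pre]
    exact tensorRightMap_one (a := a.to) (b := b.to) f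

theorem undEnrichment_isLinear (k : Type u₁) [Field k] [Preadditive V]
    [CategoryTheory.Linear k V] : (undEnrichment V A).IsLinear k where
  hom_add f g := homTo_add f g
  hom_smul r f := homTo_smul r f

theorem undEnrichment_post {v : V} {a b c : Und V A}
    (f : v ⟶ (undEnrichment V A).H a b) (g : b ⟶ c) :
    (undEnrichment V A).post f g = f ≫ postcomp V a.to (homTo V g) :=
  undEnrichmentData_post f g

theorem undEnrichment_pre {v : V} {a b c : Und V A} (g : a ⟶ b)
    (f : v ⟶ (undEnrichment V A).H b c) :
    (undEnrichment V A).pre g f = f ≫ precomp V (homTo V g) c.to :=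
  undEnrichmentData_pre g f

/-- Translates the product used in `Enrichment.Induced` into the tensor product of hom objects used
in `IsInducedBy`. -/
theorem undEnrichment_mul_atL {u v : V} {x y : Und V A}
    (f : u ⟶ (undEnrichment V A).H (𝟙_ _) x) (g : v ⟶ (undEnrichment V A).H (𝟙_ _) y) :
    (undEnrichment V A).mul f ((undEnrichment V A).atL g x) =
      (f ⊗ₘ g) ≫ vHom V (vOne V A) (vOne V A) x.to y.to ≫
        precomp V (homTo V (λ_ (𝟙_ (Und V A))).inv) _ := by
  rw [Enrichment.mul_atL, undEnrichment_pre]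
  have h := elTensor_eq (a := vOne V A) (b := vOne V A) (c := x.to) (d := y.to) f g
  refine (congrArg (· ≫ precomp V (homTo V (λ_ (𝟙_ (Und V A))).inv) _) h.symm).trans ?_
  exact Category.assoc _ _ _

theorem undEnrichment_post_atL {v : V} {x c : Und V A} (a : Und V A)
    (f : v ⟶ (undEnrichment V A).H (𝟙_ _) x) (g : a ⊗ x ⟶ c) :
    (undEnrichment V A).post ((undEnrichment V A).atL f a) g =
      f ≫ tensorLeftMap a.to (vOne V A) x.to ≫ precomp V (homTo V (ρ_ a).inv) _ ≫
        postcomp V a.to (homTo V g) := by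
  rw [Enrichment.atL, undEnrichment_post, undEnrichment_pre]
  exact (Category.assoc _ _ _).trans (Category.assoc _ _ _)

theorem undEnrichment_atR {v : V} {x : Und V A} (a : Und V A)
    (f : v ⟶ (undEnrichment V A).H (𝟙_ _) x) :
    (undEnrichment V A).atR f a =
      f ≫ tensorRightMap (vOne V A) x.to a.to ≫ precomp V (homTo V (λ_ a).inv) _ := by
  rw [Enrichment.atR, undEnrichment_pre]
  exact Category.assoc _ _ _

/-- Composition with the unit of an adjunction is its hom bijection, so the unit is a universal
element. -/
theorem isUniversal_unit {a : Und V A} {L : V ⥤ Und V A} (adj : L ⊣ reprFunctor V a.to) (v : V) :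
    (undEnrichment V A).IsUniversal (a := a) (x := L.obj v) (adj.unit.app v) := fun c => by
  have h : (fun g : L.obj v ⟶ c =>
      (undEnrichment V A).post (a := a) (b := L.obj v) (adj.unit.app v) g) =
      adj.homEquiv v c := funext fun g =>
    (undEnrichment_post (a := a) (b := L.obj v) (adj.unit.app v) g).trans
      (adj.homEquiv_unit v c g).symm
  exact h ▸ (adj.homEquiv v c).bijective

/-- A left adjoint amounts to a choice of representing objects, one for each `v`; their
functoriality is automatic. -/
theorem isRightAdjoint_reprFunctor (a : Und V A) : (reprFunctor V a.to).IsRightAdjoint ↔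
    ∀ v : V, ∃ (x : Und V A) (η : v ⟶ (undEnrichment V A).H a x),
      (undEnrichment V A).IsUniversal η := by
  constructor
  · intro h v
    exact ⟨_, _, isUniversal_unit (Adjunction.ofIsRightAdjoint (reprFunctor V a.to)) v⟩
  · intro h
    choose x η hη using h
    refine (Adjunction.adjunctionOfEquivLeft (G := reprFunctor V a.to) (F_obj := x)
      (fun v b => Equiv.ofBijective _ (hη v b)) ?_).isRightAdjoint
    intro v b c g f
    change (undEnrichment V A).post (η v) (f ≫ g) = (undEnrichment V A).post (η v) f ≫ _
    rw [← Enrichment.post_post, undEnrichment_post _ g]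
    rfl

variable {k : Type u₁} [Field k] [Preadditive V] [CategoryTheory.Linear k V]

/-- The adjunction given by an induced central functor. -/
def Enrichment.Induced.adjunction {F : CentralFunctor k V (Und V A)}
    (I : (undEnrichment V A).Induced F) : F.functor ⊣ reprFunctor V (vOne V A) :=
  Adjunction.mkOfHomEquiv
    { homEquiv v b := Equiv.ofBijective _ (I.universal v b)
      homEquiv_naturality_left_symm := by
        intro u v b f g
        rw [Equiv.symm_apply_eq]
        -- Every element is composition of the universal element with some morphism, which removes
        -- the inverse bijection from the equation.
        obtain ⟨g, rfl⟩ := (Equiv.ofBijective _ (I.universal v b)).surjective g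
        refine Eq.trans ?_ (congrArg (fun t => (undEnrichment V A).post (I.η u)
          (F.functor.map f ≫ t)) (Equiv.symm_apply_apply _ g).symm)
        change f ≫ (undEnrichment V A).post (I.η v) g =
          (undEnrichment V A).post (I.η u) (F.functor.map f ≫ g)
        rw [← Enrichment.post_post, I.post_map, EnrichmentData.comp_post]
      homEquiv_naturality_right := by
        intro v b c f g
        change (undEnrichment V A).post (I.η v) (f ≫ g) =
          (undEnrichment V A).post (I.η v) f ≫ _
        rw [← Enrichment.post_post, undEnrichment_post _ g]
        rfl }

theorem Enrichment.Induced.adjunction_unit {F : CentralFunctor k V (Und V A)}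
    (I : (undEnrichment V A).Induced F) (v : V) : I.adjunction.unit.app v = I.η v :=
  (Adjunction.mkOfHomEquiv_unit_app _ _).trans (Enrichment.post_id _ (I.η v))

theorem isInducedBy_of_induced {F : CentralFunctor k V (Und V A)}
    (I : (undEnrichment V A).Induced F) : IsInducedBy A F := by
  refine ⟨I.adjunction, ?_⟩
  intro unit
  have hunit : unit = I.η := funext I.adjunction_unit
  clear_value unit
  subst hunit
  refine ⟨?_, fun u v => ?_, fun a v => ?_⟩
  · exact (undEnrichment_post _ _).symm.trans (I.post_counit.trans (homTo_id V _))
  · exact (undEnrichment_post _ _).symm.trans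
      ((I.post_cotensor u v).trans (undEnrichment_mul_atL _ _))
  · exact (undEnrichment_post_atL a _ _).symm.trans
      ((I.post_halfBraiding a v).trans (undEnrichment_atR _ _))

theorem nonempty_induced {F : CentralFunctor k V (Und V A)} (h : IsInducedBy A F) :
    Nonempty ((undEnrichment V A).Induced F) := by
  obtain ⟨adj, h1, h2, h3⟩ := h
  exact ⟨{
    η := fun v => adj.unit.app v
    universal := fun v => isUniversal_unit adj v
    post_map := fun {u v} f => (undEnrichment_post _ _).trans (adj.unit.naturality f).symm
    post_counit := (undEnrichment_post _ _).trans (h1.trans (homTo_id V _).symm)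
    post_cotensor := fun u v => (undEnrichment_post _ _).trans
      ((h2 u v).trans (undEnrichment_mul_atL _ _).symm)
    post_halfBraiding := fun a v => (undEnrichment_post_atL a _ _).trans
      ((h3 a v).trans (undEnrichment_atR _ _).symm) }⟩

end Elements

end VEnriched

/-! ### The calculus of morphisms `a ⊗ F v ⟶ b` for a central functor `F`. -/

namespace VEnriched

/-- Up to unitors `e` is an automorphism `f` of `x`. The hypothesis, which is the hexagon at `𝟙_ C ⊗
𝟙_ C`, says that `f` is idempotent, and an invertible idempotent is the identity. -/
theorem eq_unitors_of_multiplicative {C : Type u} [Category.{w} C] [MonoidalCategory C] {x : C}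
    (e : 𝟙_ C ⊗ x ≅ x ⊗ 𝟙_ C)
    (h : (λ_ (𝟙_ C)).hom ▷ x ≫ e.hom = ((α_ _ _ _).hom ≫ 𝟙_ C ◁ e.hom ≫ (α_ _ _ _).inv ≫
      e.hom ▷ 𝟙_ C ≫ (α_ _ _ _).hom) ≫ x ◁ (λ_ (𝟙_ C)).hom) :
    e.hom = (λ_ x).hom ≫ (ρ_ x).inv := by
  obtain ⟨f, rfl⟩ : ∃ f : x ≅ x, e = λ_ x ≪≫ f ≪≫ (ρ_ x).symm :=
    ⟨(λ_ x).symm ≪≫ e ≪≫ ρ_ x, by ext; simp⟩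
  simp only [Iso.trans_hom, Iso.symm_hom] at h ⊢
  have h1 : ((λ_ (𝟙_ C)).hom ▷ x ≫ (λ_ x).hom) ≫ f.hom ≫ (ρ_ x).inv =
      ((λ_ (𝟙_ C)).hom ▷ x ≫ (λ_ x).hom) ≫ (f.hom ≫ f.hom) ≫ (ρ_ x).inv := by
    refine Eq.trans ?_ (h.trans ?_) <;> monoidal
  have h2 : f.hom = f.hom ≫ f.hom := by
    rwa [cancel_epi, cancel_mono] at h1
  have h3 : f.hom = 𝟙 _ := by rw [← cancel_epi f.hom, Category.comp_id, ← h2]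
  rw [h3, Category.id_comp]

namespace CentralFunctor

open Functor.OplaxMonoidal

variable {k : Type u₁} [Field k]
  {V : Type v} [Category.{w} V] [MonoidalCategory V] [BraidedCategory V]
  [Preadditive V] [CategoryTheory.Linear k V]
  {C : Type u} [Category.{w} C] [MonoidalCategory C] [Preadditive C]
  [CategoryTheory.Linear k C] (F : CentralFunctor k V C)

/-- The value of the functor to `C` on objects. -/
abbrev ob (v : V) : C := F.functor.obj v

/-- The value of the functor to `C` on morphisms. -/
abbrev mp {u v : V} (f : u ⟶ v) : F.ob u ⟶ F.ob v := F.functor.map f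

theorem mp_id (v : V) : F.mp (𝟙 v) = 𝟙 (F.ob v) := F.functor.map_id v

theorem mp_comp {u v w : V} (f : u ⟶ v) (g : v ⟶ w) : F.mp (f ≫ g) = F.mp f ≫ F.mp g :=
  F.functor.map_comp f g

theorem cotensor_natural_left {u u' : V} (f : u ⟶ u') (v : V) :
    F.mp (f ▷ v) ≫ F.cotensor u' v = F.cotensor u v ≫ F.mp f ▷ F.ob v :=
  congrArg Center.Hom.f (δ_natural_left F.toFunctor f v).symm

theorem cotensor_natural_right (u : V) {v v' : V} (f : v ⟶ v') :
    F.mp (u ◁ f) ≫ F.cotensor u v' = F.cotensor u v ≫ F.ob u ◁ F.mp f :=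
  congrArg Center.Hom.f (δ_natural_right F.toFunctor u f).symm

theorem cotensor_assoc (u v w : V) :
    F.cotensor (u ⊗ v) w ≫ F.cotensor u v ▷ F.ob w ≫ (α_ _ _ _).hom =
      F.mp (α_ u v w).hom ≫ F.cotensor u (v ⊗ w) ≫ F.ob u ◁ F.cotensor v w :=
  congrArg Center.Hom.f (Functor.OplaxMonoidal.oplax_associativity F.toFunctor u v w)

theorem cotensor_counit_left (v : V) :
    F.cotensor (𝟙_ V) v ≫ F.counit ▷ F.ob v = F.mp (λ_ v).hom ≫ (λ_ (F.ob v)).inv := by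
  have h : (λ_ (F.ob v)).inv = F.mp (λ_ v).inv ≫ F.cotensor (𝟙_ V) v ≫ F.counit ▷ F.ob v :=
    (Center.leftUnitor_inv_f (F.toFunctor.obj v)).symm.trans
      (congrArg Center.Hom.f (Functor.OplaxMonoidal.oplax_left_unitality F.toFunctor v))
  rw [h, ← Category.assoc (F.mp _), ← mp_comp, Iso.hom_inv_id, mp_id, Category.id_comp]

theorem cotensor_counit_right (v : V) :
    F.cotensor v (𝟙_ V) ≫ F.ob v ◁ F.counit = F.mp (ρ_ v).hom ≫ (ρ_ (F.ob v)).inv := by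
  have h : (ρ_ (F.ob v)).inv = F.mp (ρ_ v).inv ≫ F.cotensor v (𝟙_ V) ≫ F.ob v ◁ F.counit :=
    (Center.rightUnitor_inv_f (F.toFunctor.obj v)).symm.trans
      (congrArg Center.Hom.f (Functor.OplaxMonoidal.oplax_right_unitality F.toFunctor v))
  rw [h, ← Category.assoc (F.mp _), ← mp_comp, Iso.hom_inv_id, mp_id, Category.id_comp]

/-- The half-braiding as an isomorphism. -/
def halfBraidingIso (a : C) (v : V) : a ⊗ F.ob v ≅ F.ob v ⊗ a :=
  ((F.toFunctor.obj v).2.β a).symm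

theorem halfBraidingIso_hom (a : C) (v : V) : (F.halfBraidingIso a v).hom = F.halfBraiding a v :=
  rfl

theorem halfBraiding_naturality_left {a b : C} (f : a ⟶ b) (v : V) :
    f ▷ F.ob v ≫ F.halfBraiding b v = F.halfBraiding a v ≫ F.ob v ◁ f := by
  rw [← halfBraidingIso_hom, ← halfBraidingIso_hom, ← Iso.eq_comp_inv, Category.assoc,
    ← Iso.inv_comp_eq]
  exact ((F.toFunctor.obj v).2.naturality f).symm

theorem halfBraiding_naturality_right (a : C) {u v : V} (f : u ⟶ v) :
    a ◁ F.mp f ≫ F.halfBraiding a v = F.halfBraiding a u ≫ F.mp f ▷ a := by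
  rw [← halfBraidingIso_hom, ← halfBraidingIso_hom, ← Iso.eq_comp_inv, Category.assoc,
    ← Iso.inv_comp_eq]
  exact ((F.toFunctor.map f).comm a).symm

theorem halfBraiding_tensor (a b : C) (v : V) :
    F.halfBraiding (a ⊗ b) v = (α_ _ _ _).hom ≫ a ◁ F.halfBraiding b v ≫ (α_ _ _ _).inv ≫
      F.halfBraiding a v ▷ b ≫ (α_ _ _ _).hom := by
  have h : (F.halfBraidingIso (a ⊗ b) v).inv = (α_ _ _ _).inv ≫
      (F.halfBraidingIso a v).inv ▷ b ≫ (α_ _ _ _).hom ≫ a ◁ (F.halfBraidingIso b v).inv ≫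
        (α_ _ _ _).inv := (F.toFunctor.obj v).2.monoidal a b
  simp only [← halfBraidingIso_hom]
  rw [← cancel_epi (F.halfBraidingIso (a ⊗ b) v).inv, Iso.inv_hom_id, h]
  simp

theorem halfBraiding_cotensor (a : C) (u v : V) :
    F.halfBraiding a (u ⊗ v) ≫ F.cotensor u v ▷ a =
      a ◁ F.cotensor u v ≫ (α_ _ _ _).inv ≫ F.halfBraiding a u ▷ F.ob v ≫ (α_ _ _ _).hom ≫
        F.ob u ◁ F.halfBraiding a v ≫ (α_ _ _ _).inv := by
  have h := (δ F.toFunctor u v).comm a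
  rw [← halfBraidingIso_hom, ← Iso.eq_inv_comp]
  have h' : F.cotensor u v ▷ a ≫ (α_ _ _ _).hom ≫ F.ob u ◁ (F.halfBraidingIso a v).inv ≫
      (α_ _ _ _).inv ≫ (F.halfBraidingIso a u).inv ▷ F.ob v ≫ (α_ _ _ _).hom =
      (F.halfBraidingIso a (u ⊗ v)).inv ≫ a ◁ F.cotensor u v := h
  rw [← reassoc_of% h', ← halfBraidingIso_hom, ← halfBraidingIso_hom]
  simp

theorem halfBraiding_counit (a : C) :
    F.halfBraiding a (𝟙_ V) ≫ F.counit ▷ a = a ◁ F.counit ≫ (ρ_ a).hom ≫ (λ_ a).inv := by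
  have h : F.counit ▷ a ≫ (λ_ a).hom ≫ (ρ_ a).inv =
      (F.halfBraidingIso a (𝟙_ V)).inv ≫ a ◁ F.counit := (η F.toFunctor).comm a
  rw [← halfBraidingIso_hom, ← Iso.eq_inv_comp, ← reassoc_of% h]
  simp

/-- A half-braiding is only required to be natural and multiplicative. Its value at the unit follows
from naturality along `𝟙_ C ⊗ 𝟙_ C ≅ 𝟙_ C`. -/
theorem halfBraiding_unit (v : V) :
    F.halfBraiding (𝟙_ C) v = (λ_ _).hom ≫ (ρ_ _).inv := by
  have h := F.halfBraiding_naturality_left (λ_ (𝟙_ C)).hom v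
  rw [halfBraiding_tensor] at h
  exact eq_unitors_of_multiplicative (F.halfBraidingIso (𝟙_ C) v) h

theorem cotensor_braided (u v : V) :
    F.cotensor u v ≫ F.halfBraiding (F.ob u) v = F.mp (β_ u v).hom ≫ F.cotensor v u := by
  have h := congrArg Center.Hom.f (F.braided u v)
  refine Eq.trans (congrArg (F.cotensor u v ≫ ·) ?_) h
  exact (center_braiding_inv_f _ _).symm

instance : IsIso F.counit := by
  have := F.isIso_η
  exact inferInstanceAs (IsIso ((Center.forget C).map (η F.toFunctor)))

/-! ### Morphisms `a ⊗ F v ⟶ b` -/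

/-- Composition of morphisms `a ⊗ F u ⟶ b` and `b ⊗ F v ⟶ c`. -/
def gmul {u v : V} {a b c : C} (g : a ⊗ F.ob u ⟶ b) (h : b ⊗ F.ob v ⟶ c) :
    a ⊗ F.ob (u ⊗ v) ⟶ c :=
  a ◁ F.cotensor u v ≫ (α_ _ _ _).inv ≫ g ▷ F.ob v ≫ h

/-- Left whiskering of a morphism `b ⊗ F v ⟶ c`. -/
def gwl (a : C) {v : V} {b c : C} (g : b ⊗ F.ob v ⟶ c) : (a ⊗ b) ⊗ F.ob v ⟶ a ⊗ c :=
  (α_ _ _ _).hom ≫ a ◁ g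

/-- Right whiskering of a morphism `b ⊗ F v ⟶ c`. -/
def gwr {v : V} {b c : C} (g : b ⊗ F.ob v ⟶ c) (a : C) : (b ⊗ a) ⊗ F.ob v ⟶ c ⊗ a :=
  (α_ _ _ _).hom ≫ b ◁ F.halfBraiding a v ≫ (α_ _ _ _).inv ≫ g ▷ a

/-- The morphism `a ⊗ F 1 ⟶ b` given by a morphism `a ⟶ b`. -/
def ghom {a b : C} (f : a ⟶ b) : a ⊗ F.ob (𝟙_ V) ⟶ b := a ◁ F.counit ≫ (ρ_ a).hom ≫ f

theorem ghom_gmul {v : V} {a b c : C} (f : a ⟶ b) (g : b ⊗ F.ob v ⟶ c) :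
    F.gmul (F.ghom f) g = a ◁ F.mp (λ_ v).hom ≫ f ▷ F.ob v ≫ g := by
  simp only [gmul, ghom]
  calc
    _ = 𝟙 _ ⊗≫ a ◁ (F.cotensor (𝟙_ V) v ≫ F.counit ▷ F.ob v) ⊗≫ (f ▷ F.ob v ≫ g) ⊗≫ 𝟙 _ := by
      monoidal
    _ = _ := by rw [cotensor_counit_left]; monoidal

theorem gmul_ghom {v : V} {a b c : C} (g : a ⊗ F.ob v ⟶ b) (f : b ⟶ c) :
    F.gmul g (F.ghom f) = a ◁ F.mp (ρ_ v).hom ≫ g ≫ f := by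
  simp only [gmul, ghom]
  calc
    _ = 𝟙 _ ⊗≫ a ◁ F.cotensor v (𝟙_ V) ⊗≫ (g ▷ F.ob (𝟙_ V) ≫ b ◁ F.counit) ⊗≫ f ⊗≫ 𝟙 _ := by
      monoidal
    _ = 𝟙 _ ⊗≫ a ◁ (F.cotensor v (𝟙_ V) ≫ F.ob v ◁ F.counit) ⊗≫ (g ≫ f) ⊗≫ 𝟙 _ := by
      rw [← whisker_exchange]; monoidal
    _ = _ := by rw [cotensor_counit_right]; monoidal

theorem gmul_assoc {u v w : V} {a b c d : C} (f : a ⊗ F.ob u ⟶ b) (g : b ⊗ F.ob v ⟶ c)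
    (h : c ⊗ F.ob w ⟶ d) :
    F.gmul (F.gmul f g) h = a ◁ F.mp (α_ u v w).hom ≫ F.gmul f (F.gmul g h) := by
  simp only [gmul]
  calc
    _ = 𝟙 _ ⊗≫ a ◁ (F.cotensor (u ⊗ v) w ≫ F.cotensor u v ▷ F.ob w ≫ (α_ _ _ _).hom) ⊗≫
        (f ▷ F.ob v ≫ g) ▷ F.ob w ≫ h := by monoidal
    _ = 𝟙 _ ⊗≫ a ◁ F.mp (α_ u v w).hom ⊗≫ a ◁ F.cotensor u (v ⊗ w) ⊗≫
        ((a ⊗ F.ob u) ◁ F.cotensor v w ≫ f ▷ (F.ob v ⊗ F.ob w)) ⊗≫ g ▷ F.ob w ≫ h := by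
      rw [cotensor_assoc]; monoidal
    _ = _ := by rw [whisker_exchange]; monoidal

theorem gwl_gmul (a : C) {u v : V} {b c d : C} (g : b ⊗ F.ob u ⟶ c) (h : c ⊗ F.ob v ⟶ d) :
    F.gwl a (F.gmul g h) = F.gmul (F.gwl a g) (F.gwl a h) := by
  simp only [gmul, gwl]
  monoidal

/-- Right whiskering moves `a` past `F (u ⊗ v)`. Since the oplax structure consists of morphisms of
the center, this is moving it past `F u` and then past `F v`. -/
theorem gwr_gmul {u v : V} {b c d : C} (g : b ⊗ F.ob u ⟶ c) (h : c ⊗ F.ob v ⟶ d) (a : C) :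
    F.gwr (F.gmul g h) a = F.gmul (F.gwr g a) (F.gwr h a) := by
  simp only [gmul, gwr]
  calc
    _ = 𝟙 _ ⊗≫ b ◁ (F.halfBraiding a (u ⊗ v) ≫ F.cotensor u v ▷ a) ⊗≫
        (g ▷ F.ob v ≫ h) ▷ a := by monoidal
    _ = 𝟙 _ ⊗≫ b ◁ a ◁ F.cotensor u v ⊗≫ b ◁ F.halfBraiding a u ▷ F.ob v ⊗≫
        ((b ⊗ F.ob u) ◁ F.halfBraiding a v ≫ g ▷ (F.ob v ⊗ a)) ⊗≫ h ▷ a := by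
      rw [halfBraiding_cotensor]; monoidal
    _ = _ := by rw [whisker_exchange]; monoidal

/-- Naturality moves `g` through the half-braiding with `F u`, and multiplicativity splits the
half-braiding of `b ⊗ F v`. The factor for `F v` is then absorbed by the oplax structure because `F`
is braided, and this produces the braiding of `V`. -/
theorem gmul_exchange {u v : V} {a b c d : C} (f : a ⊗ F.ob u ⟶ c) (g : b ⊗ F.ob v ⟶ d) :
    F.gmul (F.gwl a g) (F.gwr f d) =
      (a ⊗ b) ◁ F.mp (β_ v u).hom ≫ F.gmul (F.gwr f b) (F.gwl c g) := by
  simp only [gmul, gwl, gwr]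
  calc
    _ = 𝟙 _ ⊗≫ (a ⊗ b) ◁ F.cotensor v u ⊗≫ a ◁ (g ▷ F.ob u ≫ F.halfBraiding d u) ⊗≫
        f ▷ d := by monoidal
    _ = 𝟙 _ ⊗≫ (a ⊗ b) ◁ (F.cotensor v u ≫ F.halfBraiding (F.ob v) u) ⊗≫
        a ◁ F.halfBraiding b u ▷ F.ob v ⊗≫ ((a ⊗ F.ob u) ◁ g ≫ f ▷ d) := by
      rw [halfBraiding_naturality_left, halfBraiding_tensor]; monoidal
    _ = _ := by rw [cotensor_braided, whisker_exchange]; monoidal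

theorem gwl_gwl {v : V} (a b : C) {c d : C} (f : c ⊗ F.ob v ⟶ d) :
    F.gwl (a ⊗ b) f ≫ (α_ a b d).hom =
      (α_ a b c).hom ▷ F.ob v ≫ F.gwl a (F.gwl b f) := by
  simp only [gwl]
  monoidal

theorem gwr_gwl {v : V} (a b : C) {c d : C} (f : c ⊗ F.ob v ⟶ d) :
    F.gwr (F.gwl a f) b ≫ (α_ a d b).hom =
      (α_ a c b).hom ▷ F.ob v ≫ F.gwl a (F.gwr f b) := by
  simp only [gwl, gwr]
  monoidal

theorem gwr_gwr {v : V} (a b : C) {c d : C} (f : c ⊗ F.ob v ⟶ d) :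
    F.gwr (F.gwr f a) b ≫ (α_ d a b).hom =
      (α_ c a b).hom ▷ F.ob v ≫ F.gwr f (a ⊗ b) := by
  simp only [gwr, halfBraiding_tensor]
  monoidal

theorem gwl_one {v : V} {a b : C} (f : a ⊗ F.ob v ⟶ b) :
    F.gwl (𝟙_ C) f ≫ (λ_ b).hom = (λ_ a).hom ▷ F.ob v ≫ f := by
  simp only [gwl]
  monoidal

theorem gwr_one {v : V} {a b : C} (f : a ⊗ F.ob v ⟶ b) :
    F.gwr f (𝟙_ C) ≫ (ρ_ b).hom = (ρ_ a).hom ▷ F.ob v ≫ f := by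
  simp only [gwr, halfBraiding_unit]
  monoidal

theorem gwl_ghom (a : C) {b c : C} (f : b ⟶ c) : F.gwl a (F.ghom f) = F.ghom (a ◁ f) := by
  simp only [gwl, ghom]
  monoidal

theorem gwr_ghom {b c : C} (f : b ⟶ c) (a : C) : F.gwr (F.ghom f) a = F.ghom (f ▷ a) := by
  simp only [gwr, ghom]
  calc
    _ = 𝟙 _ ⊗≫ b ◁ (F.halfBraiding a (𝟙_ V) ≫ F.counit ▷ a) ⊗≫ f ▷ a := by monoidal
    _ = _ := by rw [halfBraiding_counit]; monoidal

end CentralFunctor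

end VEnriched

/-! ### Internal homs and the enrichment that they give. -/

namespace VEnriched

open EnrichmentData

variable {k : Type u₁} [Field k]
  {V : Type v} [Category.{w} V] [MonoidalCategory V] [BraidedCategory V]
  [Preadditive V] [CategoryTheory.Linear k V]
  {C : Type u} [Category.{w} C] [MonoidalCategory C] [Preadditive C]
  [CategoryTheory.Linear k C]

namespace CentralFunctor

variable (F : CentralFunctor k V C)

theorem comp_gmul {u' u v : V} {a b c : C} (x : u' ⟶ u) (g : a ⊗ F.ob u ⟶ b)
    (h : b ⊗ F.ob v ⟶ c) :
    F.gmul (a ◁ F.mp x ≫ g) h = a ◁ F.mp (x ▷ v) ≫ F.gmul g h := by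
  simp only [gmul]
  calc
    _ = 𝟙 _ ⊗≫ a ◁ (F.cotensor u' v ≫ F.mp x ▷ F.ob v) ⊗≫ g ▷ F.ob v ≫ h := by monoidal
    _ = _ := by rw [← cotensor_natural_left]; monoidal

theorem gmul_comp {u v' v : V} {a b c : C} (g : a ⊗ F.ob u ⟶ b) (x : v' ⟶ v)
    (h : b ⊗ F.ob v ⟶ c) :
    F.gmul g (b ◁ F.mp x ≫ h) = a ◁ F.mp (u ◁ x) ≫ F.gmul g h := by
  simp only [gmul]
  calc
    _ = 𝟙 _ ⊗≫ a ◁ F.cotensor u v' ⊗≫ (g ▷ F.ob v' ≫ b ◁ F.mp x) ⊗≫ h := by monoidal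
    _ = 𝟙 _ ⊗≫ a ◁ (F.cotensor u v' ≫ F.ob u ◁ F.mp x) ⊗≫ g ▷ F.ob v ≫ h := by
      rw [← whisker_exchange]; monoidal
    _ = _ := by rw [← cotensor_natural_right]; monoidal

theorem gwl_comp (a : C) {u v : V} {b c : C} (x : u ⟶ v) (g : b ⊗ F.ob v ⟶ c) :
    F.gwl a (b ◁ F.mp x ≫ g) = (a ⊗ b) ◁ F.mp x ≫ F.gwl a g := by
  simp only [gwl]
  monoidal

theorem gwr_comp {u v : V} {b c : C} (x : u ⟶ v) (g : b ⊗ F.ob v ⟶ c) (a : C) :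
    F.gwr (b ◁ F.mp x ≫ g) a = (b ⊗ a) ◁ F.mp x ≫ F.gwr g a := by
  simp only [gwr]
  calc
    _ = 𝟙 _ ⊗≫ b ◁ (F.halfBraiding a u ≫ F.mp x ▷ a) ⊗≫ g ▷ a := by monoidal
    _ = _ := by rw [← halfBraiding_naturality_right]; monoidal

/-- Objects of `V` that represent the functors `v ↦ (a ⊗ F v ⟶ b)`. -/
structure InternalHoms where
  H : C → C → V
  ev (a b : C) : a ⊗ F.ob (H a b) ⟶ b
  bijective (v : V) (a b : C) : Function.Bijective fun f : v ⟶ H a b => a ◁ F.mp f ≫ ev a b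

/-- Morphisms `a ⊗ F v ⟶ b` transpose by duality to `F v ⟶ ᘁa ⊗ b`, and by adjunction to morphisms
from `v` to the right adjoint at `ᘁa ⊗ b`. That object is the internal hom, with the transpose of
the identity as evaluation. -/
theorem nonempty_internalHoms [LeftRigidCategory C] (h : F.functor.IsLeftAdjoint) :
    Nonempty F.InternalHoms := by
  let adj := Adjunction.ofIsLeftAdjoint F.functor
  let e (v : V) (a b : C) : (v ⟶ F.functor.rightAdjoint.obj ((ᘁa) ⊗ b)) ≃ (a ⊗ F.ob v ⟶ b) :=
    (adj.homEquiv v _).symm.trans (tensorLeftHomEquiv _ _ _ _).symm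
  refine ⟨⟨fun a b => F.functor.rightAdjoint.obj ((ᘁa) ⊗ b), fun a b => e _ a b (𝟙 _), ?_⟩⟩
  intro v a b
  -- By naturality in `v`, precomposing the evaluation with `F f` is the inverse transpose of `f`.
  convert (e v a b).bijective using 2 with f
  simp only [e, Equiv.trans_apply]
  rw [← tensorLeftHomEquiv_symm_naturality, ← adj.homEquiv_naturality_left_symm,
    Category.comp_id]

namespace InternalHoms

variable {F} (I : F.InternalHoms)

/-- Elements of `H a b` correspond to morphisms `a ⊗ F v ⟶ b`. -/
def eqv {v : V} {a b : C} : (v ⟶ I.H a b) ≃ (a ⊗ F.ob v ⟶ b) :=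
  Equiv.ofBijective _ (I.bijective v a b)

theorem eqv_apply {v : V} {a b : C} (f : v ⟶ I.H a b) : I.eqv f = a ◁ F.mp f ≫ I.ev a b := rfl

theorem eqv_comp {u v : V} {a b : C} (x : u ⟶ v) (f : v ⟶ I.H a b) :
    I.eqv (x ≫ f) = a ◁ F.mp x ≫ I.eqv f := by
  rw [eqv_apply, eqv_apply, mp_comp, MonoidalCategory.whiskerLeft_comp, Category.assoc]

theorem gmul_eqv {u v : V} {a b c : C} (f : u ⟶ I.H a b) (g : v ⟶ I.H b c) :
    F.gmul (I.eqv f) (I.eqv g) = a ◁ F.mp (f ⊗ₘ g) ≫ F.gmul (I.ev a b) (I.ev b c) := by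
  rw [eqv_apply, eqv_apply, comp_gmul, gmul_comp, MonoidalCategory.tensorHom_def, mp_comp,
    MonoidalCategory.whiskerLeft_comp, Category.assoc]

theorem eqv_comp_symm {u v : V} {a b : C} (x : u ⟶ v) (g : a ⊗ F.ob v ⟶ b) :
    I.eqv (x ≫ I.eqv.symm g) = a ◁ F.mp x ≫ g := by
  rw [eqv_comp, Equiv.apply_symm_apply]

/-- Morphisms `a ⟶ b` correspond to morphisms `a ⊗ F 1 ⟶ b`. -/
def ghomEquiv (F : CentralFunctor k V C) (a b : C) : (a ⟶ b) ≃ (a ⊗ F.ob (𝟙_ V) ⟶ b) where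
  toFun f := F.ghom f
  invFun g := (ρ_ a).inv ≫ a ◁ inv F.counit ≫ g
  left_inv f := by
    change (ρ_ a).inv ≫ a ◁ inv F.counit ≫ a ◁ F.counit ≫ (ρ_ a).hom ≫ f = f
    rw [← MonoidalCategory.whiskerLeft_comp_assoc, IsIso.inv_hom_id,
      MonoidalCategory.whiskerLeft_id, Category.id_comp, Iso.inv_hom_id_assoc]
  right_inv g := by
    change a ◁ F.counit ≫ (ρ_ a).hom ≫ (ρ_ a).inv ≫ a ◁ inv F.counit ≫ g = g
    rw [Iso.hom_inv_id_assoc, ← MonoidalCategory.whiskerLeft_comp_assoc,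
      IsIso.hom_inv_id, MonoidalCategory.whiskerLeft_id, Category.id_comp]

/-- The enrichment data given by internal homs. -/
def enrichmentData : EnrichmentData V C where
  H := I.H
  hom {a b} := (ghomEquiv F a b).trans I.eqv.symm
  comp a b c := I.eqv.symm (F.gmul (I.ev a b) (I.ev b c))
  left a b c := I.eqv.symm (F.gwl a (I.ev b c))
  right b c a := I.eqv.symm (F.gwr (I.ev b c) a)

/-- Elements of `H a b` correspond to morphisms `a ⊗ F v ⟶ b`. -/
def equiv {v : V} {a b : C} : (v ⟶ I.enrichmentData.H a b) ≃ (a ⊗ F.ob v ⟶ b) := I.eqv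

theorem equiv_comp {u v : V} {a b : C} (x : u ⟶ v) (f : v ⟶ I.enrichmentData.H a b) :
    I.equiv (x ≫ f) = a ◁ F.mp x ≫ I.equiv f := I.eqv_comp x f

theorem equiv_hom {a b : C} (f : a ⟶ b) : I.equiv (I.enrichmentData.hom f) = F.ghom f :=
  I.eqv.apply_symm_apply _

theorem equiv_mul {u v : V} {a b c : C} (f : u ⟶ I.enrichmentData.H a b)
    (g : v ⟶ I.enrichmentData.H b c) :
    I.equiv (I.enrichmentData.mul f g) = F.gmul (I.equiv f) (I.equiv g) := by
  exact (I.eqv_comp_symm (f ⊗ₘ g) (F.gmul (I.ev a b) (I.ev b c))).trans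
    (I.gmul_eqv f g).symm

theorem equiv_wl (a : C) {v : V} {b c : C} (f : v ⟶ I.enrichmentData.H b c) :
    I.equiv (I.enrichmentData.wl a f) = F.gwl a (I.equiv f) :=
  (I.eqv_comp_symm f (F.gwl a (I.ev b c))).trans (F.gwl_comp a f (I.ev b c)).symm

theorem equiv_wr {v : V} {b c : C} (f : v ⟶ I.enrichmentData.H b c) (a : C) :
    I.equiv (I.enrichmentData.wr f a) = F.gwr (I.equiv f) a :=
  (I.eqv_comp_symm f (F.gwr (I.ev b c) a)).trans (F.gwr_comp f (I.ev b c) a).symm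

theorem whiskerLeft_mp_iso {v v' : V} (a : C) {b : C} (e : v ≅ v') (g : a ⊗ F.ob v' ⟶ b) :
    a ◁ F.mp e.inv ≫ a ◁ F.mp e.hom ≫ g = (a ◁ F.mp (𝟙 _)) ≫ g := by
  rw [← MonoidalCategory.whiskerLeft_comp_assoc, ← mp_comp, Iso.inv_hom_id]

theorem equiv_post {v : V} {a b c : C} (f : v ⟶ I.enrichmentData.H a b) (g : b ⟶ c) :
    I.equiv (I.enrichmentData.post f g) = I.equiv f ≫ g := by
  rw [post, equiv_comp, equiv_mul, equiv_hom, gmul_ghom, whiskerLeft_mp_iso, mp_id,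
    MonoidalCategory.whiskerLeft_id, Category.id_comp]

theorem equiv_pre {v : V} {a b c : C} (f : a ⟶ b) (g : v ⟶ I.enrichmentData.H b c) :
    I.equiv (I.enrichmentData.pre f g) = f ▷ F.ob v ≫ I.equiv g := by
  rw [pre, equiv_comp, equiv_mul, equiv_hom, ghom_gmul, whiskerLeft_mp_iso, mp_id,
    MonoidalCategory.whiskerLeft_id, Category.id_comp]

/-- The enrichment given by internal homs. -/
def enrichment : Enrichment V C where
  toEnrichmentData := I.enrichmentData
  hom_comp f g := I.equiv.injective (by
    rw [equiv_comp, equiv_mul, equiv_hom, equiv_hom, equiv_hom, ghom_gmul, whiskerLeft_mp_iso,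
      mp_id, MonoidalCategory.whiskerLeft_id, Category.id_comp, ghom, ghom,
      ← whisker_exchange_assoc, rightUnitor_naturality_assoc])
  id_mul f := I.equiv.injective (by
    rw [equiv_comp, equiv_mul, equiv_hom, ghom_gmul, MonoidalCategory.id_whiskerRight,
      Category.id_comp])
  mul_id f := I.equiv.injective (by
    rw [equiv_comp, equiv_mul, equiv_hom, gmul_ghom, Category.comp_id])
  mul_assoc f g h := I.equiv.injective (by
    simp only [equiv_comp, equiv_mul, gmul_assoc])
  wl_hom a _ _ f := I.equiv.injective (by rw [equiv_wl, equiv_hom, equiv_hom, gwl_ghom])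
  wr_hom f a := I.equiv.injective (by rw [equiv_wr, equiv_hom, equiv_hom, gwr_ghom])
  wl_mul a _ _ _ _ _ f g := I.equiv.injective (by simp only [equiv_wl, equiv_mul, gwl_gmul])
  wr_mul f g a := I.equiv.injective (by simp only [equiv_wr, equiv_mul, gwr_gmul])
  exchange f g := I.equiv.injective (by
    simp only [equiv_comp, equiv_wr, equiv_wl, equiv_mul, gmul_exchange])
  wl_wl a b _ _ f := I.equiv.injective (by
    simp only [equiv_post, equiv_pre, equiv_wl, gwl_gwl])
  wl_wr a b _ _ f := I.equiv.injective (by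
    simp only [equiv_post, equiv_pre, equiv_wl, equiv_wr, gwr_gwl])
  wr_wr a b _ _ f := I.equiv.injective (by
    simp only [equiv_post, equiv_pre, equiv_wr, gwr_gwr])
  one_wl f := I.equiv.injective (by simp only [equiv_post, equiv_pre, equiv_wl, gwl_one])
  wr_one f := I.equiv.injective (by simp only [equiv_post, equiv_pre, equiv_wr, gwr_one])

/-- Elements of the hom objects of the enrichment correspond to morphisms `a ⊗ F v ⟶ b`. -/
def elEquiv {v : V} {a b : C} : (v ⟶ I.enrichment.H a b) ≃ (a ⊗ F.ob v ⟶ b) := I.eqv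

theorem elEquiv_comp {u v : V} {a b : C} (x : u ⟶ v) (f : v ⟶ I.enrichment.H a b) :
    I.elEquiv (x ≫ f) = a ◁ F.mp x ≫ I.elEquiv f := I.eqv_comp x f

theorem elEquiv_hom {a b : C} (f : a ⟶ b) : I.elEquiv (I.enrichment.hom f) = F.ghom f :=
  I.equiv_hom f

theorem elEquiv_mul {u v : V} {a b c : C} (f : u ⟶ I.enrichment.H a b)
    (g : v ⟶ I.enrichment.H b c) :
    I.elEquiv (I.enrichment.mul f g) = F.gmul (I.elEquiv f) (I.elEquiv g) := I.equiv_mul f g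

theorem elEquiv_post {v : V} {a b c : C} (f : v ⟶ I.enrichment.H a b) (g : b ⟶ c) :
    I.elEquiv (I.enrichment.post f g) = I.elEquiv f ≫ g := I.equiv_post f g

theorem elEquiv_atL {v : V} {x : C} (f : v ⟶ I.enrichment.H (𝟙_ C) x) (a : C) :
    I.elEquiv (I.enrichment.atL f a) = a ◁ ((λ_ _).inv ≫ I.elEquiv f) := by
  refine (I.equiv_pre _ _).trans ((congrArg (_ ≫ ·) (I.equiv_wl a f)).trans ?_)
  change _ ≫ F.gwl a (I.elEquiv f) = _
  rw [gwl]
  monoidal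

theorem elEquiv_atR {v : V} {x : C} (f : v ⟶ I.enrichment.H (𝟙_ C) x) (a : C) :
    I.elEquiv (I.enrichment.atR f a) = F.halfBraiding a v ≫ ((λ_ _).inv ≫ I.elEquiv f) ▷ a := by
  refine (I.equiv_pre _ _).trans ((congrArg (_ ≫ ·) (I.equiv_wr f a)).trans ?_)
  change _ ≫ F.gwr (I.elEquiv f) a = _
  rw [gwr]
  monoidal

/-- The central functor is induced by the enrichment that it gives. -/
def induced : I.enrichment.Induced F where
  -- An element of `H 1 (F v)` is a morphism `𝟙_ C ⊗ F v ⟶ F v`, and the unitor is the universal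
  -- one.
  η v := I.elEquiv.symm (λ_ _).hom
  universal v c := by
    have h : I.elEquiv ∘ (fun g : F.ob v ⟶ c => I.enrichment.post (I.elEquiv.symm (λ_ _).hom) g) =
        fun g => (λ_ _).hom ≫ g := funext fun g => (I.elEquiv_post _ _).trans (by
      rw [Equiv.apply_symm_apply])
    rw [← I.elEquiv.comp_bijective]
    exact h ▸ ⟨fun g g' w => (cancel_epi (λ_ _).hom).1 w,
      fun g => ⟨(λ_ _).inv ≫ g, Iso.hom_inv_id_assoc _ _⟩⟩
  post_map {u v} f := I.elEquiv.injective (by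
    refine (I.elEquiv_post _ _).trans ?_
    rw [elEquiv_comp, Equiv.apply_symm_apply, Equiv.apply_symm_apply, leftUnitor_naturality])
  post_counit := I.elEquiv.injective (by
    refine (I.elEquiv_post _ _).trans ((?_ : _ = F.ghom (𝟙 _)).trans (I.elEquiv_hom _).symm)
    rw [Equiv.apply_symm_apply, ghom, ← unitors_equal, leftUnitor_naturality_assoc,
      Category.comp_id])
  post_cotensor u v := I.elEquiv.injective (by
    refine (I.elEquiv_post _ _).trans (Eq.trans ?_ (I.elEquiv_mul _ _).symm)
    rw [elEquiv_atL]
    simp only [Equiv.apply_symm_apply, Iso.inv_hom_id, MonoidalCategory.whiskerLeft_id, gmul]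
    monoidal)
  post_halfBraiding a v := I.elEquiv.injective (by
    refine (I.elEquiv_post _ _).trans ?_
    rw [elEquiv_atL, elEquiv_atR]
    simp only [Equiv.apply_symm_apply, Iso.inv_hom_id, MonoidalCategory.whiskerLeft_id,
      MonoidalCategory.id_whiskerRight, Category.id_comp, Category.comp_id])

/-- The bijection with morphisms `a ⊗ F v ⟶ b` applies `F` to the element, so it is linear because
`F` is. -/
theorem isLinear [MonoidalPreadditive C] [MonoidalLinear k C] : I.enrichment.IsLinear k where
  hom_add f g := I.elEquiv.injective (by
    have h := F.additive
    refine (I.elEquiv_hom _).trans ?_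
    rw [eq_comm]
    refine (I.eqv_apply _).trans ?_
    have h1 := I.elEquiv_hom f
    have h2 := I.elEquiv_hom g
    refine (congrArg (fun t => _ ◁ t ≫ _) F.functor.map_add).trans ?_
    rw [MonoidalPreadditive.whiskerLeft_add, Preadditive.add_comp]
    refine (congrArg₂ (· + ·) h1 h2).trans ?_
    simp only [ghom, Preadditive.comp_add])
  hom_smul r f := I.elEquiv.injective (by
    have h := F.linear
    refine (I.elEquiv_hom _).trans ?_
    rw [eq_comm]
    refine (I.eqv_apply _).trans ?_
    have h1 := I.elEquiv_hom f
    refine (congrArg (fun t => _ ◁ t ≫ _) (F.functor.map_smul r _)).trans ?_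
    rw [MonoidalLinear.whiskerLeft_smul, Linear.smul_comp]
    refine (congrArg (r • ·) h1).trans ?_
    simp only [ghom, Linear.comp_smul])

end InternalHoms

end CentralFunctor

end VEnriched

/-! ### From an enrichment to a `V`-monoidal category. -/

namespace VEnriched

open EnrichmentData ForgetEnrichment

namespace Enrichment

variable {V : Type v} [Category.{w} V] [MonoidalCategory V] [BraidedCategory V]
  {C : Type u} [Category.{w} C] [MonoidalCategory C] (E : Enrichment V C)

/-- Tensor product of generalized elements. -/
def ten {u v : V} {a b c d : C} (f : u ⟶ E.H a c) (g : v ⟶ E.H b d) :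
    u ⊗ v ⟶ E.H (a ⊗ b) (c ⊗ d) := E.mul (E.wr f b) (E.wl c g)

theorem comp_ten {u' u v' v : V} {a b c d : C} (x : u' ⟶ u) (y : v' ⟶ v) (f : u ⟶ E.H a c)
    (g : v ⟶ E.H b d) : E.ten (x ≫ f) (y ≫ g) = (x ⊗ₘ y) ≫ E.ten f g := by
  rw [ten, wr_comp, wl_comp, comp_mul, mul_comp, ten, MonoidalCategory.tensorHom_def,
    Category.assoc]

theorem ten_hom {a b c d : C} (f : a ⟶ c) (g : b ⟶ d) :
    E.ten (E.hom f) (E.hom g) = (λ_ (𝟙_ V)).hom ≫ E.hom (f ⊗ₘ g) := by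
  rw [ten, E.wr_hom, E.wl_hom, hom_mul_hom, MonoidalCategory.tensorHom_def]

theorem hom_id_ten {v : V} (a : C) {b c : C} (f : v ⟶ E.H b c) :
    E.ten (E.hom (𝟙 a)) f = (λ_ v).hom ≫ E.wl a f := by
  rw [ten, E.wr_hom, MonoidalCategory.id_whiskerRight, E.id_mul]

theorem ten_hom_id {v : V} (a : C) {b c : C} (f : v ⟶ E.H b c) :
    E.ten f (E.hom (𝟙 a)) = (ρ_ v).hom ≫ E.wr f a := by
  rw [ten, E.wl_hom, MonoidalCategory.whiskerLeft_id, E.mul_id]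

/-- Once both sides are expanded into four whiskered factors, they differ by the order of the two
middle ones, which `exchange` swaps; the resulting structural map is `tensorμ`. -/
theorem ten_interchange {u v u' v' : V} {a b c d e f : C} (x : u ⟶ E.H a b)
    (y : v ⟶ E.H d e) (x' : u' ⟶ E.H b c) (y' : v' ⟶ E.H e f) :
    E.mul (E.ten x y) (E.ten x' y') = tensorμ u v u' v' ≫ E.ten (E.mul x x') (E.mul y y') := by
  have key : E.mul (E.wl b y) (E.mul (E.wr x' e) (E.wl c y')) =
      (α_ _ _ _).inv ≫ (β_ v u').hom ▷ v' ≫ (α_ _ _ _).hom ≫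
        E.mul (E.wr x' d) (E.mul (E.wl c y) (E.wl c y')) := by
    rw [← E.mul_assoc, ← comp_mul, ← E.exchange, E.mul_assoc, Iso.inv_hom_id_assoc]
  simp only [ten, E.mul_assoc, E.wr_mul, E.wl_mul, key, mul_comp, tensorμ, Category.assoc,
    Iso.inv_hom_id_assoc]

/-- The associator slides past the three whiskered factors one at a time, by `wl_wl`, `wl_wr` and
`wr_wr`. -/
theorem ten_assoc {u v w : V} {a b c d e f : C} (x : u ⟶ E.H a d)
    (y : v ⟶ E.H b e) (z : w ⟶ E.H c f) :
    E.post (E.ten (E.ten x y) z) (α_ d e f).hom =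
      (α_ u v w).hom ≫ E.pre (α_ a b c).hom (E.ten x (E.ten y z)) := by
  simp only [ten, E.wr_mul, E.wl_mul]
  rw [← mul_post, E.wl_wl, ← post_mul, ← mul_post, E.wl_wr, ← post_mul, E.wr_wr, pre_mul,
    pre_mul, E.mul_assoc, pre_comp]

/-- The objects of `C`, as the objects of a `V`-category. -/
structure Carrier (E : Enrichment V C) : Type u where
  out : C

/-- Each axiom is the corresponding law for generalized elements, evaluated at the identities of the
hom objects. -/
instance : EnrichedCategory V E.Carrier where
  Hom a b := E.H a.out b.out
  id a := E.hom (𝟙 a.out)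
  comp a b c := E.comp a.out b.out c.out
  id_comp a b := by
    have h : E.mul (E.hom (𝟙 _)) (𝟙 (E.H a.out b.out)) = _ := E.id_mul (𝟙 (E.H a.out b.out))
    simp only [mul, tensorHom_id, Category.comp_id] at h
    exact (congrArg _ h).trans (Iso.inv_hom_id _)
  comp_id a b := by
    have h : E.mul (𝟙 (E.H a.out b.out)) (E.hom (𝟙 _)) = _ := E.mul_id (𝟙 (E.H a.out b.out))
    simp only [mul, id_tensorHom, Category.comp_id] at h
    exact (congrArg _ h).trans (Iso.inv_hom_id _)
  assoc a b c d := by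
    have h := E.mul_assoc (𝟙 (E.H a.out b.out)) (𝟙 (E.H b.out c.out)) (𝟙 (E.H c.out d.out))
    simp only [mul, id_tensorHom, tensorHom_id, MonoidalCategory.id_whiskerRight,
      Category.id_comp] at h
    refine (congrArg ((α_ _ _ _).inv ≫ ·) h).trans ?_
    exact Iso.inv_hom_id_assoc _ _

theorem post_eq {v : V} {a b c : E.Carrier} (f : v ⟶ E.H a.out b.out) (g : b.out ⟶ c.out) :
    E.post f g = f ≫ postcomp V a (c := c) (E.hom g) :=
  (comp_postcomp (a := a) (b := b) (c := c) f (E.hom g)).symm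

theorem pre_eq {v : V} {a b c : E.Carrier} (f : v ⟶ E.H b.out c.out) (g : a.out ⟶ b.out) :
    E.pre g f = f ≫ precomp V (a := a) (E.hom g) c :=
  (comp_precomp (a := a) (b := b) (c := c) (E.hom g) f).symm

/-- The identity on objects, as a functor from `C`. -/
def toUnd : C ⥤ Und V E.Carrier where
  obj a := of V ⟨a⟩
  map f := homOf (C := E.Carrier) V (E.hom f)
  map_id a := und_hom_ext (homTo_id V (of V (⟨a⟩ : E.Carrier))).symm
  map_comp {a b c} f g := und_hom_ext ((E.hom_comp f g).symm.trans
    ((homTo_comp V (homOf (C := E.Carrier) (X := ⟨a⟩) (Y := ⟨b⟩) V (E.hom f))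
      (homOf (C := E.Carrier) (X := ⟨b⟩) (Y := ⟨c⟩) V (E.hom g))).trans
        (Category.assoc _ _ _)).symm)

/-- The identity on objects, as a functor to `C`. -/
def ofUnd : Und V E.Carrier ⥤ C where
  obj a := a.to.out
  map f := E.hom.symm (homTo V f)
  map_id _ := E.hom.injective (by
    rw [Equiv.apply_symm_apply]
    exact homTo_id V _)
  map_comp {a b c} f g := E.hom.injective (by
    rw [Equiv.apply_symm_apply, ← E.hom_comp, Equiv.apply_symm_apply, Equiv.apply_symm_apply]
    exact (homTo_comp V f g).trans (Category.assoc _ _ _))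

theorem toUnd_map_ofUnd_map {a b : Und V E.Carrier} (f : a ⟶ b) :
    E.toUnd.map (E.ofUnd.map f) = f :=
  und_hom_ext (E.hom.apply_symm_apply (homTo V f))

theorem ofUnd_map_toUnd_map {a b : C} (f : a ⟶ b) : E.ofUnd.map (E.toUnd.map f) = f :=
  E.hom.symm_apply_apply f

instance : E.ofUnd.IsEquivalence where
  faithful := ⟨fun {a b f g} h => by
    rw [← E.toUnd_map_ofUnd_map f, h, E.toUnd_map_ofUnd_map]⟩
  full := ⟨fun {a b} f => ⟨E.toUnd.map f, E.ofUnd_map_toUnd_map f⟩⟩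
  essSurj := ⟨fun a => ⟨E.toUnd.obj a, ⟨Iso.refl _⟩⟩⟩

instance : VMonoidalStruct V E.Carrier where
  one := ⟨𝟙_ C⟩
  tensorObj a b := ⟨a.out ⊗ b.out⟩
  tensorHom a b c d := E.ten (𝟙 (E.H a.out c.out)) (𝟙 (E.H b.out d.out))

theorem ten_eq {u v : V} {a b c d : E.Carrier} (f : u ⟶ E.H a.out c.out)
    (g : v ⟶ E.H b.out d.out) :
    E.ten f g = (f ⊗ₘ g) ≫ vHom V a b c d := by
  refine Eq.trans ?_ (E.comp_ten f g (𝟙 _) (𝟙 _))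
  rw [Category.comp_id, Category.comp_id]

theorem wl_id (a b c : E.Carrier) :
    E.wl a.out (𝟙 (E.H b.out c.out)) = (λ_ _).inv ≫ (eId V a ▷ (b ⟶[V] c)) ≫ vHom V a b a c := by
  rw [eq_comm, Iso.inv_comp_eq, ← hom_id_ten]
  refine Eq.trans ?_ (E.ten_eq (a := a) (b := b) (c := a) (d := c) (E.hom (𝟙 _)) (𝟙 _)).symm
  rw [tensorHom_id]
  rfl

theorem wr_id (a b c : E.Carrier) :
    E.wr (𝟙 (E.H b.out c.out)) a.out = (ρ_ _).inv ≫ ((b ⟶[V] c) ◁ eId V a) ≫ vHom V b a c a := by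
  rw [eq_comm, Iso.inv_comp_eq, ← ten_hom_id]
  refine Eq.trans ?_ (E.ten_eq (a := b) (b := a) (c := c) (d := a) (𝟙 _) (E.hom (𝟙 _))).symm
  rw [id_tensorHom]
  rfl

theorem undTensor_toUnd {a b c d : C} (f : a ⟶ c) (g : b ⟶ d) :
    undTensor V (E.toUnd.map f) (E.toUnd.map g) = E.toUnd.map (f ⊗ₘ g) := by
  apply und_hom_ext
  refine (congrArg ((λ_ (𝟙_ V)).inv ≫ ·) ((E.ten_eq (a := ⟨a⟩) (b := ⟨b⟩) (c := ⟨c⟩) (d := ⟨d⟩)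
    (E.hom f) (E.hom g)).symm.trans (E.ten_hom f g))).trans ?_
  exact Iso.inv_hom_id_assoc _ _

theorem undTensor_toUnd_id {a b c : C} (f : a ⟶ c) :
    undTensor V (E.toUnd.map f) (𝟙 (of V (⟨b⟩ : E.Carrier))) = E.toUnd.map (f ▷ b) := by
  rw [← tensorHom_id, ← undTensor_toUnd, E.toUnd.map_id]
  rfl

theorem undTensor_id_toUnd {a b c : C} (f : a ⟶ c) :
    undTensor V (𝟙 (of V (⟨b⟩ : E.Carrier))) (E.toUnd.map f) = E.toUnd.map (b ◁ f) := by
  rw [← id_tensorHom, ← undTensor_toUnd, E.toUnd.map_id]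
  rfl

/-- The coherence isomorphisms are the images of those of `C`, so pentagon and triangle are
inherited. The remaining axioms are laws of generalized elements evaluated at identities. -/
instance : VMonoidalCategory V E.Carrier where
  associator a b c := E.toUnd.mapIso (α_ a.out b.out c.out)
  leftUnitor a := E.toUnd.mapIso (λ_ a.out)
  rightUnitor a := E.toUnd.mapIso (ρ_ a.out)
  tensor_id a b := by
    refine (congrArg ((λ_ (𝟙_ V)).inv ≫ ·) ((E.ten_eq (a := a) (b := b) (c := a) (d := b)
      (E.hom (𝟙 _)) (E.hom (𝟙 _))).symm.trans (E.ten_hom (𝟙 _) (𝟙 _)))).trans ?_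
    rw [Iso.inv_hom_id_assoc, id_tensorHom_id]
    rfl
  interchange a b c d e f := by
    refine (E.ten_interchange (𝟙 (E.H a.out b.out)) (𝟙 (E.H d.out e.out)) (𝟙 (E.H b.out c.out))
      (𝟙 (E.H e.out f.out))).trans ?_
    simp only [mul, id_tensorHom_id, Category.id_comp]
    exact congrArg (_ ≫ ·) (E.ten_eq (a := a) (b := d) (c := c) (d := f) _ _)
  associator_naturality a b c d e f := by
    have h := E.ten_assoc (𝟙 (E.H a.out d.out)) (𝟙 (E.H b.out e.out)) (𝟙 (E.H c.out f.out))
    rw [← Category.assoc]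
    refine Eq.trans (congrArg (· ≫ postcomp V _ _) ?_) ((E.post_eq
      (a := ⟨(a.out ⊗ b.out) ⊗ c.out⟩) (b := ⟨(d.out ⊗ e.out) ⊗ f.out⟩)
      (c := ⟨d.out ⊗ e.out ⊗ f.out⟩) _ _).symm.trans (h.trans ((congrArg (_ ≫ ·) (E.pre_eq
      (b := ⟨a.out ⊗ b.out ⊗ c.out⟩) (a := ⟨(a.out ⊗ b.out) ⊗ c.out⟩)
      (c := ⟨d.out ⊗ e.out ⊗ f.out⟩) _ _)).trans ?_)))
    · refine Eq.trans ?_ (E.ten_eq (a := vObj V a b) (c := vObj V d e) (b := c) (d := f)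
        (E.ten (𝟙 _) (𝟙 _)) (𝟙 _)).symm
      rw [tensorHom_id]
      rfl
    · refine congrArg (_ ≫ ·) (Eq.trans ?_ (Category.assoc _ _ _))
      refine congrArg (· ≫ precomp (a := (⟨(a.out ⊗ b.out) ⊗ c.out⟩ : E.Carrier)) V
        (b := ⟨a.out ⊗ b.out ⊗ c.out⟩) (E.hom (α_ a.out b.out c.out).hom)
        ⟨d.out ⊗ e.out ⊗ f.out⟩) ?_
      refine (E.ten_eq (a := a) (c := d) (b := vObj V b c) (d := vObj V e f)
        (𝟙 _) (E.ten (𝟙 _) (𝟙 _))).trans ?_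
      rw [id_tensorHom]
      rfl
  leftUnitor_naturality a b := by
    have h := E.one_wl (𝟙 (E.H a.out b.out))
    rw [E.post_eq (a := ⟨𝟙_ C ⊗ a.out⟩) (b := ⟨𝟙_ C ⊗ b.out⟩) (c := b),
      E.pre_eq (a := ⟨𝟙_ C ⊗ a.out⟩) (b := a) (c := b), Category.id_comp] at h
    refine Eq.trans ?_ h
    rw [E.wl_id]
    simp only [Category.assoc]
    rfl
  rightUnitor_naturality a b := by
    have h := E.wr_one (𝟙 (E.H a.out b.out))
    rw [E.post_eq (a := ⟨a.out ⊗ 𝟙_ C⟩) (b := ⟨b.out ⊗ 𝟙_ C⟩) (c := b),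
      E.pre_eq (a := ⟨a.out ⊗ 𝟙_ C⟩) (b := a) (c := b), Category.id_comp] at h
    refine Eq.trans ?_ h
    rw [E.wr_id]
    simp only [Category.assoc]
    rfl
  pentagon a b c d := by
    refine (congrArg₂ (fun s t => s ≫ _ ≫ t) (E.undTensor_toUnd_id _)
      (E.undTensor_id_toUnd _)).trans ?_
    have h := congrArg E.toUnd.map (MonoidalCategory.pentagon a.out b.out c.out d.out)
    simp only [Functor.map_comp] at h
    exact h
  triangle a b := by
    refine (congrArg (_ ≫ ·) (E.undTensor_id_toUnd _)).trans ((E.toUnd.map_comp _ _).symm.trans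
      ((congrArg E.toUnd.map (MonoidalCategory.triangle a.out b.out)).trans
      (E.undTensor_toUnd_id _).symm))

end Enrichment

end VEnriched

/-! ### Enriched monoidal functors and action coherences. -/

namespace VEnriched

open EnrichmentData Functor.LaxMonoidal Functor.OplaxMonoidal

variable {V : Type v} [Category.{w} V] [MonoidalCategory V] [BraidedCategory V]
  {C : Type u} [Category.{w} C] [MonoidalCategory C]
  {D : Type u} [Category.{w} D] [MonoidalCategory D]

/-- The action on hom objects of an enriched monoidal functor whose underlying monoidal functor
is `R`. -/
structure EnrichmentFunctor (E : Enrichment V C) (E' : Enrichment V D) (R : C ⥤ D)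
    [R.Monoidal] where
  T (a b : C) : E.H a b ⟶ E'.H (R.obj a) (R.obj b)
  hom_T {a b : C} (f : a ⟶ b) : E.hom f ≫ T a b = E'.hom (R.map f)
  mul_T {u v : V} {a b c : C} (f : u ⟶ E.H a b) (g : v ⟶ E.H b c) :
    E.mul f g ≫ T a c = E'.mul (f ≫ T a b) (g ≫ T b c)
  wl_T (a : C) {v : V} {b c : C} (f : v ⟶ E.H b c) :
    E'.post (E'.wl (R.obj a) (f ≫ T b c)) (μ R a c) =
      E'.pre (μ R a b) (E.wl a f ≫ T (a ⊗ b) (a ⊗ c))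
  wr_T {v : V} {b c : C} (f : v ⟶ E.H b c) (a : C) :
    E'.post (E'.wr (f ≫ T b c) (R.obj a)) (μ R c a) =
      E'.pre (μ R b a) (E.wr f a ≫ T (b ⊗ a) (c ⊗ a))

namespace EnrichmentFunctor

variable {E : Enrichment V C} {E' : Enrichment V D} {R : C ⥤ D} [R.Monoidal]
  (S : EnrichmentFunctor E E' R)

theorem post_T {v : V} {a b c : C} (f : v ⟶ E.H a b) (g : b ⟶ c) :
    E.post f g ≫ S.T a c = E'.post (f ≫ S.T a b) (R.map g) := by
  rw [post, Category.assoc, S.mul_T, S.hom_T, post]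

theorem pre_T {v : V} {a b c : C} (f : a ⟶ b) (g : v ⟶ E.H b c) :
    E.pre f g ≫ S.T a c = E'.pre (R.map f) (g ≫ S.T b c) := by
  rw [pre, Category.assoc, S.mul_T, S.hom_T, pre]

/-- The tensor product of hom objects is composed of two whiskerings, so compatibility with both
gives the naturality of the tensor constraint. -/
theorem wr_wl_T {u v : V} {a b c d : C} (f : u ⟶ E.H a c) (g : v ⟶ E.H b d) :
    E'.post (E'.mul (E'.wr (f ≫ S.T a c) (R.obj b)) (E'.wl (R.obj c) (g ≫ S.T b d))) (μ R c d) =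
      E'.pre (μ R a b) (E.mul (E.wr f b) (E.wl c g) ≫ S.T _ _) := by
  rw [← Enrichment.mul_post, S.wl_T, ← Enrichment.post_mul, S.wr_T, S.mul_T, Enrichment.pre_mul]

/-- The image of an element of `H 1 x`. -/
def pt {v : V} {x : C} (η : v ⟶ E.H (𝟙_ C) x) : v ⟶ E'.H (𝟙_ D) (R.obj x) :=
  E'.pre (ε R) (η ≫ S.T _ _)

theorem comp_pt {u v : V} {x : C} (z : u ⟶ v) (η : v ⟶ E.H (𝟙_ C) x) :
    S.pt (z ≫ η) = z ≫ S.pt η := by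
  rw [pt, Category.assoc, pre_comp, pt]

theorem pt_post {v : V} {x y : C} (η : v ⟶ E.H (𝟙_ C) x) (g : x ⟶ y) :
    S.pt (E.post η g) = E'.post (S.pt η) (R.map g) := by
  rw [pt, post_T, Enrichment.pre_post, pt]

theorem post_atL_pt {v : V} {x : C} (η : v ⟶ E.H (𝟙_ C) x) (a : C) :
    E'.post (E'.atL (S.pt η) (R.obj a)) (μ R a x) = E.atL η a ≫ S.T _ _ := by
  rw [Enrichment.atL, pt, Enrichment.wl_pre, Enrichment.pre_pre, ← Enrichment.pre_post, S.wl_T,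
    Enrichment.pre_pre, Enrichment.atL, pre_T]
  congr 1
  simp

theorem post_atR_pt {v : V} {x : C} (η : v ⟶ E.H (𝟙_ C) x) (a : C) :
    E'.post (E'.atR (S.pt η) (R.obj a)) (μ R x a) = E.atR η a ≫ S.T _ _ := by
  rw [Enrichment.atR, pt, Enrichment.wr_pre, Enrichment.pre_pre, ← Enrichment.pre_post, S.wr_T,
    Enrichment.pre_pre, Enrichment.atR, pre_T]
  congr 1
  simp

theorem pt_mul_atL {u v : V} {x y : C} (η : u ⟶ E.H (𝟙_ C) x) (θ : v ⟶ E.H (𝟙_ C) y) :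
    S.pt (E.mul η (E.atL θ x)) =
      E'.post (E'.mul (S.pt η) (E'.atL (S.pt θ) (R.obj x))) (μ R x y) := by
  rw [pt, S.mul_T, ← Enrichment.pre_mul, ← Enrichment.mul_post, post_atL_pt, pt]

/-- For targets of the form `R c`, full faithfulness of `R` and invertibility of the maps on hom
objects transport the universal property. Essential surjectivity reduces every target to this form.
-/
theorem isUniversal_pt [R.IsEquivalence] [∀ a b, IsIso (S.T a b)] {v : V} {x : C}
    {η : v ⟶ E.H (𝟙_ C) x} (h : E.IsUniversal η) : E'.IsUniversal (S.pt η) := by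
  have key : ∀ c : C, Function.Bijective fun g : R.obj x ⟶ R.obj c => E'.post (S.pt η) g := by
    intro c
    have h1 : (fun g : R.obj x ⟶ R.obj c => E'.post (S.pt η) g) ∘ R.map =
        fun g : x ⟶ c => S.pt (E.post η g) := funext fun g => (S.pt_post η g).symm
    rw [← Function.Bijective.of_comp_iff _
      ((Functor.FullyFaithful.ofFullyFaithful R).map_bijective x c), h1]
    -- The map `pt` is composition with `ε R` and with `S.T`, both invertible.
    have h2 : Function.Bijective fun k : v ⟶ E.H (𝟙_ C) c => S.pt k := by
      constructor
      · intro k k' w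
        have w' := congrArg (E'.pre (inv (ε R))) w
        simp only [pt, Enrichment.pre_pre, IsIso.inv_hom_id, Enrichment.pre_id] at w'
        exact (cancel_mono _).1 w'
      · intro k
        refine ⟨E'.pre (inv (ε R)) k ≫ inv (S.T _ _), ?_⟩
        simp only [pt, Category.assoc, IsIso.inv_hom_id, Category.comp_id, Enrichment.pre_pre,
          IsIso.hom_inv_id, Enrichment.pre_id]
    exact h2.comp (h c)
  intro c
  have e := R.objObjPreimageIso c
  have h1 : (fun g : R.obj x ⟶ c => E'.post (S.pt η) g) =
      (fun k => E'.post k e.hom) ∘ (fun g => E'.post (S.pt η) g) ∘ fun g => g ≫ e.inv := by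
    funext g
    simp only [Function.comp_apply, Enrichment.post_post, Category.assoc, Iso.inv_hom_id,
      Category.comp_id]
  rw [h1]
  refine Function.Bijective.comp ⟨fun k k' w => ?_, fun k => ⟨E'.post k e.inv, ?_⟩⟩
    ((key _).comp ⟨fun g g' w => (cancel_mono e.inv).1 w, fun g => ⟨g ≫ e.hom, ?_⟩⟩)
  · have w' := congrArg (fun k => E'.post k e.inv) w
    simpa only [Enrichment.post_post, Iso.hom_inv_id, Enrichment.post_id] using w'
  · simp only [Enrichment.post_post, Iso.inv_hom_id, Enrichment.post_id]
  · simp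

end EnrichmentFunctor

section Central

variable {k : Type u₁} [Field k] [Preadditive V] [CategoryTheory.Linear k V]
  [Preadditive C] [CategoryTheory.Linear k C] [Preadditive D] [CategoryTheory.Linear k D]

/-- The coherence conditions for an action coherence. -/
structure ActionCoherence (F : CentralFunctor k V C) (F' : CentralFunctor k V D)
    (R : C ⥤ D) [R.Monoidal] (r : ∀ v, F'.ob v ⟶ R.obj (F.ob v)) : Prop where
  natural {u v : V} (f : u ⟶ v) : F'.mp f ≫ r v = r u ≫ R.map (F.mp f)
  unit : r (𝟙_ V) ≫ R.map F.counit = F'.counit ≫ ε R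
  tensor (u v : V) : r (u ⊗ v) ≫ R.map (F.cotensor u v) =
    F'.cotensor u v ≫ (r u ⊗ₘ r v) ≫ μ R (F.ob u) (F.ob v)
  halfBraiding (a : C) (v : V) :
    F'.halfBraiding (R.obj a) v ≫ (r v ▷ R.obj a) ≫ μ R (F.ob v) a =
      (R.obj a ◁ r v) ≫ μ R a (F.ob v) ≫ R.map (F.halfBraiding a v)

namespace EnrichmentFunctor

variable {E : Enrichment V C} {E' : Enrichment V D} {R : C ⥤ D} [R.Monoidal]
  (S : EnrichmentFunctor E E' R) {F : CentralFunctor k V C} {F' : CentralFunctor k V D}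
  (I : E.Induced F) (I' : E'.Induced F')

/-- The comparison of the induced central functors. -/
def comparison (v : V) : F'.ob v ⟶ R.obj (F.ob v) := (I'.universal v).desc (S.pt (I.η v))

theorem post_comparison (v : V) :
    E'.post (I'.η v) (S.comparison I I' v) = S.pt (I.η v) := (I'.universal v).fac _

theorem isIso_comparison [R.IsEquivalence] [∀ a b, IsIso (S.T a b)] (v : V) :
    IsIso (S.comparison I I' v) :=
  (I'.universal v).isIso_of_post (by
    rw [post_comparison]
    exact S.isUniversal_pt (I.universal v))

theorem post_atL_comparison (v : V) (a : C) :
    E'.post (E'.atL (I'.η v) (R.obj a)) (R.obj a ◁ S.comparison I I' v ≫ μ R a _) =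
      E.atL (I.η v) a ≫ S.T _ _ := by
  rw [← Enrichment.post_post, ← Enrichment.atL_post, post_comparison]
  exact S.post_atL_pt _ _

theorem post_atR_comparison (v : V) (a : C) :
    E'.post (E'.atR (I'.η v) (R.obj a)) (S.comparison I I' v ▷ R.obj a ≫ μ R _ a) =
      E.atR (I.η v) a ≫ S.T _ _ := by
  rw [← Enrichment.post_post, ← Enrichment.atR_post, post_comparison]
  exact S.post_atR_pt _ _

/-- Each identity concerns morphisms out of a representing object and is tested on the universal
element, which the comparison sends to the image of the other universal element. For the
half-braiding the test element is `atL` at `R a`, and its universality uses a dual of `R a`. -/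
theorem actionCoherence [RigidCategory D] : ActionCoherence F F' R (S.comparison I I') where
  natural {u v} f := (I'.universal u).ext (by
    rw [← Enrichment.post_post, I'.post_map, comp_post, post_comparison,
      ← Enrichment.post_post, post_comparison, ← pt_post, I.post_map, comp_pt])
  unit := (I'.universal _).ext (by
    rw [← Enrichment.post_post, post_comparison, ← Enrichment.post_post, I'.post_counit,
      Enrichment.post_hom, Category.id_comp]
    rw [← pt_post, I.post_counit, pt, S.hom_T, Enrichment.pre_hom, R.map_id, Category.comp_id])
  tensor u v := (I'.universal _).ext (by
    rw [← Enrichment.post_post, post_comparison, ← pt_post, I.post_cotensor, pt_mul_atL,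
      ← Enrichment.post_post, I'.post_cotensor, MonoidalCategory.tensorHom_def,
      ← Enrichment.post_post, ← Enrichment.post_post, ← Enrichment.mul_post,
      ← Enrichment.mul_post, ← Enrichment.pre_atL, ← Enrichment.post_mul, post_comparison,
      ← Enrichment.mul_post, ← Enrichment.atL_post, post_comparison, ← Enrichment.mul_post])
  halfBraiding a v := ((I'.universal v).atL (R.obj a) (ᘁ(R.obj a))).ext (by
    rw [← Enrichment.post_post, I'.post_halfBraiding, post_atR_comparison, ← Category.assoc,
      ← Enrichment.post_post, post_atL_comparison, ← post_T, I.post_halfBraiding])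

end EnrichmentFunctor

namespace Enrichment.Induced

variable {E : Enrichment V C} {F : CentralFunctor k V C} (I : E.Induced F)

/-- The element of `H a b` given by a morphism `a ⊗ F v ⟶ b`. -/
def el {v : V} {a b : C} (g : a ⊗ F.ob v ⟶ b) : v ⟶ E.H a b := E.post (E.atL (I.η v) a) g

/-- Whenever `F` is induced by `E`, elements of `H a b` are the morphisms `a ⊗ F v ⟶ b`. The `el`
lemmas below show that all the structure of `E` is thereby determined by `F`. -/
theorem el_bijective [RigidCategory C] (v : V) (a b : C) :
    Function.Bijective fun g : a ⊗ F.ob v ⟶ b => I.el g := (I.universal v).atL a (ᘁa) b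

theorem el_comp {u v : V} {a b : C} (x : u ⟶ v) (g : a ⊗ F.ob v ⟶ b) :
    I.el (a ◁ F.mp x ≫ g) = x ≫ I.el g := by
  rw [el, ← post_post, ← atL_post, I.post_map, atL_comp, comp_post, el]

theorem el_gmul {u v : V} {a b c : C} (g : a ⊗ F.ob u ⟶ b) (h : b ⊗ F.ob v ⟶ c) :
    I.el (F.gmul g h) = E.mul (I.el g) (I.el h) := by
  have e : E.post (E.wl a (E.atL (I.η v) (F.ob u))) (α_ a (F.ob u) (F.ob v)).inv =
      E.atL (I.η v) (a ⊗ F.ob u) := by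
    rw [post_inv_eq, atL_tensor]
  rw [el, CentralFunctor.gmul]
  simp only [← post_post]
  rw [← atL_post, I.post_cotensor, atL_mul, ← mul_post, e, ← mul_post, ← pre_atL, ← post_mul,
    ← mul_post]
  rfl

theorem el_gwl (a : C) {v : V} {b c : C} (g : b ⊗ F.ob v ⟶ c) :
    I.el (F.gwl a g) = E.wl a (I.el g) := by
  rw [el, CentralFunctor.gwl, ← post_post, atL_tensor, ← wl_post]
  rfl

theorem el_gwr {v : V} {b c : C} (g : b ⊗ F.ob v ⟶ c) (a : C) :
    I.el (F.gwr g a) = E.wr (I.el g) a := by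
  have e : E.post (E.wl b (E.atR (I.η v) a)) (α_ b (F.ob v) a).inv =
      E.wr (E.atL (I.η v) b) a := by
    rw [post_inv_eq, wr_atL]
  rw [el, CentralFunctor.gwr]
  simp only [← post_post]
  rw [atL_tensor, ← wl_post, I.post_halfBraiding, e, ← wr_post]
  rfl

theorem el_ghom {a b : C} (f : a ⟶ b) : I.el (F.ghom f) = E.hom f := by
  rw [el, CentralFunctor.ghom, ← post_post, ← atL_post, I.post_counit, atL_hom, post_hom]
  simp

theorem el_post {v : V} {a b c : C} (g : a ⊗ F.ob v ⟶ b) (h : b ⟶ c) :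
    I.el (g ≫ h) = E.post (I.el g) h := (post_post _ _ _ _).symm

theorem el_pre {v : V} {a b c : C} (h : a ⟶ b) (g : b ⊗ F.ob v ⟶ c) :
    I.el (h ▷ F.ob v ≫ g) = E.pre h (I.el g) := by
  rw [el, ← post_post, ← pre_atL, ← pre_post, el]

end Enrichment.Induced

namespace ActionCoherence

variable {F : CentralFunctor k V C} {F' : CentralFunctor k V D} {R : C ⥤ D} [R.Monoidal]
  {r : ∀ v, F'.ob v ⟶ R.obj (F.ob v)} (hr : ActionCoherence F F' R r)

/-- The image under `R` of a morphism `a ⊗ F v ⟶ b`, as a morphism `R a ⊗ F' v ⟶ R b`. -/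
def gmap (_ : ActionCoherence F F' R r) {v : V} {a b : C} (g : a ⊗ F.ob v ⟶ b) :
    R.obj a ⊗ F'.ob v ⟶ R.obj b :=
  R.obj a ◁ r v ≫ μ R a (F.ob v) ≫ R.map g

theorem gmap_bijective [R.IsEquivalence] [∀ v, IsIso (r v)] (v : V) (a b : C) :
    Function.Bijective fun g : a ⊗ F.ob v ⟶ b => hr.gmap g := by
  have h : Function.Bijective fun g : R.obj (a ⊗ F.ob v) ⟶ R.obj b =>
      (R.obj a ◁ r v ≫ μ R a (F.ob v)) ≫ g :=
    ⟨fun g g' w => (cancel_epi _).1 w, fun g => ⟨inv (R.obj a ◁ r v ≫ μ R a (F.ob v)) ≫ g,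
      IsIso.hom_inv_id_assoc _ _⟩⟩
  have h2 := h.comp ((Functor.FullyFaithful.ofFullyFaithful R).map_bijective (a ⊗ F.ob v) b)
  convert h2 using 2 with g
  simp only [gmap, Function.comp_apply, Category.assoc]

theorem gmap_comp {u v : V} {a b : C} (x : u ⟶ v) (g : a ⊗ F.ob v ⟶ b) :
    hr.gmap (a ◁ F.mp x ≫ g) = R.obj a ◁ F'.mp x ≫ hr.gmap g := by
  rw [gmap, gmap, R.map_comp, ← μ_natural_right_assoc, ← MonoidalCategory.whiskerLeft_comp_assoc,
    ← hr.natural, MonoidalCategory.whiskerLeft_comp_assoc]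

theorem gmap_ghom {a b : C} (f : a ⟶ b) : hr.gmap (F.ghom f) = F'.ghom (R.map f) := by
  rw [gmap, CentralFunctor.ghom, R.map_comp, ← μ_natural_right_assoc,
    ← MonoidalCategory.whiskerLeft_comp_assoc, hr.unit, CentralFunctor.ghom, R.map_comp,
    Functor.LaxMonoidal.right_unitality R]
  simp only [MonoidalCategory.whiskerLeft_comp, Category.assoc]

theorem gmap_gwl (a : C) {v : V} {b c : C} (g : b ⊗ F.ob v ⟶ c) :
    μ R a b ▷ F'.ob v ≫ hr.gmap (F.gwl a g) = F'.gwl (R.obj a) (hr.gmap g) ≫ μ R a c := by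
  simp only [gmap, CentralFunctor.gwl, R.map_comp, Category.assoc,
    MonoidalCategory.whiskerLeft_comp, μ_natural_right]
  rw [← whisker_exchange_assoc, Functor.LaxMonoidal.associativity_assoc, tensor_whiskerLeft]
  simp only [Category.assoc, Iso.inv_hom_id_assoc]

/-- Compatibility of `r` with the half-braidings is used here, since right whiskering of a morphism
`b ⊗ F v ⟶ c` involves one. -/
theorem gmap_gwr {v : V} {b c : C} (g : b ⊗ F.ob v ⟶ c) (a : C) :
    μ R b a ▷ F'.ob v ≫ hr.gmap (F.gwr g a) = F'.gwr (hr.gmap g) (R.obj a) ≫ μ R c a := by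
  simp only [gmap, CentralFunctor.gwr, R.map_comp, Category.assoc, comp_whiskerRight]
  rw [← whisker_exchange_assoc, Functor.LaxMonoidal.associativity_assoc, tensor_whiskerLeft,
    ← μ_natural_right_assoc, μ_natural_left]
  simp only [Category.assoc, Iso.inv_hom_id_assoc]
  rw [← MonoidalCategory.whiskerLeft_comp_assoc _ (_ ◁ _),
    ← MonoidalCategory.whiskerLeft_comp_assoc, Category.assoc, ← hr.halfBraiding]
  simp only [MonoidalCategory.whiskerLeft_comp, Category.assoc]
  rw [Functor.LaxMonoidal.associativity_inv_assoc]
  simp only [associator_inv_naturality_middle_assoc]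

/-- Compatibility of `r` with the oplax structures is used here, since they define the composition
of these morphisms. -/
theorem gmap_gmul {u v : V} {a b c : C} (g : a ⊗ F.ob u ⟶ b) (h : b ⊗ F.ob v ⟶ c) :
    hr.gmap (F.gmul g h) = F'.gmul (hr.gmap g) (hr.gmap h) := by
  simp only [gmap, CentralFunctor.gmul, R.map_comp, Category.assoc, comp_whiskerRight]
  rw [← μ_natural_right_assoc, ← MonoidalCategory.whiskerLeft_comp_assoc, hr.tensor]
  simp only [MonoidalCategory.whiskerLeft_comp, Category.assoc]
  rw [Functor.LaxMonoidal.associativity_inv_assoc, ← μ_natural_left_assoc,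
    ← whisker_exchange_assoc, ← whisker_exchange_assoc, ← whisker_exchange_assoc,
    tensorHom_def']
  simp only [MonoidalCategory.whiskerLeft_comp, Category.assoc, tensor_whiskerLeft,
    Iso.inv_hom_id_assoc, associator_inv_naturality_middle_assoc]

variable {E : Enrichment V C} {E' : Enrichment V D} (I : E.Induced F) (I' : E'.Induced F')
  [RigidCategory C]

/-- The map on hom objects. -/
def homMap (a b : C) : E.H a b ⟶ E'.H (R.obj a) (R.obj b) :=
  I'.el (hr.gmap ((I.el_bijective (E.H a b) a b).2 (𝟙 _)).choose)

/-- A Yoneda argument: `homMap` is defined by the image of the generic element `𝟙 (E.H a b)`, and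
naturality of `gmap` in `v` gives its value on every element. -/
theorem el_homMap {v : V} {a b : C} (g : a ⊗ F.ob v ⟶ b) :
    I.el g ≫ hr.homMap I I' a b = I'.el (hr.gmap g) := by
  have h := ((I.el_bijective (E.H a b) a b).2 (𝟙 _)).choose_spec
  rw [homMap, ← I'.el_comp, ← hr.gmap_comp]
  congr 2
  apply (I.el_bijective _ _ _).1
  refine (I.el_comp _ _).trans ?_
  exact (congrArg (I.el g ≫ ·) h).trans (Category.comp_id _)

/-- An action coherence gives an action on hom objects. -/
def enrichmentFunctor : EnrichmentFunctor E E' R where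
  T := hr.homMap I I'
  hom_T f := by rw [← I.el_ghom, el_homMap, gmap_ghom, I'.el_ghom]
  mul_T {u v a b c} f g := by
    obtain ⟨f, rfl⟩ := (I.el_bijective _ _ _).2 f
    obtain ⟨g, rfl⟩ := (I.el_bijective _ _ _).2 g
    simp only
    rw [← I.el_gmul, el_homMap, el_homMap, el_homMap, gmap_gmul, I'.el_gmul]
  wl_T a {v b c} f := by
    obtain ⟨f, rfl⟩ := (I.el_bijective _ _ _).2 f
    simp only
    rw [← I.el_gwl, el_homMap, el_homMap, ← I'.el_gwl, ← I'.el_post, ← I'.el_pre, gmap_gwl]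
  wr_T {v b c} f a := by
    obtain ⟨f, rfl⟩ := (I.el_bijective _ _ _).2 f
    simp only
    rw [← I.el_gwr, el_homMap, el_homMap, ← I'.el_gwr, ← I'.el_post, ← I'.el_pre, gmap_gwr]

/-- On generalized elements the map is `gmap` conjugated by bijections, so it is bijective for every
`v`, and Yoneda gives an inverse. -/
theorem isIso_homMap [RigidCategory D] [R.IsEquivalence] [∀ v, IsIso (r v)] (a b : C) :
    IsIso (hr.homMap I I' a b) := by
  have h (v : V) : Function.Bijective fun f : v ⟶ E.H a b => f ≫ hr.homMap I I' a b := by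
    rw [← Function.Bijective.of_comp_iff _ (I.el_bijective v a b)]
    have h1 := (I'.el_bijective v (R.obj a) (R.obj b)).comp (hr.gmap_bijective v a b)
    refine (funext fun g => ?_ : (_ ∘ _) = _) ▸ h1
    exact hr.el_homMap I I' g
  obtain ⟨s, hs⟩ := (h _).2 (𝟙 _)
  exact ⟨s, (h _).1 (by simpa using congrArg (hr.homMap I I' a b ≫ ·) hs), hs⟩

end ActionCoherence

end Central

end VEnriched

/-! ### `V`-monoidal functors as functors of enrichments, and back. -/

namespace VEnriched

open EnrichmentData Functor.LaxMonoidal Functor.OplaxMonoidal ForgetEnrichment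

variable {V : Type v} [Category.{w} V] [MonoidalCategory V] [BraidedCategory V]
  {A B : Type u} [EnrichedCategory V A] [EnrichedCategory V B]
  [VMonoidalCategory V A] [VMonoidalCategory V B]

theorem exists_comp_eq {V : Type v} [Category.{w} V] {X Y Z : V} (g : Y ⟶ Z) [IsIso g] (f : X ⟶ Z) :
    ∃ s : X ⟶ Y, s ≫ g = f := ⟨f ≫ inv g, by simp⟩

namespace VMonoidalFunctor

variable (M : VMonoidalFunctor V A B)

/-- The underlying functor. -/
abbrev functor : Und V A ⥤ Und V B := M.toEnrichedFunctor.forget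

theorem elTensor_naturality {u v : V} {a b c d : A} (f : u ⟶ (a ⟶[V] c)) (g : v ⟶ (b ⟶[V] d)) :
    elTensor (f ≫ M.map a c) (g ≫ M.map b d) ≫ postcomp V _ (homTo V (M.tensorIso c d).hom) =
      elTensor f g ≫ M.map _ _ ≫ precomp V (homTo V (M.tensorIso a b).hom) _ := by
  simp only [elTensor, Category.assoc, ← tensorHom_comp_tensorHom]
  rw [M.naturality]

/-- The naturality of the tensor constraint with the identity element in the first variable, which
the functor preserves. -/
theorem wl_map (a : Und V A) {v : V} {b c : Und V A} (f : v ⟶ (undEnrichment V A).H b c) :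
    (undEnrichment V B).post (a := of V (vObj V (M.obj a.to) (M.obj b.to)))
        (b := of V (vObj V (M.obj a.to) (M.obj c.to))) (c := M.functor.obj (a ⊗ c))
        ((undEnrichment V B).wl (M.functor.obj a) (b := M.functor.obj b) (c := M.functor.obj c)
          (f ≫ M.map b.to c.to)) (M.tensorIso a.to c.to).hom =
      (undEnrichment V B).pre (a := of V (vObj V (M.obj a.to) (M.obj b.to)))
        (b := M.functor.obj (a ⊗ b)) (c := M.functor.obj (a ⊗ c)) (M.tensorIso a.to b.to).hom
        ((undEnrichment V A).wl a f ≫ M.map _ _) := by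
  rw [undEnrichment_post, undEnrichment_pre]
  have h := M.elTensor_naturality (a := a.to) (b := b.to) (c := a.to) (d := c.to) (eId V a.to) f
  rw [M.map_id] at h
  have h1 := comp_tensorLeftMap (M.obj a.to) (f ≫ M.map b.to c.to)
  have h2 := comp_tensorLeftMap (b := b.to) (c := c.to) a.to f
  refine (congrArg (· ≫ postcomp V _ _) h1).trans ((Category.assoc _ _ _).trans
    ((congrArg (_ ≫ ·) h).trans ((Category.assoc _ _ _).symm.trans
    ((congrArg (· ≫ _) h2.symm).trans (Category.assoc _ _ _).symm))))

theorem wr_map {v : V} {b c : Und V A} (f : v ⟶ (undEnrichment V A).H b c) (a : Und V A) :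
    (undEnrichment V B).post (a := of V (vObj V (M.obj b.to) (M.obj a.to)))
        (b := of V (vObj V (M.obj c.to) (M.obj a.to))) (c := M.functor.obj (c ⊗ a))
        ((undEnrichment V B).wr (b := M.functor.obj b) (c := M.functor.obj c)
          (f ≫ M.map b.to c.to) (M.functor.obj a)) (M.tensorIso c.to a.to).hom =
      (undEnrichment V B).pre (a := of V (vObj V (M.obj b.to) (M.obj a.to)))
        (b := M.functor.obj (b ⊗ a)) (c := M.functor.obj (c ⊗ a)) (M.tensorIso b.to a.to).hom
        ((undEnrichment V A).wr f a ≫ M.map _ _) := by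
  rw [undEnrichment_post, undEnrichment_pre]
  have h := M.elTensor_naturality (a := b.to) (b := a.to) (c := c.to) (d := a.to) f (eId V a.to)
  rw [M.map_id] at h
  have h1 := comp_tensorRightMap (f ≫ M.map b.to c.to) (M.obj a.to)
  have h2 := comp_tensorRightMap (b := b.to) (c := c.to) f a.to
  refine (congrArg (· ≫ postcomp V _ _) h1).trans ((Category.assoc _ _ _).trans
    ((congrArg (_ ≫ ·) h).trans ((Category.assoc _ _ _).symm.trans
    ((congrArg (· ≫ _) h2.symm).trans (Category.assoc _ _ _).symm))))

/-- The underlying functor is monoidal. -/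
def coreMonoidal : M.functor.CoreMonoidal where
  εIso := M.unitIso
  μIso a b := M.tensorIso a.to b.to
  μIso_hom_natural_left {b c} f a := (undEnrichment V B).hom.injective (by
    have h := M.wr_map ((undEnrichment V A).hom f) a
    rw [(undEnrichment V A).wr_hom] at h
    refine (Enrichment.post_hom _ _ _).symm.trans (Eq.trans ?_ (h.trans
      (Enrichment.pre_hom _ _ (M.functor.map (f ▷ a)))))
    rw [← (undEnrichment V B).wr_hom]
    rfl)
  μIso_hom_natural_right {b c} a f := (undEnrichment V B).hom.injective (by
    have h := M.wl_map a ((undEnrichment V A).hom f)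
    rw [(undEnrichment V A).wl_hom] at h
    refine (Enrichment.post_hom _ _ _).symm.trans (Eq.trans ?_ (h.trans
      (Enrichment.pre_hom _ _ (M.functor.map (a ◁ f)))))
    rw [← (undEnrichment V B).wl_hom]
    rfl)
  associativity a b c := M.associativity a b c
  left_unitality a := (M.left_unitality a).symm
  right_unitality a := (M.right_unitality a).symm

instance : M.functor.Monoidal := M.coreMonoidal.toMonoidal

/-- The action on hom objects. -/
def enrichmentFunctor : EnrichmentFunctor (undEnrichment V A) (undEnrichment V B) M.functor where
  T a b := M.map a.to b.to
  hom_T f := rfl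
  mul_T {u v a b c} f g := by
    have h := M.map_comp a.to b.to c.to
    exact (Category.assoc _ _ _).trans ((congrArg ((f ⊗ₘ g) ≫ ·) h).trans
      ((Category.assoc _ _ _).symm.trans (congrArg (· ≫ eComp V _ _ _)
        (tensorHom_comp_tensorHom _ _ _ _))))
  wl_T a {v b c} f := M.wl_map a f
  wr_T {v b c} f a := M.wr_map f a

theorem IsEquivalence.isEquivalence_functor {M : VMonoidalFunctor V A B} (h : M.IsEquivalence) :
    M.functor.IsEquivalence where
  faithful := ⟨fun {a b f g} w => by
    have := h.1 a.to b.to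
    exact und_hom_ext ((cancel_mono (M.map a.to b.to)).1 (congrArg (homTo V) w))⟩
  full := ⟨fun {a b} f => by
    have := h.1 a.to b.to
    obtain ⟨s, hs⟩ := exists_comp_eq (M.map a.to b.to) (homTo V f)
    exact ⟨homOf V s, und_hom_ext hs⟩⟩
  essSurj := h.2

end VMonoidalFunctor

namespace EnrichmentFunctor

variable {R : Und V A ⥤ Und V B} [R.Monoidal]
  (S : EnrichmentFunctor (undEnrichment V A) (undEnrichment V B) R)

/-- The enriched functor given by an action on hom objects. -/
def toEnrichedFunctor : EnrichedFunctor V A B where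
  obj a := (R.obj (of V a)).to
  map a b := S.T (of V a) (of V b)
  map_id a := by
    have h := S.hom_T (𝟙 (of V a))
    rw [R.map_id] at h
    exact (congrArg (· ≫ S.T (of V a) (of V a)) (homTo_id V (of V a)).symm).trans
      (h.trans (homTo_id V _))
  map_comp a b c := by
    have h := S.mul_T (𝟙 ((undEnrichment V A).H (of V a) (of V b)))
      (𝟙 ((undEnrichment V A).H (of V b) (of V c)))
    simp only [mul, Category.id_comp, id_tensorHom_id] at h
    exact h

theorem forget_map {a b : Und V A} (f : a ⟶ b) :
    S.toEnrichedFunctor.forget.map f = R.map f := und_hom_ext (S.hom_T f)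

/-- The functor of `V`-monoidal categories given by an action on hom objects. -/
def toVMonoidalFunctor : VMonoidalFunctor V A B where
  toEnrichedFunctor := S.toEnrichedFunctor
  unitIso := Functor.Monoidal.εIso R
  tensorIso a b := Functor.Monoidal.μIso R (of V a) (of V b)
  naturality a b c d := by
    have h := S.wr_wl_T (𝟙 ((undEnrichment V A).H (of V a) (of V c)))
      (𝟙 ((undEnrichment V A).H (of V b) (of V d)))
    rw [Category.id_comp, Category.id_comp, undEnrichment_post, undEnrichment_pre] at h
    have h1 := elTensor_eq (a := a) (c := c) (b := b) (d := d) (𝟙 (a ⟶[V] c)) (𝟙 (b ⟶[V] d))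
    have h2 := elTensor_eq (a := (R.obj (of V a)).to) (c := (R.obj (of V c)).to)
      (b := (R.obj (of V b)).to) (d := (R.obj (of V d)).to)
      (S.T (of V a) (of V c)) (S.T (of V b) (of V d))
    rw [elTensor, id_tensorHom_id, Category.id_comp] at h1
    refine (Category.assoc _ _ _).symm.trans ((congrArg (· ≫ postcomp V _ _) h2).trans
      (h.trans ((Category.assoc _ _ _).trans ?_)))
    exact congrArg (· ≫ S.T (of V a ⊗ of V b) (of V c ⊗ of V d) ≫ precomp V _ _) h1.symm
  associativity a b c := (congrArg (fun t => _ ≫ _ ≫ t) (S.forget_map _)).trans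
    (Functor.LaxMonoidal.associativity R a b c)
  left_unitality a := (congrArg (fun t => _ ≫ _ ≫ t) (S.forget_map _)).trans
    (Functor.LaxMonoidal.left_unitality R a).symm
  right_unitality a := (congrArg (fun t => _ ≫ _ ≫ t) (S.forget_map _)).trans
    (Functor.LaxMonoidal.right_unitality R a).symm

end EnrichmentFunctor

namespace Enrichment

variable {C : Type u} [Category.{w} C] [MonoidalCategory C] (E : Enrichment V C)

theorem ofUnd_map_undTensor {a b c d : Und V E.Carrier} (f : a ⟶ c) (g : b ⟶ d) :
    E.ofUnd.map (undTensor V f g) = E.ofUnd.map f ⊗ₘ E.ofUnd.map g := by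
  rw [← E.ofUnd_map_toUnd_map (E.ofUnd.map f ⊗ₘ E.ofUnd.map g), ← undTensor_toUnd,
    toUnd_map_ofUnd_map, toUnd_map_ofUnd_map]
  rfl

theorem ofUnd_map_whiskerLeft (a : Und V E.Carrier) {b c : Und V E.Carrier} (f : b ⟶ c) :
    E.ofUnd.map (a ◁ f) = E.ofUnd.obj a ◁ E.ofUnd.map f := by
  refine (E.ofUnd_map_undTensor (𝟙 a) f).trans ?_
  rw [E.ofUnd.map_id, id_tensorHom]

theorem ofUnd_map_whiskerRight (a : Und V E.Carrier) {b c : Und V E.Carrier} (f : b ⟶ c) :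
    E.ofUnd.map (f ▷ a) = E.ofUnd.map f ▷ E.ofUnd.obj a := by
  refine (E.ofUnd_map_undTensor f (𝟙 a)).trans ?_
  rw [E.ofUnd.map_id, tensorHom_id]

/-- The tensor product of `E.Carrier` is that of `C` on objects, so the constraints can be taken to
be identities. -/
instance : E.ofUnd.Monoidal :=
  Functor.CoreMonoidal.toMonoidal
    { εIso := Iso.refl (𝟙_ C)
      μIso a b := Iso.refl (E.ofUnd.obj a ⊗ E.ofUnd.obj b)
      μIso_hom_natural_left f a := (Category.comp_id _).trans
        ((E.ofUnd_map_whiskerRight a f).symm.trans (Category.id_comp _).symm)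
      μIso_hom_natural_right a f := (Category.comp_id _).trans
        ((E.ofUnd_map_whiskerLeft a f).symm.trans (Category.id_comp _).symm)
      associativity a b c := by
        have h := E.ofUnd_map_toUnd_map (α_ (E.ofUnd.obj a) (E.ofUnd.obj b) (E.ofUnd.obj c)).hom
        refine (congrArg (fun t => _ ≫ _ ≫ t) h).trans ?_
        have e (x y z : C) : 𝟙 (x ⊗ y) ▷ z ≫ 𝟙 ((x ⊗ y) ⊗ z) ≫ (α_ x y z).hom =
            (α_ x y z).hom ≫ x ◁ 𝟙 (y ⊗ z) ≫ 𝟙 (x ⊗ y ⊗ z) := by simp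
        exact e _ _ _
      left_unitality a := by
        have h := E.ofUnd_map_toUnd_map (λ_ (E.ofUnd.obj a)).hom
        refine Eq.trans ?_ (congrArg (fun t => _ ≫ _ ≫ t) h.symm)
        have e (x : C) : (λ_ x).hom = 𝟙 (𝟙_ C) ▷ x ≫ 𝟙 (𝟙_ C ⊗ x) ≫ (λ_ x).hom := by simp
        exact e _
      right_unitality a := by
        have h := E.ofUnd_map_toUnd_map (ρ_ (E.ofUnd.obj a)).hom
        refine Eq.trans ?_ (congrArg (fun t => _ ≫ _ ≫ t) h.symm)
        have e (x : C) : (ρ_ x).hom = x ◁ 𝟙 (𝟙_ C) ≫ 𝟙 (x ⊗ 𝟙_ C) ≫ (ρ_ x).hom := by simp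
        exact e _ }

theorem undEnrichment_wl (a : Und V E.Carrier) {v : V} {b c : Und V E.Carrier}
    (f : v ⟶ (undEnrichment V E.Carrier).H b c) :
    (undEnrichment V E.Carrier).wl a f =
      E.wl (E.ofUnd.obj a) (b := E.ofUnd.obj b) (c := E.ofUnd.obj c) f :=
  congrArg (f ≫ ·) ((E.wl_id a.to b.to c.to).symm.trans (Category.id_comp _))

theorem undEnrichment_wr {v : V} {b c : Und V E.Carrier}
    (f : v ⟶ (undEnrichment V E.Carrier).H b c) (a : Und V E.Carrier) :
    (undEnrichment V E.Carrier).wr f a =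
      E.wr (b := E.ofUnd.obj b) (c := E.ofUnd.obj c) f (E.ofUnd.obj a) :=
  congrArg (f ≫ ·) ((E.wr_id a.to b.to c.to).symm.trans (Category.id_comp _))

theorem comp_ofUnd_T {v : V} {a b : Und V E.Carrier}
    (f : v ⟶ (undEnrichment V E.Carrier).H a b) :
    f ≫ 𝟙 (E.H (E.ofUnd.obj a) (E.ofUnd.obj b)) = f := Category.comp_id _

/-- The action on hom objects. -/
def ofUndEnrichmentFunctor : EnrichmentFunctor (undEnrichment V E.Carrier) E E.ofUnd where
  T a b := 𝟙 (E.H (E.ofUnd.obj a) (E.ofUnd.obj b))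
  hom_T f := (Category.comp_id _).trans (E.hom.apply_symm_apply _).symm
  mul_T {u v a b c} f g := by
    rw [comp_ofUnd_T, comp_ofUnd_T, comp_ofUnd_T]
    rfl
  wl_T a {v b c} f := by
    rw [comp_ofUnd_T, comp_ofUnd_T, undEnrichment_wl]
    exact (E.post_id _).trans (E.pre_id _).symm
  wr_T {v b c} f a := by
    rw [comp_ofUnd_T, comp_ofUnd_T, undEnrichment_wr]
    exact (E.post_id _).trans (E.pre_id _).symm

end Enrichment

end VEnriched

/-! ### Equivalence of module tensor categories is an equivalence relation. -/

namespace VEnriched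

open EnrichmentData Functor.LaxMonoidal Functor.OplaxMonoidal

variable {V : Type v} [Category.{w} V] [MonoidalCategory V] [BraidedCategory V]
  {C : Type u} [Category.{w} C] [MonoidalCategory C]
  {D : Type u} [Category.{w} D] [MonoidalCategory D]
  {D' : Type u} [Category.{w} D'] [MonoidalCategory D']

/-- Pastes two half-braiding squares, the image of the one for `f` under `R'` and the one for `f'`.
This is the half-braiding axiom of a composite functor. -/
theorem halfBraiding_map_comp {R' : D ⥤ D'} [R'.Monoidal] {a p q m : D} {p' : D'} {f : p ⟶ q}
    {f' : p' ⟶ R'.obj p} {β : a ⊗ p ⟶ p ⊗ a} {β' : R'.obj a ⊗ p' ⟶ p' ⊗ R'.obj a}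
    {h : q ⊗ a ⟶ m} {h' : a ⊗ q ⟶ m}
    (e : β ≫ f ▷ a ≫ h = a ◁ f ≫ h')
    (e' : β' ≫ f' ▷ R'.obj a ≫ μ R' p a = R'.obj a ◁ f' ≫ μ R' a p ≫ R'.map β) :
    β' ≫ (f' ≫ R'.map f) ▷ R'.obj a ≫ μ R' q a ≫ R'.map h =
      R'.obj a ◁ (f' ≫ R'.map f) ≫ μ R' a q ≫ R'.map h' := by
  rw [comp_whiskerRight, MonoidalCategory.whiskerLeft_comp, Category.assoc, Category.assoc,
    μ_natural_left_assoc, μ_natural_right_assoc, ← R'.map_comp, ← R'.map_comp, ← e, R'.map_comp,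
    reassoc_of% e', R'.map_comp, R'.map_comp]

variable {k : Type u₁} [Field k] [Preadditive V] [CategoryTheory.Linear k V]
  [Preadditive C] [CategoryTheory.Linear k C] [Preadditive D] [CategoryTheory.Linear k D]
  [Preadditive D'] [CategoryTheory.Linear k D']

theorem comp_comp_of_eq {C : Type u} [Category.{w} C] {x y z t : C} {f : x ⟶ y} {g : y ⟶ z}
    {p : x ⟶ z} (h : f ≫ g = p) (q : z ⟶ t) : f ≫ g ≫ q = p ≫ q := by
  rw [← h, Category.assoc]

theorem adj_hom_ext {C D : Type u} [Category.{w} C] [Category.{w} D] {R : C ⥤ D} {S : D ⥤ C}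
    (adj : R ⊣ S) {x : C} {y : D} {p q : x ⟶ S.obj y}
    (h : R.map p ≫ adj.counit.app y = R.map q ≫ adj.counit.app y) : p = q := by
  apply (adj.homEquiv x y).symm.injective
  rwa [adj.homEquiv_counit, adj.homEquiv_counit]

namespace ActionCoherence

theorem refl (F : CentralFunctor k V C) : ActionCoherence F F (𝟭 C) fun v => 𝟙 (F.ob v) where
  natural f := (Category.comp_id _).trans (Category.id_comp _).symm
  unit := (Category.id_comp _).trans (Category.comp_id _).symm
  tensor u v := by
    rw [id_tensorHom_id, Category.id_comp, Category.id_comp]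
    exact (Category.comp_id _).symm
  halfBraiding a v := by
    rw [MonoidalCategory.id_whiskerRight, MonoidalCategory.whiskerLeft_id, Category.id_comp,
      Category.id_comp]
    exact (Category.comp_id _).trans (Category.id_comp _).symm

variable {F : CentralFunctor k V C} {F' : CentralFunctor k V D} {F'' : CentralFunctor k V D'}

theorem comp {R : C ⥤ D} [R.Monoidal] {R' : D ⥤ D'} [R'.Monoidal]
    {r : ∀ v, F'.ob v ⟶ R.obj (F.ob v)} (hr : ActionCoherence F F' R r)
    {r' : ∀ v, F''.ob v ⟶ R'.obj (F'.ob v)} (hr' : ActionCoherence F' F'' R' r') :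
    ActionCoherence F F'' (R ⋙ R') fun v => r' v ≫ R'.map (r v) where
  natural f := by
    rw [← Category.assoc, hr'.natural, Category.assoc, ← R'.map_comp, hr.natural, R'.map_comp,
      Category.assoc]
    rfl
  unit := by
    rw [Functor.comp_map, Category.assoc, ← R'.map_comp, hr.unit, R'.map_comp,
      Functor.LaxMonoidal.comp_ε, ← Category.assoc, hr'.unit, Category.assoc]
  tensor u v := by
    rw [Functor.comp_map, Category.assoc, ← R'.map_comp, hr.tensor, R'.map_comp, R'.map_comp,
      Functor.LaxMonoidal.comp_μ, ← Category.assoc, hr'.tensor, Category.assoc, Category.assoc,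
      ← μ_natural_assoc, tensorHom_comp_tensorHom_assoc]
  halfBraiding a v := by
    refine (congrArg (fun t => _ ≫ _ ≫ t) (Functor.LaxMonoidal.comp_μ R R' _ _)).trans
      (Eq.trans ?_ (congrArg (fun t => _ ≫ t ≫ _) (Functor.LaxMonoidal.comp_μ R R' _ _)).symm)
    refine (VEnriched.halfBraiding_map_comp (hr.halfBraiding a v)
      (hr'.halfBraiding (R.obj a) v)).trans ?_
    rw [R'.map_comp, Category.assoc]
    rfl

section Symm

variable {R : C ⥤ D} {S : D ⥤ C} (adj : R ⊣ S)

variable [R.Monoidal] [S.Monoidal] [adj.IsMonoidal]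

/-- Equalities of morphisms into `S y` are tested after transposing along the adjunction. There `s`
becomes the inverse of `r` and, the adjunction being monoidal, the axioms reduce to those of `r`
solved for its inverse. -/
theorem of_mate {r : ∀ v, F'.ob v ⟶ R.obj (F.ob v)} [∀ v, IsIso (r v)]
    (hr : ActionCoherence F F' R r) {s : ∀ v, F.ob v ⟶ S.obj (F'.ob v)}
    (hs : ∀ v, R.map (s v) ≫ adj.counit.app (F'.ob v) = inv (r v)) :
    ActionCoherence F' F S s := by
  have hc {x y : D} (f : x ⟶ y) : R.map (S.map f) ≫ adj.counit.app y = adj.counit.app x ≫ f :=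
    adj.counit.naturality f
  have hδ {x y x' y' : C} (f : x ⟶ x') (g : y ⟶ y') : R.map (f ⊗ₘ g) ≫ δ R x' y' =
      δ R x y ≫ (R.map f ⊗ₘ R.map g) := (δ_natural R f g).symm
  have hμ (x y : D) : R.map (μ S x y) ≫ adj.counit.app (x ⊗ y) =
      δ R _ _ ≫ (adj.counit.app x ⊗ₘ adj.counit.app y) := adj.map_μ_comp_counit_app_tensor x y
  refine ⟨fun {u v} f => adj_hom_ext adj ?_, adj_hom_ext adj ?_, fun u v => adj_hom_ext adj ?_,
    fun d v => adj_hom_ext adj ?_⟩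
  · rw [R.map_comp, R.map_comp, Category.assoc, Category.assoc, hs, hc, comp_comp_of_eq (hs _),
      IsIso.eq_inv_comp, ← Category.assoc, IsIso.comp_inv_eq, hr.natural]
  · rw [R.map_comp, R.map_comp, Category.assoc, Category.assoc, hc, comp_comp_of_eq (hs _),
      adj.map_ε_comp_counit_app_unit, IsIso.inv_comp_eq, comp_comp_of_eq hr.unit,
      Category.assoc, Functor.Monoidal.ε_η, Category.comp_id]
  · have h : R.map (F.cotensor u v) ≫ δ R _ _ ≫ (inv (r u) ⊗ₘ inv (r v)) =
        inv (r (u ⊗ v)) ≫ F'.cotensor u v := by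
      rw [IsIso.eq_inv_comp, comp_comp_of_eq (hr.tensor u v), Category.assoc, Category.assoc,
        Functor.Monoidal.μ_δ_assoc,
        tensorHom_comp_tensorHom, IsIso.hom_inv_id, IsIso.hom_inv_id, id_tensorHom_id,
        Category.comp_id]
    rw [R.map_comp, R.map_comp, R.map_comp, Category.assoc, Category.assoc, Category.assoc, hc,
      comp_comp_of_eq (hs _), hμ, comp_comp_of_eq (hδ _ _), Category.assoc,
      tensorHom_comp_tensorHom, hs, hs, h]
  -- The half-braiding axiom of `r` at `S d`, with `r` and `μ R` moved to the other sides as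
  -- inverses.
  · have h : R.map (F.halfBraiding (S.obj d) v) ≫ δ R _ _ ≫ inv (r v) ▷ R.obj (S.obj d) =
        δ R _ _ ≫ R.obj (S.obj d) ◁ inv (r v) ≫ F'.halfBraiding (R.obj (S.obj d)) v := by
      have h1 := hr.halfBraiding (S.obj d) v
      rw [← cancel_epi (μ R (S.obj d) (F.ob v)), ← cancel_epi (R.obj (S.obj d) ◁ r v),
        ← Category.assoc (μ R _ _), ← Category.assoc (R.obj (S.obj d) ◁ r v), ← h1,
        Functor.Monoidal.μ_δ_assoc, ← MonoidalCategory.whiskerLeft_comp_assoc, IsIso.hom_inv_id,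
        MonoidalCategory.whiskerLeft_id, Category.id_comp, Category.assoc, Category.assoc,
        Functor.Monoidal.μ_δ_assoc, ← comp_whiskerRight, IsIso.hom_inv_id,
        MonoidalCategory.id_whiskerRight, Category.comp_id]
    simp only [R.map_comp, Category.assoc]
    rw [hc, hμ, ← tensorHom_id, ← id_tensorHom, comp_comp_of_eq (hδ _ _),
      comp_comp_of_eq (hμ _ _)]
    simp only [Category.assoc]
    rw [comp_comp_of_eq (hδ _ _)]
    simp only [Category.assoc]
    rw [tensorHom_comp_tensorHom, tensorHom_comp_tensorHom_assoc, hs, R.map_id,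
      Category.id_comp, MonoidalCategory.tensorHom_def, tensorHom_def', ← Category.assoc,
      ← Category.assoc, Category.assoc (R.map _), h]
    simp only [Category.assoc]
    exact congrArg (fun t => δ R (S.obj d) (F.ob v) ≫ R.obj (S.obj d) ◁ inv (r v) ≫ t)
      (F'.halfBraiding_naturality_left (adj.counit.app d) v).symm

theorem symm {r : ∀ v, F'.ob v ⟶ R.obj (F.ob v)} [∀ v, IsIso (r v)]
    (hr : ActionCoherence F F' R r) :
    ActionCoherence F' F S fun v => adj.homEquiv _ _ (inv (r v)) :=
  hr.of_mate adj fun v => (adj.homEquiv_counit _ _ _).symm.trans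
    ((adj.homEquiv (F.ob v) (F'.ob v)).symm_apply_apply (inv (r v)))

end Symm

end ActionCoherence

/-! ### Membership in the components of a grading. -/

section Grading

variable {G : Type u₂} [Group G] [Finite G] {deg : G → ObjectProperty C}

/-- When all other components of `e` vanish, the inclusion and the projection of the summand `x g`
are mutually inverse, so `c` is isomorphic to it. -/
theorem mem_of_components (h : IsObjectGrading deg) {c : C}
    {x : G → C} (hx : ∀ g, deg g (x g)) [HasBiproduct x] (e : c ≅ ⨁ x) {g : G}
    (hc : ∀ g', g' ≠ g → e.hom ≫ biproduct.π x g' = 0) : deg g c := by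
  have := h.replete g
  refine (deg g).prop_of_iso ?_ (hx g)
  refine ⟨biproduct.ι x g ≫ e.inv, e.hom ≫ biproduct.π x g, by simp, ?_⟩
  rw [← cancel_mono e.hom, ← cancel_epi e.inv]
  simp only [Category.assoc, Iso.inv_hom_id_assoc, Iso.inv_hom_id, Category.comp_id,
    Category.id_comp]
  refine biproduct.hom_ext _ _ fun j => ?_
  by_cases hj : j = g
  · subst hj; simp
  · have h0 : biproduct.π x j = 0 := by
      rw [← cancel_epi e.hom, hc j hj, comp_zero]
    rw [h0, comp_zero, comp_zero]

theorem mem_of_hom_eq_zero (h : IsObjectGrading deg) {c : C} {g : G}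
    (hc : ∀ (g' : G) (b : C), g' ≠ g → deg g' b → ∀ f : c ⟶ b, f = 0) : deg g c := by
  obtain ⟨x, hx, ⟨e⟩⟩ := h.exists_decomposition c
  have := h.additive
  exact mem_of_components h hx e fun g' hg => hc g' _ hg (hx g') _

/-- Let `x` be the summand of the unit in degree `g ≠ 1`, with projection `t` and inclusion `s`.
Then `x ◁ t` goes from degree `g` to degree `g * g`, so it vanishes. Exchanging the tensor factors
exhibits `t ≫ s ≫ t`, which equals `t`, as a composite through `x ◁ t`. -/
theorem unit_mem [MonoidalPreadditive C] (h : IsObjectGrading deg)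
    (h0 : ∀ (g g' : G) (a b : C), g ≠ g' → deg g a → deg g' b → ∀ f : a ⟶ b, f = 0) :
    deg 1 (𝟙_ C) := by
  obtain ⟨x, hx, ⟨e⟩⟩ := h.exists_decomposition (𝟙_ C)
  have := h.additive
  refine mem_of_components h hx e fun g hg => ?_
  have hst : (biproduct.ι x g ≫ e.inv) ≫ e.hom ≫ biproduct.π x g = 𝟙 _ := by simp
  generalize e.hom ≫ biproduct.π x g = t at hst ⊢
  generalize biproduct.ι x g ≫ e.inv = s at hst
  have h1 : x g ◁ t = 0 := by
    have h2 := h0 g (g * g) _ _ (fun hh => hg (by simpa using hh)) (hx g)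
      (h.tensor_mem g g _ _ (hx g) (hx g)) ((ρ_ _).inv ≫ x g ◁ t)
    rwa [← cancel_epi (ρ_ _).inv, comp_zero]
  have h2 : 𝟙_ C ◁ (t ≫ s) ≫ t ▷ 𝟙_ C = 0 := by
    rw [whisker_exchange, MonoidalCategory.whiskerLeft_comp, h1, zero_comp, comp_zero]
  have h3 : (λ_ (𝟙_ C)).inv ≫ (𝟙_ C ◁ (t ≫ s) ≫ t ▷ 𝟙_ C) ≫ (ρ_ _).hom = t ≫ s ≫ t := by
    rw [Category.assoc, rightUnitor_naturality, ← leftUnitor_inv_naturality_assoc,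
      unitors_inv_equal, Iso.inv_hom_id_assoc, Category.assoc]
  rw [h2, zero_comp, comp_zero, hst, Category.comp_id] at h3
  exact h3.symm

end Grading

namespace GradedVModTensCat

variable {G : Type u₂} {X Y Z : GradedVModTensCat.{w, v, u, u₁, u₂} k V G}

theorem equivalent_of_actionCoherence {R : X.carrier ⥤ Y.carrier} [R.Monoidal]
    [R.IsEquivalence] [R.Additive] {r : ∀ v, Y.F.ob v ⟶ R.obj (X.F.ob v)} [∀ v, IsIso (r v)]
    (hr : ActionCoherence X.F Y.F R r)
    (hdeg : ∀ (g : G) (c : X.carrier), X.deg g c → Y.deg g (R.obj c)) : X.Equivalent Y :=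
  ⟨R, inferInstance, NatIso.ofComponents (fun v => asIso (r v)) hr.natural, inferInstance,
    inferInstance, ⟨hr.unit, hr.tensor, hr.halfBraiding⟩, hdeg⟩

theorem Equivalent.exists_actionCoherence (h : X.Equivalent Y) :
    ∃ (R : X.carrier ⥤ Y.carrier) (_ : R.Monoidal) (r : ∀ v, Y.F.ob v ⟶ R.obj (X.F.ob v)),
      R.IsEquivalence ∧ R.Additive ∧ (∀ v, IsIso (r v)) ∧ ActionCoherence X.F Y.F R r ∧
      ∀ (g : G) (c : X.carrier), X.deg g c → Y.deg g (R.obj c) := by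
  obtain ⟨R, hR, r, h1, h2, h3, h4⟩ := h
  exact ⟨R, hR, fun v => r.hom.app v, h1, h2, inferInstance,
    ⟨fun f => r.hom.naturality f, h3.unit, h3.tensor, h3.halfBraiding⟩, h4⟩

theorem Equivalent.refl (X : GradedVModTensCat.{w, v, u, u₁, u₂} k V G) : X.Equivalent X :=
  equivalent_of_actionCoherence (ActionCoherence.refl X.F) fun _ _ h => h

theorem Equivalent.trans (h : X.Equivalent Y) (h' : Y.Equivalent Z) : X.Equivalent Z := by
  obtain ⟨R, _, r, _, _, _, hr, h1⟩ := h.exists_actionCoherence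
  obtain ⟨R', _, r', _, _, _, hr', h1'⟩ := h'.exists_actionCoherence
  have (v : V) : IsIso (r' v ≫ R'.map (r v)) := inferInstance
  exact equivalent_of_actionCoherence (hr.comp hr') fun g c hc => h1' g _ (h1 g c hc)

theorem equivalent_symm [Group G] [Finite G] (hX : X.IsGraded) (hY : Y.IsGraded)
    (e : X.carrier ≌ Y.carrier) [e.functor.Monoidal] [e.functor.Additive]
    {r : ∀ v, Y.F.ob v ⟶ e.functor.obj (X.F.ob v)} [∀ v, IsIso (r v)]
    (hr : ActionCoherence X.F Y.F e.functor r)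
    (hdeg : ∀ (g : G) (c : X.carrier), X.deg g c → Y.deg g (e.functor.obj c)) :
    Y.Equivalent X := by
  let _ := e.inverseMonoidal
  have : e.toAdjunction.IsMonoidal := ⟨rfl, fun _ _ => rfl⟩
  have (v : V) : IsIso (e.toAdjunction.homEquiv _ _ (inv (r v))) := by
    rw [e.toAdjunction.homEquiv_unit]
    infer_instance
  refine equivalent_of_actionCoherence (hr.symm e.toAdjunction) fun g d hd => ?_
  -- A morphism from the preimage of `d` to an object of degree `g' ≠ g` becomes, under the
  -- equivalence, a morphism from degree `g` to degree `g'`, hence zero.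
  refine mem_of_hom_eq_zero hX.toIsObjectGrading fun g' b hg hb f => ?_
  apply e.functor.map_injective
  rw [e.functor.map_zero]
  refine hY.hom_eq_zero g g' _ _ hg.symm ?_ (hdeg g' b hb) _
  have := hY.replete g
  exact (Y.deg g).prop_of_iso (e.counitIso.app d).symm hd

theorem Equivalent.symm [Group G] [Finite G] (hX : X.IsGraded) (hY : Y.IsGraded)
    (h : X.Equivalent Y) : Y.Equivalent X := by
  obtain ⟨R, h1, r, h2, h3, h4, hr, h5⟩ := h.exists_actionCoherence
  exact @equivalent_symm _ _ _ _ _ _ _ _ _ _ _ _ _ hX hY R.asEquivalence h1 h3 r h4 hr h5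

end GradedVModTensCat

end VEnriched

/-! ### Strongly universal elements and `V`-adjunctions. -/

namespace VEnriched

section

variable {V : Type v} [Category.{w} V] [MonoidalCategory V] [BraidedCategory V]
  {C : Type u} [Category.{w} C] [MonoidalCategory C]

namespace Enrichment

variable (E : Enrichment V C)

open EnrichmentData

/-- A generalized element `v ⟶ E.H a x` that represents the `V`-functor `[v, E.H a -]`. -/
def IsStronglyUniversal {v : V} {a x : C} (η : v ⟶ E.H a x) : Prop :=
  ∀ (w : V) (c : C), Function.Bijective fun k : w ⟶ E.H x c => E.mul η k

variable {E} {v : V} {a x y : C} {η : v ⟶ E.H a x}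

theorem IsStronglyUniversal.isUniversal (h : E.IsStronglyUniversal η) : E.IsUniversal η :=
  fun c => (((ρ_ v).symm.homFromEquiv (Z := E.H a c)).symm.bijective.comp (h (𝟙_ V) c)).comp
    E.hom.bijective

theorem IsStronglyUniversal.post_iso (h : E.IsStronglyUniversal η) (e : x ⟶ y) [IsIso e] :
    E.IsStronglyUniversal (E.post η e) := fun w c => by
  have h1 : (fun k : w ⟶ E.H y c => E.mul (E.post η e) k) =
      (fun k => E.mul η k) ∘ fun k => E.pre e k := funext fun k => post_mul ..
  rw [h1]
  refine (h w c).comp ⟨fun k k' hk => ?_, fun k => ⟨E.pre (inv e) k, ?_⟩⟩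
  · have := congrArg (E.pre (inv e)) hk
    simpa [pre_pre, pre_id] using this
  · simp [pre_pre, pre_id]

/-- Representing objects are unique up to isomorphism. So if one universal element for `v` and `a`
is strongly universal, they all are, and being tensored becomes a property of any chosen `F`. -/
theorem IsStronglyUniversal.of_isUniversal (h : E.IsStronglyUniversal η) {η' : v ⟶ E.H a y}
    (h' : E.IsUniversal η') : E.IsStronglyUniversal η' := by
  have h1 := h.post_iso (h.isUniversal.iso h').hom
  rwa [IsUniversal.iso_hom, IsUniversal.fac] at h1

/-- An element of `H a c` of shape `v ⊗ w` is `η` times an element of shape `w`, and that one is `θ`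
followed by a morphism. -/
theorem IsStronglyUniversal.mul (h : E.IsStronglyUniversal η) {w : V} {z : C}
    {θ : w ⟶ E.H x z} (hθ : E.IsUniversal θ) : E.IsUniversal (E.mul η θ) := fun c => by
  have h1 : (fun g : z ⟶ c => E.post (E.mul η θ) g) =
      (fun k => E.mul η k) ∘ fun g => E.post θ g := funext fun g => (mul_post ..).symm
  rw [h1]
  exact (h w c).comp (hθ c)

end Enrichment

end

section Adjunctions

open scoped MonoidalClosed
open MonoidalClosed

variable {V : Type v} [Category.{w} V] [MonoidalCategory V] {A : Type u} [EnrichedCategory V A]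

/-- A generalized element `v ⟶ A(a → x)` that represents the `V`-functor `[v, A(a → -)]`. -/
def IsVUniversal {v : V} {a x : A} (η : v ⟶ (a ⟶[V] x)) : Prop :=
  ∀ (w : V) (c : A), Function.Bijective fun k : w ⟶ (x ⟶[V] c) => elComp η k

theorem isStronglyUniversal_iff [BraidedCategory V] [VMonoidalCategory V A] {v : V}
    {a x : Und V A} {η : v ⟶ (undEnrichment V A).H a x} :
    (undEnrichment V A).IsStronglyUniversal η ↔ IsVUniversal (a := a.to) (x := x.to) η := 
  ⟨fun h w c => h w (ForgetEnrichment.of V c), fun h w c => h w c.to⟩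

variable [MonoidalClosed V]

/-- The hom objects of the self-enrichment. -/
abbrev selfHom (x y : V) : V := EnrichedCategory.Hom x y

/-- The transpose of a generalized element of a hom object of the self-enrichment. -/
def elUncurry {u x y : V} (f : u ⟶ (selfHom x y)) : x ⊗ u ⟶ y := uncurry f

/-- The generalized element of a hom object of the self-enrichment with a given transpose. -/
def elCurry {u x y : V} (f : x ⊗ u ⟶ y) : u ⟶ (selfHom x y) := curry f

theorem elUncurry_elCurry {u x y : V} (f : x ⊗ u ⟶ y) : elUncurry (elCurry f) = f :=
  uncurry_curry f

theorem elUncurry_injective {u x y : V} :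
    Function.Injective (elUncurry : (u ⟶ (selfHom x y)) → _) := uncurry_injective

theorem elUncurry_bijective {u x y : V} :
    Function.Bijective (elUncurry : (u ⟶ (selfHom x y)) → _) :=
  ⟨elUncurry_injective, fun f => ⟨elCurry f, elUncurry_elCurry f⟩⟩

theorem elUncurry_comp {u u' x y : V} (z : u' ⟶ u) (f : u ⟶ (selfHom x y)) :
    elUncurry (z ≫ f) = x ◁ z ≫ elUncurry f := uncurry_natural_left z f

theorem whiskerLeft_tensorHom_compTranspose {p q x y z : V} (f : p ⟶ (ihom x).obj y)
    (g : q ⟶ (ihom y).obj z) : x ◁ (f ⊗ₘ g) ≫ compTranspose x y z =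
      (α_ x p q).inv ≫ uncurry f ▷ q ≫ uncurry g := by
  rw [compTranspose_eq, uncurry_eq, uncurry_eq, comp_whiskerRight, Category.assoc,
    ← whisker_exchange_assoc, ← whisker_exchange_assoc, MonoidalCategory.tensorHom_def',
    MonoidalCategory.whiskerLeft_comp, Category.assoc,
    associator_inv_naturality_middle_assoc, associator_inv_naturality_right_assoc]

/-- Composition in the self-enrichment is composition of transposes, which allows equations between
its elements to be checked as plain equations in `V`. -/
theorem elUncurry_elComp {p q x y z : V} (f : p ⟶ selfHom x y) (g : q ⟶ selfHom y z) :
    elUncurry (elComp f g) = (α_ x p q).inv ≫ elUncurry f ▷ q ≫ elUncurry g :=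
  ((elUncurry_comp _ _).trans
    (congrArg (x ◁ (f ⊗ₘ g) ≫ ·) (uncurry_curry (compTranspose x y z)))).trans
    (whiskerLeft_tensorHom_compTranspose f g)

theorem elUncurry_eId (x : V) : elUncurry (eId V x) = (ρ_ x).hom := uncurry_curry _

theorem elUncurry_reprVFunctor (a : A) {u : V} {b c : A} (k : u ⟶ (b ⟶[V] c)) :
    elUncurry (k ≫ (reprVFunctor V a).map b c) = elComp (𝟙 (a ⟶[V] b)) k := by
  refine (elUncurry_comp _ _).trans ?_
  refine (congrArg ((a ⟶[V] b) ◁ k ≫ ·) (uncurry_curry (eComp V a b c))).trans ?_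
  rw [elComp, id_tensorHom]

/-- The unit of a `V`-adjunction with a representable functor. -/
def VAdjunction.unit {a : A} {L : EnrichedFunctor V V A} (adj : VAdjunction L (reprVFunctor V a))
    (v : V) : v ⟶ (a ⟶[V] L.obj v) :=
  (ρ_ v).inv ≫ elUncurry (eId V (L.obj v) ≫ (adj.homIso v (L.obj v)).hom)

/-- The enriched Yoneda lemma: a `V`-natural map out of a hom object is determined by its value on
the identity, here the unit. It is `naturality_right` applied to the identity of `L v`. -/
theorem VAdjunction.elUncurry_homIso {a : A} {L : EnrichedFunctor V V A}
    (adj : VAdjunction L (reprVFunctor V a)) {v w : V} {c : A} (k : w ⟶ (L.obj v ⟶[V] c)) :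
    elUncurry (k ≫ (adj.homIso v c).hom) = elComp (adj.unit v) k := by
  let t (c : A) : (L.obj v ⟶[V] c) ⟶ selfHom v (a ⟶[V] c) := (adj.homIso v c).hom
  let e : 𝟙_ V ⟶ selfHom v (a ⟶[V] L.obj v) := eId V (L.obj v) ≫ t (L.obj v)
  let r : w ⟶ selfHom (a ⟶[V] L.obj v) (a ⟶[V] c) := k ≫ (reprVFunctor V a).map (L.obj v) c
  have hr : elUncurry r = elComp (𝟙 (a ⟶[V] L.obj v)) k := elUncurry_reprVFunctor a k
  have hu : adj.unit v = (ρ_ v).inv ≫ elUncurry e := rfl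
  have h : elComp (eId V (L.obj v)) k ≫ t c = elComp e r :=
    (Category.assoc _ _ _).trans ((congrArg (_ ≫ ·) (adj.naturality_right v (L.obj v) c)).trans
      (tensorHom_comp_tensorHom_assoc ..))
  rw [eId_elComp, Category.assoc] at h
  change elUncurry (k ≫ t c) = _
  rw [← Iso.inv_hom_id_assoc (λ_ w) (k ≫ t c), h, elUncurry_comp, elUncurry_elComp, hr,
    ← comp_elComp, Category.comp_id, hu, comp_elComp, ← Category.assoc,
    triangle_assoc_comp_left_inv]

theorem VAdjunction.isVUniversal_unit {a : A} {L : EnrichedFunctor V V A}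
    (adj : VAdjunction L (reprVFunctor V a)) (v : V) : IsVUniversal (adj.unit v) := fun w c => by
  have h : (fun k : w ⟶ (L.obj v ⟶[V] c) => elComp (adj.unit v) k) =
      elUncurry ∘ fun k => k ≫ (adj.homIso v c).hom :=
    funext fun k => (adj.elUncurry_homIso k).symm
  rw [h]
  exact elUncurry_bijective.comp ((adj.homIso v c).homToEquiv).bijective

section OfUniversal

variable {a : A} {x : V → A} {η : ∀ v, v ⟶ (a ⟶[V] x v)}

/-- The transpose of the identity is the evaluation `u ⊗ [u, v] ⟶ v`; the equation is the naturality
of `η`, which dictates the action of the left adjoint on hom objects. -/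
theorem exists_vMap (hη : ∀ v, IsVUniversal (η v)) (u v : V) : ∃ l : (selfHom u v) ⟶ (x u ⟶[V] x v),
    elComp (η u) l = elUncurry (𝟙 (selfHom u v)) ≫ η v := (hη u _ _).2 _

theorem elComp_comp_vMap {u v : V} {l : (selfHom u v) ⟶ (x u ⟶[V] x v)}
    (hl : elComp (η u) l = elUncurry (𝟙 (selfHom u v)) ≫ η v) {w : V} (f : w ⟶ (selfHom u v)) :
    elComp (η u) (f ≫ l) = elUncurry f ≫ η v := by
  rw [elComp_comp, hl, ← Category.assoc, ← elUncurry_comp, Category.comp_id]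

/-- The `V`-functor given by representing elements of the `V`-functors `[v, A(a → -)]`. -/
def vFunctorOfUniversal (hη : ∀ v, IsVUniversal (η v)) : EnrichedFunctor V V A where
  obj := x
  map u v := (exists_vMap hη u v).choose
  map_id v := by
    refine (hη v _ _).1 ?_
    change elComp (η v) _ = elComp (η v) _
    rw [elComp_comp_vMap (exists_vMap hη v v).choose_spec, elUncurry_eId, elComp_eId]
  map_comp u v w := by
    refine (hη u _ _).1 ?_
    change elComp (η u) _ = elComp (η u) (elComp _ _)
    rw [elComp_comp_vMap (exists_vMap hη u w).choose_spec, ← cancel_epi (α_ _ _ _).hom,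
      ← elComp_assoc, (exists_vMap hη u v).choose_spec, comp_elComp,
      (exists_vMap hη v w).choose_spec]
    have h : eComp V u v w = elComp (𝟙 (selfHom u v)) (𝟙 (selfHom v w)) := by
      rw [elComp, id_tensorHom_id, Category.id_comp]
    rw [h, elUncurry_elComp]
    simp

theorem nonempty_vAdjunction (hη : ∀ v, IsVUniversal (η v)) :
    Nonempty (VAdjunction (vFunctorOfUniversal hη) (reprVFunctor V a)) := by
  let t (v : V) (c : A) : (x v ⟶[V] c) ⟶ selfHom v (a ⟶[V] c) := elCurry (elComp (η v) (𝟙 _))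
  have ht {w v : V} {c : A} (k : w ⟶ (x v ⟶[V] c)) : elUncurry (k ≫ t v c) = elComp (η v) k := by
    rw [elUncurry_comp, elUncurry_elCurry, ← elComp_comp, Category.comp_id]
  -- Up to transposition, composition with `t v c` is multiplication by `η v`, which is bijective on
  -- elements of every shape; Yoneda concludes.
  have hiso (v : V) (c : A) : IsIso (t v c) := isIso_of_yoneda_map_bijective _ fun w => by
    refine (Function.Bijective.of_comp_iff' elUncurry_bijective _).1 ?_
    convert hη v w c using 2 with k
    exact ht k
  let iso (v : V) (c : A) : (x v ⟶[V] c) ≅ selfHom v (a ⟶[V] c) := @asIso _ _ _ _ (t v c) (hiso v c)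
  have he {b b' c : A} : eComp V b b' c = elComp (𝟙 _) (𝟙 _) := by
    rw [elComp, id_tensorHom_id, Category.id_comp]
  let r (c c' : A) : (c ⟶[V] c') ⟶ selfHom (a ⟶[V] c) (a ⟶[V] c') := (reprVFunctor V a).map c c'
  have hr (c c' : A) : elUncurry (r c c') = elComp (𝟙 _) (𝟙 (c ⟶[V] c')) := by
    refine Eq.trans ?_ (elUncurry_reprVFunctor a (𝟙 (c ⟶[V] c')))
    exact congrArg elUncurry (Category.id_comp _).symm
  have h1 (v : V) (c c' : A) : eComp V (x v) c c' ≫ t v c' = elComp (t v c) (r c c') := by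
    apply elUncurry_injective
    rw [ht, elUncurry_elComp, elUncurry_elCurry, hr, ← comp_elComp, Category.comp_id,
      ← cancel_epi (α_ _ _ _).hom, Iso.hom_inv_id_assoc, he, ← elComp_assoc]
  have h2 (u v : V) (c : A) (l : selfHom u v ⟶ (x u ⟶[V] x v))
      (hl : elComp (η u) l = elUncurry (𝟙 (selfHom u v)) ≫ η v) :
      l ▷ (x v ⟶[V] c) ≫ eComp V (x u) (x v) c ≫ t u c = elComp (𝟙 (selfHom u v)) (t v c) := by
    apply elUncurry_injective
    rw [elUncurry_elComp, ← Category.assoc, ht, he, ← comp_elComp, ← cancel_epi (α_ _ _ _).hom,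
      ← elComp_assoc, elUncurry_elCurry, Iso.hom_inv_id_assoc, Category.comp_id, hl, comp_elComp]
  refine ⟨⟨iso, h1, fun u v c => (h2 u v c _ (exists_vMap hη u v).choose_spec).trans ?_⟩⟩
  rw [elComp, id_tensorHom]
  rfl

end OfUniversal

end Adjunctions

end VEnriched

/-! ### From graded `V`-monoidal categories to module tensor categories. -/

namespace VEnriched

section Central

variable {k : Type u₁} [Field k] {V : Type v} [Category.{w} V] [MonoidalCategory V]
  [BraidedCategory V] [Preadditive V] [CategoryTheory.Linear k V]
  {C : Type u} [Category.{w} C] [MonoidalCategory C] [Preadditive C] [CategoryTheory.Linear k C]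
  {E : Enrichment V C} {F : CentralFunctor k V C}

namespace Enrichment

/-- Under the dictionary with morphisms out of `a ⊗ F v`, multiplication by this element is
precomposition with the oplax structure, up to an associator. -/
theorem Induced.isStronglyUniversal_atL [RigidCategory C] (I : E.Induced F)
    (hF : ∀ u v, IsIso (F.cotensor u v)) (v : V) (a : C) :
    E.IsStronglyUniversal (E.atL (I.η v) a) := fun w c => by
  have h1 : (fun k : w ⟶ E.H (a ⊗ F.ob v) c => E.mul (E.atL (I.η v) a) k) ∘
      (fun g : (a ⊗ F.ob v) ⊗ F.ob w ⟶ c => I.el g) =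
      (fun g : a ⊗ F.ob (v ⊗ w) ⟶ c => I.el g) ∘
        fun g => a ◁ F.cotensor v w ≫ (α_ _ _ _).inv ≫ g := funext fun g => by
    have h2 : I.el (𝟙 (a ⊗ F.ob v)) = E.atL (I.η v) a := E.post_id _
    have h3 := I.el_gmul (𝟙 (a ⊗ F.ob v)) g
    rw [h2, CentralFunctor.gmul, MonoidalCategory.id_whiskerRight, Category.id_comp] at h3
    exact h3.symm
  rw [← Function.Bijective.of_comp_iff _ (I.el_bijective w (a ⊗ F.ob v) c), h1]
  refine (I.el_bijective _ _ _).comp ⟨fun g g' hg => ?_, fun g =>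
    ⟨(α_ _ _ _).hom ≫ a ◁ inv (F.cotensor v w) ≫ g, ?_⟩⟩
  · exact (cancel_epi (a ◁ F.cotensor v w ≫ (α_ _ _ _).inv)).1 (by simpa using hg)
  · simp only [Iso.inv_hom_id_assoc]
    rw [← MonoidalCategory.whiskerLeft_comp_assoc, IsIso.hom_inv_id,
      MonoidalCategory.whiskerLeft_id, Category.id_comp]

/-- The cotensor carries the universal element of `u ⊗ v` to a product that is universal because its
first factor is strongly universal. -/
theorem Induced.isIso_cotensor [RigidCategory C] (I : E.Induced F) {u : V}
    (h : E.IsStronglyUniversal (I.η u)) (v : V) : IsIso (F.cotensor u v) :=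
  (I.universal (u ⊗ v)).isIso_of_post (by
    rw [I.post_cotensor]
    exact h.mul ((I.universal v).atL (F.ob u) (ᘁ(F.ob u))))

theorem IsLinear.hom_zero (hE : E.IsLinear k) (a b : C) : E.hom (0 : a ⟶ b) = 0 := by
  simpa using hE.hom_smul (0 : k) (0 : a ⟶ b)

/-- Precomposition with `𝟙 a` fixes the identity of the hom object, and precomposition with zero
annihilates it. So a nonzero hom object yields a nonzero morphism, namely `𝟙 a`. -/
theorem IsLinear.isZero_of_id_eq_zero [MonoidalPreadditive V] (hE : E.IsLinear k) {a b : C}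
    (h : 𝟙 a = 0) : IsZero (E.H a b) := by
  rw [IsZero.iff_id_eq_zero, ← E.pre_id (𝟙 (E.H a b)), h, EnrichmentData.pre, EnrichmentData.mul,
    hE.hom_zero, MonoidalPreadditive.zero_tensor, zero_comp, comp_zero]

end Enrichment

end Central

variable {V : Type v} [Category.{w} V] [MonoidalCategory V] [BraidedCategory V]
  {G : Type u₂}

namespace GradedVMonCat

variable {𝒞 : GradedVMonCat.{w, v, u, u₂} V G}

theorem isWeaklyTensored_iff : 𝒞.IsWeaklyTensored ↔ ∀ (a : 𝒞.U) (v : V), ∃ (x : 𝒞.U)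
    (η : v ⟶ (undEnrichment V 𝒞.carrier).H a x), (undEnrichment V 𝒞.carrier).IsUniversal η :=
  ⟨fun h a => (isRightAdjoint_reprFunctor a).1 (h a.to),
    fun h a => (isRightAdjoint_reprFunctor (ForgetEnrichment.of V a)).2 (h _)⟩

section Preadditive

variable [Preadditive V]

theorem IsGraded.hom_eq_zero [Group G] [Finite G] (h : 𝒞.IsGraded) (g g' : G) (a b : 𝒞.U)
    (hg : g ≠ g')
    (ha : 𝒞.deg g a) (hb : 𝒞.deg g' b) (f : a ⟶ b) : f = 0 :=
  und_hom_ext ((h.isZero_hom g g' a b hg ha hb).eq_of_tgt _ _)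

theorem IsFaithful.isFaithful_toModTens {k : Type u₁} [Field k] [CategoryTheory.Linear k V]
    [MonoidalPreadditive V] [MonoidalLinear k V] (h : 𝒞.IsFaithful)
    (F : CentralFunctor k V 𝒞.U) : (𝒞.toModTens F).IsFaithful := fun g => by
  obtain ⟨a, b, ha, hb, hab⟩ := h g
  exact ⟨a, a, ha, ha, 𝟙 a, fun h0 =>
    hab ((undEnrichment_isLinear (V := V) (A := 𝒞.carrier) k).isZero_of_id_eq_zero h0)⟩

end Preadditive

variable [RigidCategory V]

open scoped MonoidalClosed in
theorem isTensored_iff : 𝒞.IsTensored ↔ ∀ (a : 𝒞.U) (v : V), ∃ (x : 𝒞.U)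
    (η : v ⟶ (undEnrichment V 𝒞.carrier).H a x),
      (undEnrichment V 𝒞.carrier).IsStronglyUniversal η := by
  let _ := monoidalClosedOfLeftRigidCategory V
  constructor
  · intro h a v
    obtain ⟨L, ⟨adj⟩⟩ := h a.to
    exact ⟨ForgetEnrichment.of V (L.obj v), adj.unit v,
      isStronglyUniversal_iff.2 (adj.isVUniversal_unit v)⟩
  · intro h a
    choose x η hη using h (ForgetEnrichment.of V a)
    exact ⟨_, nonempty_vAdjunction (a := a) (x := fun v => (x v).to)
      fun v => isStronglyUniversal_iff.1 (hη v)⟩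

theorem IsTensored.isWeaklyTensored (h : 𝒞.IsTensored) : 𝒞.IsWeaklyTensored :=
  isWeaklyTensored_iff.2 fun a v =>
    have ⟨x, η, hη⟩ := isTensored_iff.1 h a v
    ⟨x, η, hη.isUniversal⟩

section Grading

variable [Preadditive V] [Group G] [Finite G] {t : TensorKind} {strict : Bool}

theorem IsCell.isWeaklyTensored (h : 𝒞.IsCell t strict) : 𝒞.IsWeaklyTensored :=
  match t, h.2.2.2.2 with
  | .weaklyTensored, h => h
  | .tensored, h => IsTensored.isWeaklyTensored h

end Grading

variable {k : Type u₁} [Field k] [Preadditive V] [CategoryTheory.Linear k V]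
  [MonoidalPreadditive V] [MonoidalLinear k V]

variable {F : CentralFunctor k V 𝒞.U}

theorem isTensored_toModTens [RigidCategory 𝒞.U] (h : 𝒞.IsTensored)
    (I : (undEnrichment V 𝒞.carrier).Induced F) : (𝒞.toModTens F).IsTensored :=
  ⟨I.adjunction.isLeftAdjoint, fun u v =>
    have ⟨_, _, hη⟩ := isTensored_iff.1 h (𝟙_ 𝒞.U) u
    I.isIso_cotensor (hη.of_isUniversal (I.universal u)) v⟩

variable [Group G] [Finite G] {t : TensorKind} {strict : Bool}

theorem IsCell.exists_isInducedBy (h : 𝒞.IsCell t strict) :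
    ∃ F : CentralFunctor k V 𝒞.U, IsInducedBy 𝒞.carrier F := by
  obtain ⟨_⟩ := h.2.2.1
  choose x η hη using isWeaklyTensored_iff.1 h.isWeaklyTensored (𝟙_ 𝒞.U)
  let P : (undEnrichment V 𝒞.carrier).UnitRepresentation := ⟨x, η, hη⟩
  exact ⟨_, isInducedBy_of_induced (P.induced (undEnrichment_isLinear k))⟩

theorem IsGraded.isGraded_toModTens (h : 𝒞.IsGraded)
    (I : (undEnrichment V 𝒞.carrier).Induced F) : (𝒞.toModTens F).IsGraded where
  toIsObjectGrading := h.toIsObjectGrading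
  hom_eq_zero := h.hom_eq_zero
  -- Morphisms `F v ⟶ b` are elements `v ⟶ H 1 b`, and this hom object is zero when `b` has
  -- nontrivial degree, since the unit has degree `1`.
  functor_mem v := mem_of_hom_eq_zero h.toIsObjectGrading fun g b hg hb _ =>
    (I.universal v).ext ((h.isZero_hom 1 g _ b hg.symm
      (unit_mem h.toIsObjectGrading h.hom_eq_zero) hb).eq_of_tgt _ _)

theorem IsCell.isCell_toModTens (h : 𝒞.IsCell t strict)
    (I : (undEnrichment V 𝒞.carrier).Induced F) : (𝒞.toModTens F).IsCell t strict := by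
  obtain ⟨h1, h2, ⟨h3⟩, h4, h5⟩ := h
  refine ⟨h1.isGraded_toModTens I, h2.isFaithful_toModTens F, ⟨h3⟩, h4, ?_⟩
  match t, h5 with
  | .weaklyTensored, _ => exact I.adjunction.isLeftAdjoint
  | .tensored, h5 => exact isTensored_toModTens h5 I

end GradedVMonCat

end VEnriched

/-! ### From module tensor categories to graded `V`-monoidal categories. -/

namespace VEnriched

open ForgetEnrichment

namespace Enrichment

variable {V : Type v} [Category.{w} V] [MonoidalCategory V] [BraidedCategory V]
  {C : Type u} [Category.{w} C] [MonoidalCategory C] (E : Enrichment V C)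

theorem undEnrichment_post {v : V} {a b c : Und V E.Carrier}
    (f : v ⟶ (undEnrichment V E.Carrier).H a b) (g : b ⟶ c) :
    (undEnrichment V E.Carrier).post f g =
      E.post (a := E.ofUnd.obj a) (b := E.ofUnd.obj b) f (E.ofUnd.map g) := by
  have h : (undEnrichment V E.Carrier).hom g = E.hom (E.ofUnd.map g) :=
    (E.hom.apply_symm_apply _).symm
  exact congrArg (fun t => (ρ_ v).inv ≫ (f ⊗ₘ t) ≫ _) h

theorem IsUniversal.toUnd {E : Enrichment V C} {v : V} {a x : C} {η : v ⟶ E.H a x}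
    (h : E.IsUniversal η) :
    (undEnrichment V E.Carrier).IsUniversal (a := E.toUnd.obj a) (x := E.toUnd.obj x) η :=
  fun c => by
    have h1 := (h (E.ofUnd.obj c)).comp
      ((Functor.FullyFaithful.ofFullyFaithful E.ofUnd).map_bijective (E.toUnd.obj x) c)
    have h2 : (fun g => (undEnrichment V E.Carrier).post (a := E.toUnd.obj a)
        (b := E.toUnd.obj x) (c := c) η g) = _ :=
      funext fun g => E.undEnrichment_post (a := E.toUnd.obj a) (b := E.toUnd.obj x) η g
    exact h2 ▸ h1

theorem IsStronglyUniversal.toUnd {E : Enrichment V C} {v : V} {a x : C} {η : v ⟶ E.H a x}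
    (h : E.IsStronglyUniversal η) :
    (undEnrichment V E.Carrier).IsStronglyUniversal (a := E.toUnd.obj a) (x := E.toUnd.obj x) η :=
  fun w c => h w (E.ofUnd.obj c)

theorem isStrictMonoidal_und (h : IsStrictMonoidal C) : IsStrictMonoidal (Und V E.Carrier) where
  assoc_obj a b c := congrArg E.toUnd.obj (h.assoc_obj a.to.out b.to.out c.to.out)
  one_obj a := congrArg E.toUnd.obj (h.one_obj a.to.out)
  obj_one a := congrArg E.toUnd.obj (h.obj_one a.to.out)
  associator _ _ _ := (congrArg E.toUnd.map (h.associator _ _ _)).trans (eqToHom_map _ _)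
  leftUnitor _ := (congrArg E.toUnd.map (h.leftUnitor _)).trans (eqToHom_map _ _)
  rightUnitor _ := (congrArg E.toUnd.map (h.rightUnitor _)).trans (eqToHom_map _ _)

theorem nonempty_rigidCategory_und [RigidCategory C] : Nonempty (RigidCategory (Und V E.Carrier)) :=
  let _ : E.ofUnd.asEquivalence.functor.Monoidal := inferInstanceAs E.ofUnd.Monoidal
  ⟨rigidCategoryOfEquivalence E.ofUnd.asEquivalence.toAdjunction⟩

section Linear

variable {k : Type u₁} [Field k] [Preadditive V] [CategoryTheory.Linear k V]
  [Preadditive C] [CategoryTheory.Linear k C] {E}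

theorem IsLinear.additive_ofUnd (hE : E.IsLinear k) : E.ofUnd.Additive where
  map_add {a b f g} := E.hom.injective (by
    rw [hE.hom_add]
    refine (E.hom.apply_symm_apply _).trans ?_
    exact congrArg₂ (· + ·) (E.hom.apply_symm_apply (homTo V f)).symm
      (E.hom.apply_symm_apply (homTo V g)).symm)

/-- Products transfer along the equivalence with `C`, and in a preadditive category finite products
are biproducts. -/
theorem hasFiniteBiproducts_und (E : Enrichment V C) [HasFiniteBiproducts C] :
    HasFiniteBiproducts (Und V E.Carrier) := by
  have : HasFiniteProducts (Und V E.Carrier) :=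
    ⟨fun n => Adjunction.hasLimitsOfShape_of_equivalence E.ofUnd⟩
  exact HasFiniteBiproducts.of_hasFiniteProducts

variable {G : Type u₂} [Group G] [Finite G] {deg : G → ObjectProperty C}

theorem IsLinear.isObjectGrading_und (hE : E.IsLinear k) (h : IsObjectGrading deg) :
    IsObjectGrading fun g => (deg g).inverseImage E.ofUnd := by
  have := h.additive
  have := E.hasFiniteBiproducts_und
  have := hE.additive_ofUnd
  refine { additive := inferInstance, replete := fun g => ?_, exists_decomposition := fun c => ?_,
           tensor_mem := fun g g' a b ha hb => h.tensor_mem g g' _ _ ha hb }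
  · have := h.replete g
    infer_instance
  · obtain ⟨x, hx, ⟨e⟩⟩ := h.exists_decomposition (E.ofUnd.obj c)
    have := preservesBiproductsOfShape_of_preservesProductsOfShape (J := G) E.ofUnd
    refine ⟨fun g => E.toUnd.obj (x g), hx, ⟨E.ofUnd.preimageIso (e ≪≫ ?_)⟩⟩
    exact (E.ofUnd.mapBiproduct fun g => E.toUnd.obj (x g)).symm

end Linear

end Enrichment

namespace GradedVModTensCat

variable {k : Type u₁} [Field k] {V : Type v} [Category.{w} V] [MonoidalCategory V]
  [BraidedCategory V] [Preadditive V] [CategoryTheory.Linear k V] {G : Type u₂}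

section

variable {C D : Type u} [Category.{w} C] [Category.{w} D] [Preadditive C] [Preadditive D]
  [CategoryTheory.Linear k C] [CategoryTheory.Linear k D] [MonoidalCategory C] [MonoidalCategory D]
  [MonoidalPreadditive C] [MonoidalPreadditive D] [MonoidalLinear k C] [MonoidalLinear k D]
  {F : CentralFunctor k V C} {F' : CentralFunctor k V D} {deg : G → ObjectProperty C}
  {deg' : G → ObjectProperty D}

theorem equivalent_mk {R : C ⥤ D} [R.Monoidal] [R.IsEquivalence] [R.Additive]
    {r : ∀ v, F'.ob v ⟶ R.obj (F.ob v)} (hr : ActionCoherence F F' R r) (h : ∀ v, IsIso (r v))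
    (hdeg : ∀ (g : G) (c : C), deg g c → deg' g (R.obj c)) :
    GradedVModTensCat.Equivalent ⟨C, F, deg⟩ ⟨D, F', deg'⟩ :=
  ⟨R, inferInstance, NatIso.ofComponents (fun v => @asIso _ _ _ _ (r v) (h v)) hr.natural,
    inferInstance, inferInstance, ⟨hr.unit, hr.tensor, hr.halfBraiding⟩, hdeg⟩

theorem exists_of_equivalent_mk (h : GradedVModTensCat.Equivalent ⟨C, F, deg⟩ ⟨D, F', deg'⟩) :
    ∃ (R : C ⥤ D) (_ : R.Monoidal) (r : ∀ v, F'.ob v ⟶ R.obj (F.ob v)),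
      R.IsEquivalence ∧ R.Additive ∧ (∀ v, IsIso (r v)) ∧ ActionCoherence F F' R r ∧
      ∀ (g : G) (c : C), deg g c → deg' g (R.obj c) := by
  obtain ⟨R, hR, r, h1, h2, h3, h4⟩ := h
  exact ⟨R, hR, fun v => r.hom.app v, h1, h2,
    fun v => inferInstanceAs (IsIso (r.hom.app v)),
    ⟨fun f => r.hom.naturality f, h3.unit, h3.tensor, h3.halfBraiding⟩, h4⟩

end

variable {X : GradedVModTensCat.{w, v, u, u₁, u₂} k V G} (I : X.F.InternalHoms)

/-- The graded `V`-monoidal category with the same objects whose hom objects are the internal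
homs. -/
def toVMon : GradedVMonCat.{w, v, u, u₂} V G where
  carrier := I.enrichment.Carrier
  deg g := (X.deg g).inverseImage I.enrichment.ofUnd

theorem IsFaithful.isFaithful_toVMon (h : X.IsFaithful) : (toVMon I).IsFaithful := fun g => by
  obtain ⟨a, b, ha, hb, f, hf⟩ := h g
  refine ⟨I.enrichment.toUnd.obj a, I.enrichment.toUnd.obj b, ha, hb, fun h0 => hf ?_⟩
  exact I.enrichment.hom.injective (h0.eq_of_tgt _ _)

section

variable [MonoidalPreadditive V] [MonoidalLinear k V]

/-- The original functor `X.F` and `F` are induced by enrichments that `ofUnd` identifies, so the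
comparison of their universal elements is an action coherence. -/
theorem equivalent_of_isInducedBy [RigidCategory X.carrier]
    {F : CentralFunctor k V (Und V I.enrichment.Carrier)}
    (hF : IsInducedBy I.enrichment.Carrier F) :
    GradedVModTensCat.Equivalent ((toVMon I).toModTens F) X := by
  obtain ⟨I'⟩ := nonempty_induced hF
  let S := I.enrichment.ofUndEnrichmentFunctor
  have (a b : Und V I.enrichment.Carrier) : IsIso (S.T a b) :=
    inferInstanceAs (IsIso (𝟙 (I.enrichment.H _ _)))
  have := I.isLinear.additive_ofUnd
  have h := S.actionCoherence I' I.induced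
  have hi := S.isIso_comparison I' I.induced
  have e := equivalent_mk (deg := fun g => (X.deg g).inverseImage I.enrichment.ofUnd)
    (deg' := X.deg) h hi fun _ _ h => h
  exact e

end

variable [Group G] [Finite G]

theorem IsGraded.isGraded_toVMon (h : X.IsGraded) : (toVMon I).IsGraded where
  toIsObjectGrading := I.isLinear.isObjectGrading_und h.toIsObjectGrading
  isZero_hom g g' a b hg ha hb := by
    -- Elements of the hom object are morphisms `a ⊗ F v ⟶ b`. Their source still has degree `g`,
    -- because `F v` has degree `1`.
    have h1 {v : V} (f f' : v ⟶ I.enrichment.H (I.enrichment.ofUnd.obj a)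
        (I.enrichment.ofUnd.obj b)) : f = f' := I.elEquiv.injective (by
      have h2 := h.hom_eq_zero g g' (I.enrichment.ofUnd.obj a ⊗ X.F.ob v) _ hg
        (by simpa using h.tensor_mem g 1 _ _ ha (h.functor_mem v)) hb
      rw [h2 (I.elEquiv f), h2 (I.elEquiv f')])
    exact (IsZero.iff_id_eq_zero _).2 (h1 _ _)

variable {t : TensorKind} {strict : Bool}

theorem IsCell.isLeftAdjoint (h : X.IsCell t strict) : X.F.functor.IsLeftAdjoint :=
  match t, h.2.2.2.2 with
  | .weaklyTensored, h => h
  | .tensored, h => h.1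

variable [RigidCategory V]

theorem IsCell.isCell_toVMon (h : X.IsCell t strict) : (toVMon I).IsCell t strict := by
  obtain ⟨h1, h2, ⟨_⟩, h4, h5⟩ := h
  refine ⟨h1.isGraded_toVMon I, h2.isFaithful_toVMon I, I.enrichment.nonempty_rigidCategory_und,
    fun hs => I.enrichment.isStrictMonoidal_und (h4 hs), ?_⟩
  match t, h5 with
  | .weaklyTensored, _ =>
    exact GradedVMonCat.isWeaklyTensored_iff.2 fun a v =>
      ⟨_, _, ((I.induced.universal v).atL (I.enrichment.ofUnd.obj a)
        (ᘁ(I.enrichment.ofUnd.obj a))).toUnd⟩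
  | .tensored, h5 =>
    -- The representing object at `a` is `a ⊗ F v`, as in the weakly tensored case; invertibility of
    -- the oplax structure makes its element strongly universal.
    exact GradedVMonCat.isTensored_iff.2 fun a v =>
      ⟨_, _, (I.induced.isStronglyUniversal_atL h5.2 v (I.enrichment.ofUnd.obj a)).toUnd⟩

end GradedVModTensCat

end VEnriched

/-! ### Comparison of the two notions of equivalence, and the bijection. -/

namespace VEnriched

theorem equivalence_modTensEquiv (k : Type u₁) [Field k] (V : Type v) [Category.{w} V]
    [MonoidalCategory V] [BraidedCategory V] [Preadditive V] [CategoryTheory.Linear k V]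
    (G : Type u₂) [Group G] [Finite G] (t : TensorKind) (strict : Bool) :
    _root_.Equivalence (modTensEquiv.{w, v, u, u₁, u₂} k V G t strict) where
  refl X := GradedVModTensCat.Equivalent.refl X.1
  symm {X Y} h := GradedVModTensCat.Equivalent.symm X.2.1 Y.2.1 h
  trans h h' := GradedVModTensCat.Equivalent.trans h h'

variable {k : Type u₁} [Field k] {V : Type v} [Category.{w} V] [MonoidalCategory V]
  [BraidedCategory V] [Preadditive V] [CategoryTheory.Linear k V] [MonoidalPreadditive V]
  [MonoidalLinear k V] {G : Type u₂}

section

variable {A B : Type u} [EnrichedCategory V A] [EnrichedCategory V B] [VMonoidalCategory V A]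
  [VMonoidalCategory V B] {F : CentralFunctor k V (Und V A)} {F' : CentralFunctor k V (Und V B)}
  {deg : G → ObjectProperty (Und V A)} {deg' : G → ObjectProperty (Und V B)}
  [RigidCategory (Und V B)]

theorem equivalent_of_isEquivalence (I : (undEnrichment V A).Induced F)
    (I' : (undEnrichment V B).Induced F') {M : VMonoidalFunctor V A B}
    (hM : M.IsEquivalence) (hadd : M.functor.Additive)
    (hdeg : ∀ (g : G) (c : Und V A), deg g c → deg' g (M.functor.obj c)) :
    GradedVModTensCat.Equivalent ⟨Und V A, F, deg⟩ ⟨Und V B, F', deg'⟩ := by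
  have := hM.isEquivalence_functor
  have (a b : Und V A) : IsIso (M.enrichmentFunctor.T a b) := hM.1 a.to b.to
  exact GradedVModTensCat.equivalent_mk (M.enrichmentFunctor.actionCoherence I I')
    (M.enrichmentFunctor.isIso_comparison I I') hdeg

/-- The action coherence supplies the maps on hom objects, and these have `R` as underlying functor,
so additivity and degrees carry over. -/
theorem exists_vMonoidalFunctor (I : (undEnrichment V A).Induced F)
    (I' : (undEnrichment V B).Induced F') [RigidCategory (Und V A)]
    (h : GradedVModTensCat.Equivalent ⟨Und V A, F, deg⟩ ⟨Und V B, F', deg'⟩) :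
    ∃ M : VMonoidalFunctor V A B, M.IsEquivalence ∧ M.functor.Additive ∧
      ∀ (g : G) (c : Und V A), deg g c → deg' g (M.functor.obj c) := by
  obtain ⟨R, _, r, _, _, _, hr, hdeg⟩ := GradedVModTensCat.exists_of_equivalent_mk h
  let S := hr.enrichmentFunctor I I'
  refine ⟨S.toVMonoidalFunctor, ⟨fun a b => hr.isIso_homMap I I' (ForgetEnrichment.of V a)
    (ForgetEnrichment.of V b), ⟨fun b => ?_⟩⟩, ⟨fun {a b f g} => ?_⟩, hdeg⟩
  · exact ⟨R.objPreimage b, ⟨R.objObjPreimageIso b⟩⟩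
  · exact (S.forget_map _).trans (R.map_add.trans
      (congrArg₂ (· + ·) (S.forget_map f).symm (S.forget_map g).symm))

end

namespace GradedVMonCat

variable {𝒞 𝒟 : GradedVMonCat.{w, v, u, u₂} V G} {F : CentralFunctor k V 𝒞.U}
  {F' : CentralFunctor k V 𝒟.U}

theorem equivalent_iff [RigidCategory 𝒞.U] [RigidCategory 𝒟.U]
    (I : (undEnrichment V 𝒞.carrier).Induced F) (I' : (undEnrichment V 𝒟.carrier).Induced F') :
    𝒞.Equivalent 𝒟 ↔ GradedVModTensCat.Equivalent (𝒞.toModTens F) (𝒟.toModTens F') :=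
  ⟨fun ⟨_, hM, hadd, hdeg⟩ => equivalent_of_isEquivalence I I' hM hadd hdeg,
    fun h => exists_vMonoidalFunctor I I' h⟩

variable [RigidCategory V] [Group G] [Finite G] {t : TensorKind} {strict : Bool}

theorem IsCell.equivalent_iff (h𝒞 : 𝒞.IsCell t strict) (h𝒟 : 𝒟.IsCell t strict)
    (hF : IsInducedBy 𝒞.carrier F) (hF' : IsInducedBy 𝒟.carrier F') :
    𝒞.Equivalent 𝒟 ↔ GradedVModTensCat.Equivalent (𝒞.toModTens F) (𝒟.toModTens F') := by
  obtain ⟨_⟩ := h𝒞.2.2.1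
  obtain ⟨_⟩ := h𝒟.2.2.1
  obtain ⟨I⟩ := nonempty_induced hF
  obtain ⟨I'⟩ := nonempty_induced hF'
  exact GradedVMonCat.equivalent_iff I I'

theorem IsCell.isCell_of_isInducedBy (h : 𝒞.IsCell t strict) (hF : IsInducedBy 𝒞.carrier F) :
    (𝒞.toModTens F).IsCell t strict :=
  have ⟨I⟩ := nonempty_induced hF
  h.isCell_toModTens I

end GradedVMonCat

theorem GradedVModTensCat.IsCell.exists_equivalent [RigidCategory V] [Group G] [Finite G]
    {t : TensorKind} {strict : Bool} {X : GradedVModTensCat.{w, v, u, u₁, u₂} k V G}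
    (hX : X.IsCell t strict) : ∃ 𝒞 : GradedVMonCat.{w, v, u, u₂} V G, 𝒞.IsCell t strict ∧
      ∀ F : CentralFunctor k V 𝒞.U, IsInducedBy 𝒞.carrier F →
        GradedVModTensCat.Equivalent (𝒞.toModTens F) X := by
  obtain ⟨_⟩ := hX.2.2.1
  obtain ⟨I⟩ := CentralFunctor.nonempty_internalHoms X.F hX.isLeftAdjoint
  exact ⟨toVMon I, hX.isCell_toVMon I, fun F hF => equivalent_of_isInducedBy I hF⟩

end VEnriched

end

theorem mainTheorem2 (k : Type u₁) [Field k]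
    (V : Type v) [Category.{w} V] [MonoidalCategory V] [BraidedCategory V] [RigidCategory V]
    [Preadditive V] [CategoryTheory.Linear k V] [MonoidalPreadditive V] [MonoidalLinear k V]
    [HasFiniteBiproducts V] (G : Type u₂) [Group G] [Finite G]
    (t : VEnriched.TensorKind) (strict : Bool) :
    _root_.Equivalence (VEnriched.monEquiv.{w, v, u, u₂} V G t strict) ∧
    _root_.Equivalence (VEnriched.modTensEquiv.{w, v, u, u₁, u₂} k V G t strict) ∧
    ∃ Φ : Quot (VEnriched.monEquiv.{w, v, u, u₂} V G t strict) ≃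
        Quot (VEnriched.modTensEquiv.{w, v, u, u₁, u₂} k V G t strict),
      ∀ 𝒞 : VEnriched.VMonCell.{w, v, u, u₂} V G t strict,
        (∃ F : VEnriched.CentralFunctor k V 𝒞.1.U, VEnriched.IsInducedBy 𝒞.1.carrier F) ∧
        ∀ F : VEnriched.CentralFunctor k V 𝒞.1.U, VEnriched.IsInducedBy 𝒞.1.carrier F →
          ∃ h : (𝒞.1.toModTens F).IsCell t strict,
            Φ (Quot.mk _ 𝒞) = Quot.mk _ ⟨𝒞.1.toModTens F, h⟩ := by
  have hmod := VEnriched.equivalence_modTensEquiv.{w, v, u, u₁, u₂} k V G t strict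
  -- The induced functor is chosen once for each category; the last step of the proof shows that its
  -- class does not depend on the choice.
  choose F hF using fun 𝒞 : VEnriched.VMonCell.{w, v, u, u₂} V G t strict =>
    𝒞.2.exists_isInducedBy (k := k)
  let f (𝒞 : VEnriched.VMonCell.{w, v, u, u₂} V G t strict) :
      VEnriched.VModTensCell.{w, v, u, u₁, u₂} k V G t strict :=
    ⟨𝒞.1.toModTens (F 𝒞), 𝒞.2.isCell_of_isInducedBy (hF 𝒞)⟩
  have hf (𝒞 𝒟 : VEnriched.VMonCell.{w, v, u, u₂} V G t strict) :
      VEnriched.monEquiv V G t strict 𝒞 𝒟 ↔ VEnriched.modTensEquiv k V G t strict (f 𝒞) (f 𝒟) :=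
    𝒞.2.equivalent_iff 𝒟.2 (hF 𝒞) (hF 𝒟)
  -- By `hf` this relation is the pullback of the module-side relation along `f`, so no enriched
  -- functor has to be composed or inverted.
  have hmon : _root_.Equivalence (VEnriched.monEquiv.{w, v, u, u₂} V G t strict) :=
    ⟨fun 𝒞 => (hf _ _).2 (hmod.refl _), fun h => (hf _ _).2 (hmod.symm ((hf _ _).1 h)),
      fun h h' => (hf _ _).2 (hmod.trans ((hf _ _).1 h) ((hf _ _).1 h'))⟩
  refine ⟨hmon, hmod, Equiv.ofBijective (Quot.map f fun 𝒞 𝒟 => (hf 𝒞 𝒟).1) ⟨?_, ?_⟩,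
    fun 𝒞 => ⟨⟨F 𝒞, hF 𝒞⟩, fun F' hF' => ⟨𝒞.2.isCell_of_isInducedBy hF', ?_⟩⟩⟩
  · rintro ⟨𝒞⟩ ⟨𝒟⟩ h
    exact Quot.sound ((hf 𝒞 𝒟).2 ((hmod.eqvGen_iff).1 (Quot.eqvGen_exact h)))
  · rintro ⟨X⟩
    obtain ⟨𝒞, h𝒞, h⟩ := X.2.exists_equivalent
    exact ⟨Quot.mk _ ⟨𝒞, h𝒞⟩, Quot.sound (h _ (hF ⟨𝒞, h𝒞⟩))⟩
  -- Two functors induced by the same `𝒞` give equivalent module tensor categories, because `𝒞` is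
  -- equivalent to itself.
  · exact Quot.sound ((𝒞.2.equivalent_iff 𝒞.2 (hF 𝒞) hF').1 (hmon.refl 𝒞))
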